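/- **Setting.** Let $\mathbf T^2=(\mathbf R/\mathbf Z)^2$ with its Lebesgue probability measure and $M(v)=\frac1{2\pi}e^{-|v|^2/2}$ on $\mathbf R^2$. For $\rho_*$ with $\int_{\mathbf T^2}\rho_*=1$ and $\delta>0$, let $\phi_\infty\in H^1(\mathbf T^2)$ be the weak solution of $-\delta^2\Delta\phi_\infty=e^{-\phi_\infty}-\rho_*$, put $f_\infty(x,v)=M(v)e^{-\phi_\infty(x)}$, $d\mu=f_\infty\,dx\,dv$, $\mathcal H=L^2(\mathbf T^2\times\mathbf R^2,\mu)$ with norm $\|\cdot\|$ and scalar product $\langle\cdot,\cdot\rangle$, and $\mathcal H_0=\{h\in\mathcal H:\int h\,d\mu=0\}$. Let $A=\nabla_v$, $C=\nabla_x$ (weak derivatives) and $A^*=v-\nabla_v$, so that $A^*\cdot Ah=v\cdot\nabla_vh-\Delta_vh$; $A^2h$ and $ACh$ denote the matrices $(\partial_{v_i}\partial_{v_j}h)$ and $(\partial_{v_i}\partial_{x_j}h)$. A norm of a derivative of $h$ is $+\infty$ if that derivative does not exist in $L^2(\mu)$ (and $\|A^*\cdot Ah\|=+\infty$ if $Ah$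 or $A^2h$ is not in $L^2(\mu)$); all functionals below take values in $[0,\infty]$, with $0\cdot\infty=0$. For $h\in\mathcal H_0$ the electric field is $E=\delta^{-2}\nabla\Delta^{-1}n$ with $n=\int_{\mathbf R^2}hf_\infty\,dv$. For $\beta\in\mathbf R^3$, $\gamma\in(0,\infty)^3$, $\tau>0$, $t\ge0$, write $m=\min(1,t/\tau)$ and $$|||h|||_t^2=\|h\|^2+\gamma_1\tau^{\beta_1}m\|Ah\|^2+\gamma_2\tau^{\beta_2}m^3\|Ch\|^2+2\gamma_3\tau^{\beta_3}m^2\langle Ah,Ch\rangle$$ (equal to $\|h\|^2$ at $t=0$, and to $+\infty$ if $t>0$ and $Ah$ or $Ch$ is not in $L^2(\mu)$), $$\mathcal E_t(h)=|||h|||_t^2+\delta^2(1+\gamma_1\tau^{\beta_1}m)\|E\|_{L^2(\mathbf T^2)}^2,$$ $$D_t(h)=\tau^{-1}\|Ah\|^2+\gamma_1\tau^{\beta_1-1}m\|A^*\cdot Ah\|^2+\gamma_2\tau^{\beta_2-1}m^3\|ACh\|^2+\gamma_3\tau^{\beta_3}m^2\|Ch\|^2.$$ The quadratic remainder is $$Q^\delta_t(h)=\tfrac1{\delta^2}\Big(\tau^{\beta_2}m^3\big(\|Ah\|+\|h\|\big)\|Ch\|+\tau^{\beta_3}m^2\big(\|Ah\|^2+\|h\|\|Ch\|+\|h\|\|Ah\|\big)\Big).$$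 With $[g]_s=\|g\|^{1-s}\|Cg\|^s$, $\eta\in(0,1)^9$ and $\tilde\eta_1\in(0,1)$, the trilinear remainder is $$\mathcal R^\delta_t(h,g,\tilde g)=\tfrac1{\delta^2}\big(T_1\chi_{t\ge\tau}+\tilde T_1\chi_{t\le\tau}\big)+\tfrac1{\delta^2}\sum_{i=2}^9T_i,$$ where $T_1=\|Ah\|[g]_{\eta_1}\|\tilde g\|$, $\tilde T_1=\|Ah\|\|g\|[\tilde g]_{\tilde\eta_1}$, $T_2=\tau^{\beta_1}m\|Ah\|[g]_{\eta_2}\|\tilde g\|$, $T_3=\tau^{\beta_1}m\|A^2h\|[\tilde g]_{\eta_3}\|Ag\|$, $T_4=\tau^{\beta_2}m^3\|ACh\|\|Cg\|[\tilde g]_{\eta_4}$, $T_5=\tau^{\beta_2}m^3\|ACh\|[\tilde g]_{\eta_5}[g]_{1-\eta_5}$, $T_6=\tau^{\beta_3}m^2\|A^2h\|[\tilde g]_{\eta_6}\|Cg\|$, $T_7=\tau^{\beta_3}m^2\|A^2h\|[\tilde g]_{\eta_7}[g]_{1-\eta_7}$, $T_8=\tau^{\beta_3}m^2\|Ch\|[g]_{\eta_8}\|\tilde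 g\|$, $T_9=\tau^{\beta_3}m^2\|ACh\|[\tilde g]_{\eta_9}\|Ag\|$. **Proposition 8.2.** Set $\beta=(-\tfrac8{15},\tfrac25,-\tfrac1{15})$. Let $\varepsilon>0$, $\tau_0>0$, and let $\gamma\in(0,\infty)^3$ be such that, for some $c_0,C_0>0$, $$c_0\,N_t(h)\le|||h|||_t^2\le C_0\,N_t(h),\qquad N_t(h)=\|h\|^2+\tau^{\beta_1}m\|Ah\|^2+\tau^{\beta_2}m^3\|Ch\|^2,$$ for all $\rho_*$ of integral $1$ lying in $W^{1,q}(\mathbf T^2)$ for some $q>2$, all $\delta>0$, $\tau>\tau_0$, $t\ge0$ and $h\in\mathcal H$. Let $\rho_*\in W^{1,p}(\mathbf T^2)$, $p>2$, with $\int_{\mathbf T^2}\rho_*=1$, and let $\delta_0>0$. Then there exist $\eta\in(0,1)^9$, $\tilde\eta_1\in(0,1)$ and $K>0$ such that for all $t\ge0$, $\tau>\tau_0$, $\delta>\delta_0$ and $(h,g,\tilde g)\in(\mathcal H_0)^3$, $$Q^\delta_t(h)\le\frac{K\tau^{14/15}}{\delta^2}D_t(h),$$ $$\mathcal R^\delta_t(h,g,\tilde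 g)\le\frac{K\tau^{14/15+\varepsilon}}{\delta^2}D_t(h)^{1/2}\Big[D_t(g)^{1/2}+\tau^{-1/2}\big(\tfrac t\tau\big)^{-3\tilde\eta_1/2}\chi_{t\le\tau}\|g\|\Big]\mathcal E_t(\tilde g)^{1/2}.$$ (At $t=0$ the factor $(t/\tau)^{-3\tilde\eta_1/2}$ is $+\infty$.) -/

import Mathlib

open MeasureTheory Set
open scoped ENNReal ContDiff

noncomputable section

namespace VPFP

/-- The position space: the unit torus `𝐓² = (ℝ/ℤ)²`, with its Lebesgue probability measure. -/
abbrev Torus : Type := UnitAddTorus (Fin 2)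

/-- The velocity space `ℝ²` with its Euclidean structure. -/
abbrev Vel : Type := EuclideanSpace ℝ (Fin 2)

/-- The phase space `𝐓² × ℝ²`, with Lebesgue measure `dx dv`. -/
abbrev Phase : Type := Torus × Vel

/-- `2 × 2` matrices with the Frobenius norm. -/
abbrev Mat : Type := EuclideanSpace ℝ (Fin 2 × Fin 2)

/-- The covering map `ℝ² → 𝐓²`. -/
def proj (y : Vel) : Torus := fun i => (y i : UnitAddCircle)

/-! ### Sobolev spaces on the torus -/

/-- `∂_{x_i} χ` for a function on the torus. -/
def partialT (i : Fin 2) (χ : Torus → ℝ) (x : Torus) : ℝ :=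
  deriv (fun s : ℝ => χ (x + Pi.single i (s : UnitAddCircle))) 0

/-- Smooth functions on the torus. -/
def IsTestT (χ : Torus → ℝ) : Prop :=
  ContDiff ℝ ∞ (fun y : Vel => χ (proj y))

/-- `G` is the weak gradient of `u` on the torus. -/
def IsGradT (u : Torus → ℝ) (G : Torus → Vel) : Prop :=
  Integrable u ∧ ∀ i, Integrable (fun x => G x i) ∧
    ∀ χ, IsTestT χ → ∫ x, u x * partialT i χ x = -∫ x, G x i * χ x

/-- `u ∈ W^{1,p}(𝐓²)`. -/
def MemW1 (p : ℝ≥0∞) (u : Torus → ℝ) : Prop :=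
  MemLp u p ∧ ∃ G, IsGradT u G ∧ MemLp G p

/-- `φ ∈ H¹(𝐓²)` is a weak solution of the Poisson-Boltzmann equation
`-δ² Δφ = e^{-φ} - ρ` on the torus. -/
def IsPoissonBoltzmann (δ : ℝ) (ρ φ : Torus → ℝ) : Prop :=
  MemLp φ 2 ∧ Integrable (fun x => Real.exp (-φ x)) ∧ ∃ G, IsGradT φ G ∧ MemLp G 2 ∧
    ∀ χ, IsTestT χ →
      δ ^ 2 * ∫ x, ∑ i, G x i * partialT i χ x = ∫ x, (Real.exp (-φ x) - ρ x) * χ x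

/-! ### The equilibrium and the weighted space `𝓗 = L²(μ)` -/

/-- The Maxwellian `M(v) = (2π)⁻¹ e^{-|v|²/2}`. -/
def maxwellian (v : Vel) : ℝ := (2 * Real.pi)⁻¹ * Real.exp (-‖v‖ ^ 2 / 2)

/-- The equilibrium `f_∞(x,v) = M(v) e^{-φ(x)}` with potential `φ`. -/
def finf (φ : Torus → ℝ) (z : Phase) : ℝ := maxwellian z.2 * Real.exp (-φ z.1)

/-- The measure `dμ = f_∞ dx dv`. -/
def mu (φ : Torus → ℝ) : Measure Phase :=
  (volume : Measure Phase).withDensity (fun z => ENNReal.ofReal (finf φ z))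

/-- `h ∈ 𝓗 = L²(μ)`. -/
def MemH (φ : Torus → ℝ) (h : Phase → ℝ) : Prop := MemLp h 2 (mu φ)

/-- `h ∈ 𝓗₀`: `h ∈ 𝓗` and `⟨1, h⟩ = 0`. -/
def MemH0 (φ : Torus → ℝ) (h : Phase → ℝ) : Prop := MemH φ h ∧ ∫ z, h z ∂(mu φ) = 0

/-- `‖h‖`, the norm of `𝓗`. -/
def normH (φ : Torus → ℝ) (h : Phase → ℝ) : ℝ≥0∞ := eLpNorm h 2 (mu φ)

/-! ### The operators `A = ∇_v` and `C = ∇_x` in the weak sense -/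

/-- `∂_{x_i} ψ` on phase space. -/
def partialX (i : Fin 2) (ψ : Phase → ℝ) (z : Phase) : ℝ :=
  deriv (fun s : ℝ => ψ (z.1 + Pi.single i (s : UnitAddCircle), z.2)) 0

/-- `∂_{v_i} ψ` on phase space. -/
def partialV (i : Fin 2) (ψ : Phase → ℝ) (z : Phase) : ℝ :=
  deriv (fun s : ℝ => ψ (z.1, z.2 + s • EuclideanSpace.single i (1 : ℝ))) 0

/-- Smooth compactly supported functions on phase space. -/
def IsTest (ψ : Phase → ℝ) : Prop :=
  ContDiff ℝ ∞ (fun y : Vel × Vel => ψ (proj y.1, y.2)) ∧ HasCompactSupport ψ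

/-- `w` is the weak derivative of `u` for the partial derivative `d`
(one of the `partialX i`, `partialV i`). -/
def IsWeakDeriv (d : (Phase → ℝ) → Phase → ℝ) (u w : Phase → ℝ) : Prop :=
  LocallyIntegrable u ∧ LocallyIntegrable w ∧
    ∀ ψ, IsTest ψ → ∫ z, u z * d ψ z = -∫ z, w z * ψ z

/-- `G = Ah = ∇_v h` weakly. -/
def IsGradV (h : Phase → ℝ) (G : Phase → Vel) : Prop :=
  ∀ i, IsWeakDeriv (partialV i) h (fun z => G z i)

/-- `F = Ch = ∇_x h` weakly. -/
def IsGradX (h : Phase → ℝ) (F : Phase → Vel) : Prop :=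
  ∀ i, IsWeakDeriv (partialX i) h (fun z => F z i)

/-- `H = AG` weakly: `H_{ij} = ∂_{v_i} G_j`. -/
def IsJacV (G : Phase → Vel) (H : Phase → Mat) : Prop :=
  ∀ i j, IsWeakDeriv (partialV i) (fun z => G z j) (fun z => H z (i, j))

/-! Each of the following extended norms is the `L²(μ)`-norm of the (almost everywhere unique)
weak derivative if there is one, and `∞` if there is none. -/

/-- `‖Ah‖`. -/
def normA (φ : Torus → ℝ) (h : Phase → ℝ) : ℝ≥0∞ :=
  ⨅ (G : Phase → Vel) (_ : IsGradV h G), eLpNorm G 2 (mu φ)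

/-- `‖Ch‖`. -/
def normC (φ : Torus → ℝ) (h : Phase → ℝ) : ℝ≥0∞ :=
  ⨅ (F : Phase → Vel) (_ : IsGradX h F), eLpNorm F 2 (mu φ)

/-- `‖A²h‖`. -/
def normAA (φ : Torus → ℝ) (h : Phase → ℝ) : ℝ≥0∞ :=
  ⨅ (G : Phase → Vel) (H : Phase → Mat) (_ : IsGradV h G) (_ : IsJacV G H), eLpNorm H 2 (mu φ)

/-- `‖ACh‖`. -/
def normAC (φ : Torus → ℝ) (h : Phase → ℝ) : ℝ≥0∞ :=
  ⨅ (F : Phase → Vel) (H : Phase → Mat) (_ : IsGradX h F) (_ : IsJacV F H), eLpNorm H 2 (mu φ)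

/-- `‖A^*·Ah‖`, where `A^*_i = v_i - ∂_{v_i}`, so that `A^*·Ah = v·∇_v h - Δ_v h`. The operator
`A^*·A` is taken on its domain `{h : Ah ∈ L²(μ), A²h ∈ L²(μ)}`, and the value is `∞` outside. -/
def normAstarA (φ : Torus → ℝ) (h : Phase → ℝ) : ℝ≥0∞ :=
  ⨅ (G : Phase → Vel) (H : Phase → Mat) (_ : IsGradV h G) (_ : IsJacV G H)
    (_ : MemLp G 2 (mu φ)) (_ : MemLp H 2 (mu φ)),
    eLpNorm (fun z => ∑ i, (z.2 i * G z i - H z (i, i))) 2 (mu φ)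

/-! ### The electric field -/

/-- The macroscopic density `n(x) = ∫ h(x,v) f_∞(x,v) dv`. -/
def density (φ : Torus → ℝ) (h : Phase → ℝ) (x : Torus) : ℝ := ∫ v, h (x, v) * finf φ (x, v)

/-- `E = δ⁻² ∇Δ⁻¹ n`, i.e. `E = -∇ψ` where `ψ ∈ H¹(𝐓²)` solves `-δ² Δψ = n` weakly. -/
def IsElectricField (δ : ℝ) (φ : Torus → ℝ) (h : Phase → ℝ) (E : Torus → Vel) : Prop :=
  MemLp E 2 ∧ ∃ ψ : Torus → ℝ, MemLp ψ 2 ∧ IsGradT ψ (fun x => -E x) ∧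
    ∀ χ, IsTestT χ →
      δ ^ 2 * ∫ x, ∑ i, (-E x i) * partialT i χ x = ∫ x, density φ h x * χ x

/-- `‖E‖_{L²(𝐓²)}` for the (almost everywhere unique) electric field `E` created by `h`. -/
def normE (δ : ℝ) (φ : Torus → ℝ) (h : Phase → ℝ) : ℝ≥0∞ :=
  ⨅ (E : Torus → Vel) (_ : IsElectricField δ φ h E), eLpNorm E 2 volume

/-! ### Energy and dissipation functionals

The indices `0, 1, 2` of `β` and `γ` stand for the usual indices `1, 2, 3`. All functionals take
values in `[0,∞]`, with `0 · ∞ = 0`. -/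

/-- The time weight `min(1, t/τ)`. -/
def wt (τ t : ℝ) : ℝ := min 1 (t / τ)

/-- The squared twisted norm
`‖h‖² + γ₁τ^{β₁} m ‖Ah‖² + γ₂τ^{β₂} m³ ‖Ch‖² + 2γ₃τ^{β₃} m² ⟨Ah, Ch⟩` with `m = min(1, t/τ)`.
At `t = 0` it is `‖h‖²`; for `t > 0` it is infinite unless `Ah` and `Ch` are in `L²(μ)`. -/
def twistedSq (γ β : Fin 3 → ℝ) (τ t : ℝ) (φ : Torus → ℝ) (h : Phase → ℝ) : ℝ≥0∞ :=
  open scoped Classical in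
  if t = 0 then normH φ h ^ 2 else
    ⨅ (G : Phase → Vel) (F : Phase → Vel) (_ : IsGradV h G) (_ : IsGradX h F)
      (_ : MemLp G 2 (mu φ)) (_ : MemLp F 2 (mu φ)),
      ENNReal.ofReal (
        ∫ z, h z ^ 2 ∂(mu φ)
        + γ 0 * τ ^ β 0 * wt τ t * ∫ z, ‖G z‖ ^ 2 ∂(mu φ)
        + γ 1 * τ ^ β 1 * wt τ t ^ 3 * ∫ z, ‖F z‖ ^ 2 ∂(mu φ)
        + 2 * γ 2 * τ ^ β 2 * wt τ t ^ 2 * ∫ z, inner ℝ (G z) (F z) ∂(mu φ))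

/-- The untwisted weighted norm `‖h‖² + τ^{β₁} m ‖Ah‖² + τ^{β₂} m³ ‖Ch‖²`. -/
def plainSq (β : Fin 3 → ℝ) (τ t : ℝ) (φ : Torus → ℝ) (h : Phase → ℝ) : ℝ≥0∞ :=
  normH φ h ^ 2
    + ENNReal.ofReal (τ ^ β 0 * wt τ t) * normA φ h ^ 2
    + ENNReal.ofReal (τ ^ β 1 * wt τ t ^ 3) * normC φ h ^ 2

/-- The condition on `γ`: the twisted norm is equivalent to the untwisted one, uniformly in
`ρ_*`, `δ > 0`, `τ > τ₀`, `t ≥ 0` and `h`. -/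
def NormEquivalence (γ β : Fin 3 → ℝ) (τ₀ : ℝ) : Prop :=
  ∃ c₀ C₀ : ℝ, 0 < c₀ ∧ 0 < C₀ ∧
    ∀ (p : ℝ≥0∞) (ρ : Torus → ℝ), 2 < p → MemW1 p ρ → ∫ x, ρ x = 1 →
    ∀ δ > 0, ∀ φ, IsPoissonBoltzmann δ ρ φ →
    ∀ τ > τ₀, ∀ t ≥ 0, ∀ h, MemH φ h →
      ENNReal.ofReal c₀ * plainSq β τ t φ h ≤ twistedSq γ β τ t φ h ∧
      twistedSq γ β τ t φ h ≤ ENNReal.ofReal C₀ * plainSq β τ t φ h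

/-- The energy `𝓔_t(h)`, i.e. the squared twisted norm plus
`δ² (1 + γ₁τ^{β₁} m) ‖E‖²_{L²}`. -/
def energy (γ β : Fin 3 → ℝ) (τ δ t : ℝ) (φ : Torus → ℝ) (h : Phase → ℝ) : ℝ≥0∞ :=
  twistedSq γ β τ t φ h
    + ENNReal.ofReal (δ ^ 2 * (1 + γ 0 * τ ^ β 0 * wt τ t)) * normE δ φ h ^ 2

/-- The dissipation `D_t(h)`. -/
def dissipation (γ β : Fin 3 → ℝ) (τ t : ℝ) (φ : Torus → ℝ) (h : Phase → ℝ) : ℝ≥0∞ :=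
  ENNReal.ofReal τ⁻¹ * normA φ h ^ 2
    + ENNReal.ofReal (γ 0 * τ ^ (β 0 - 1) * wt τ t) * normAstarA φ h ^ 2
    + ENNReal.ofReal (γ 1 * τ ^ (β 1 - 1) * wt τ t ^ 3) * normAC φ h ^ 2
    + ENNReal.ofReal (γ 2 * τ ^ β 2 * wt τ t ^ 2) * normC φ h ^ 2

/-! ### Quadratic and trilinear remainders -/

/-- The quadratic remainder `Q^δ_t(h) = δ⁻² (S₁ + ⋯ + S₅)`. -/
def quadRem (β : Fin 3 → ℝ) (τ δ t : ℝ) (φ : Torus → ℝ) (h : Phase → ℝ) : ℝ≥0∞ :=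
  ENNReal.ofReal (1 / δ ^ 2) *
    (ENNReal.ofReal (τ ^ β 1 * wt τ t ^ 3) * normA φ h * normC φ h
    + ENNReal.ofReal (τ ^ β 1 * wt τ t ^ 3) * normH φ h * normC φ h
    + ENNReal.ofReal (τ ^ β 2 * wt τ t ^ 2) * normA φ h ^ 2
    + ENNReal.ofReal (τ ^ β 2 * wt τ t ^ 2) * normH φ h * normC φ h
    + ENNReal.ofReal (τ ^ β 2 * wt τ t ^ 2) * normH φ h * normA φ h)

/-- Geometric interpolation `‖g‖^{1-s} ‖Cg‖^s`. -/
def interp (φ : Torus → ℝ) (g : Phase → ℝ) (s : ℝ) : ℝ≥0∞ :=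
  normH φ g ^ (1 - s) * normC φ g ^ s

/-- The trilinear remainder
`𝓡^δ_t(h,g,k) = δ⁻² (T₁ χ_{t ≥ τ} + T₁' χ_{t ≤ τ}) + δ⁻² (T₂ + ⋯ + T₉)`,
with exponents `η = (η₁,…,η₉)` (indexed from `0`) and `η'`. -/
def triRem (β : Fin 3 → ℝ) (η : Fin 9 → ℝ) (η' τ δ t : ℝ) (φ : Torus → ℝ)
    (h g k : Phase → ℝ) : ℝ≥0∞ :=
  open scoped Classical in
  ENNReal.ofReal (1 / δ ^ 2) *
    ((if τ ≤ t then normA φ h * interp φ g (η 0) * normH φ k else 0)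
    + (if t ≤ τ then normA φ h * normH φ g * interp φ k η' else 0))
  + ENNReal.ofReal (1 / δ ^ 2) *
    (ENNReal.ofReal (τ ^ β 0 * wt τ t) * normA φ h * interp φ g (η 1) * normH φ k
    + ENNReal.ofReal (τ ^ β 0 * wt τ t) * normAA φ h * interp φ k (η 2) * normA φ g
    + ENNReal.ofReal (τ ^ β 1 * wt τ t ^ 3) * normAC φ h * normC φ g * interp φ k (η 3)
    + ENNReal.ofReal (τ ^ β 1 * wt τ t ^ 3) * normAC φ h * interp φ k (η 4)
        * interp φ g (1 - η 4)
    + ENNReal.ofReal (τ ^ β 2 * wt τ t ^ 2) * normAA φ h * interp φ k (η 5) * normC φ g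
    + ENNReal.ofReal (τ ^ β 2 * wt τ t ^ 2) * normAA φ h * interp φ k (η 6)
        * interp φ g (1 - η 6)
    + ENNReal.ofReal (τ ^ β 2 * wt τ t ^ 2) * normC φ h * interp φ g (η 7) * normH φ k
    + ENNReal.ofReal (τ ^ β 2 * wt τ t ^ 2) * normAC φ h * interp φ k (η 8) * normA φ g)

/-- The short-time term `τ^{-1/2} (t/τ)^{-3η'/2} χ_{t ≤ τ} ‖g‖` (equal to `∞` at `t = 0` if
`g ≠ 0`). -/
def shortTime (η' τ t : ℝ) (φ : Torus → ℝ) (g : Phase → ℝ) : ℝ≥0∞ :=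
  open scoped Classical in
  if t ≤ τ then
    ENNReal.ofReal (τ ^ (-(1 / 2) : ℝ)) * ENNReal.ofReal (t / τ) ^ (-(3 * η' / 2)) * normH φ g
  else 0

/-- The exponents `β = (-8/15, 2/5, -1/15)`. -/
def betaColl : Fin 3 → ℝ := ![-8 / 15, 2 / 5, -1 / 15]

end VPFP

end

/-! Once `mu φ` is comparable to the Gaussian reference measure `nu`, uniformly in `δ > δ₀`, both
inequalities reduce to counting powers of `τ` and `m`. Put `x = D_t(h)^{1/2}` and `z =
𝓔_t(k)^{1/2}`. The separate terms of the dissipation give, up to constants, `‖Ah‖ ≤ τ^{1/2} x`,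
`‖A^*·Ah‖ ≤ τ^{23/30} m^{-1/2} x`, `‖ACh‖ ≤ τ^{3/10} m^{-3/2} x` and `‖Ch‖ ≤ τ^{1/30} m^{-1} x`. The
energy and the norm equivalence give `‖k‖ ≤ z` and `‖Ck‖ ≤ τ^{-1/5} m^{-3/2} z`.

Two norms in the remainders do not occur in the dissipation. For `‖h‖` the Poincaré inequality
`IsComparable.poincare` gives `τ^{1/2} m^{-1} x`, because `h` has mean zero; for `‖A²h‖` the
elliptic estimate `IsComparable.normAA_le` gives the bound of `‖A^*·Ah‖`. Multiplying the bounds,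
every term has a `τ`-exponent at most `14/15` and, where `m` may be small, a nonnegative
`m`-exponent (`wgt_mul_three_le`, `quadRem_le`, `triRem_le`). Since `τ > τ₀`, smaller powers of `τ`
are absorbed in a constant, and so is the passage from `14/15` to `14/15 + ε`.

For `nu` the Poincaré and elliptic inequalities follow from Parseval in the Fourier-Hermite basis:
`∂_{x_i}` is diagonal, `∂_{v_i}` shifts the Hermite index, and `A^*·A` multiplies by the total
Hermite degree.

Comparability is the bound `exists_exp_neg_bounds` on `e^{-φ}`. Testing the Poisson-Boltzmann
equation with a decreasing function of `φ` gives `‖e^{-φ}‖₂ ≤ ‖ρ‖₂`. Then `Δφ` is bounded in `L²`,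
so in dimension two the nonzero Fourier coefficients of `φ` are summable and `φ` has bounded
oscillation; the mass constraint `∫ e^{-φ} = 1` controls its mean. Truncation and Fejér means turn
the nonlinear test function into an admissible trigonometric polynomial. -/

noncomputable section

namespace VPFP

open scoped ComplexConjugate Topology
open Filter

/-! ### Complete orthonormal systems: Parseval, transport, products. -/

section CompleteSystems

variable {ι κ X Y : Type*} [MeasurableSpace X] [MeasurableSpace Y]

/-- The coefficient of `f` along `b i`. -/
def coef (μ : Measure X) (b : ι → X → ℂ) (f : X → ℂ) (i : ι) : ℂ :=
  ∫ x, conj (b i x) * f x ∂μ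

/-- The functions `b i` form a Hilbert basis of `L²(μ; ℂ)`. -/
structure IsCompleteONS (μ : Measure X) (b : ι → X → ℂ) : Prop where
  memLp : ∀ i, MemLp (b i) 2 μ
  coef_self : ∀ i, coef μ b (b i) i = 1
  coef_ne : ∀ i j, i ≠ j → coef μ b (b j) i = 0
  complete : ∀ f, MemLp f 2 μ → (∀ i, coef μ b f i = 0) → f =ᵐ[μ] 0

theorem inner_toLp_eq_integral {μ : Measure X} {f g : X → ℂ} (hf : MemLp f 2 μ)
    (hg : MemLp g 2 μ) : inner ℂ (hf.toLp f) (hg.toLp g) = ∫ x, conj (f x) * g x ∂μ := by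
  rw [L2.inner_def]
  refine integral_congr_ae ?_
  filter_upwards [hf.coeFn_toLp, hg.coeFn_toLp] with x h1 h2
  rw [h1, h2, RCLike.inner_apply, mul_comm]

theorem integrable_conj_mul {μ : Measure X} {f g : X → ℂ} (hf : MemLp f 2 μ)
    (hg : MemLp g 2 μ) : Integrable (fun x => conj (f x) * g x) μ :=
  MemLp.integrable_mul (p := 2) (q := 2) hf.star hg

namespace IsCompleteONS

variable {μ : Measure X} {ν : Measure Y} {b : ι → X → ℂ} {c : κ → Y → ℂ}

theorem orthonormal (hb : IsCompleteONS μ b) :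
    Orthonormal ℂ (fun i => (hb.memLp i).toLp (b i)) := by
  classical
  rw [orthonormal_iff_ite]
  intro i j
  rw [inner_toLp_eq_integral]
  split_ifs with h
  · subst h
    exact hb.coef_self i
  · exact hb.coef_ne i j h

theorem exists_hilbertBasis (hb : IsCompleteONS μ b) :
    ∃ B : HilbertBasis ι ℂ (Lp ℂ 2 μ), ∀ f (hf : MemLp f 2 μ) i,
      B.repr (hf.toLp f) i = coef μ b f i := by
  have hbot : (Submodule.span ℂ (Set.range fun i => (hb.memLp i).toLp (b i)))ᗮ = ⊥ := by
    rw [Submodule.eq_bot_iff]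
    intro f hf
    have h0 : (f : X → ℂ) =ᵐ[μ] 0 := by
      refine hb.complete f (Lp.memLp f) fun i => ?_
      have := (Submodule.mem_orthogonal _ _).1 hf _ (Submodule.subset_span ⟨i, rfl⟩)
      have h2 := inner_toLp_eq_integral (hb.memLp i) (Lp.memLp f)
      rw [Lp.toLp_coeFn] at h2
      exact h2.symm.trans this
    exact (Lp.eq_zero_iff_ae_eq_zero).2 h0
  refine ⟨HilbertBasis.mkOfOrthogonalEqBot hb.orthonormal hbot, fun f hf i => ?_⟩
  rw [HilbertBasis.repr_apply_apply, HilbertBasis.coe_mkOfOrthogonalEqBot, inner_toLp_eq_integral]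
  rfl

/-- **Parseval's identity.** -/
theorem hasSum_sq (hb : IsCompleteONS μ b) {f : X → ℂ} (hf : MemLp f 2 μ) :
    HasSum (fun i => ‖coef μ b f i‖ ^ 2) (∫ x, ‖f x‖ ^ 2 ∂μ) := by
  obtain ⟨B, hB⟩ := hb.exists_hilbertBasis
  have h := B.hasSum_inner_mul_inner (hf.toLp f) (hf.toLp f)
  rw [inner_toLp_eq_integral] at h
  have h2 := (RCLike.hasSum_re ℂ h)
  convert h2 using 1
  · ext i
    rw [← inner_conj_symm, ← B.repr_apply_apply, hB, RCLike.conj_mul]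
    norm_cast
  · rw [← integral_re (integrable_conj_mul hf hf)]
    refine integral_congr_ae (Filter.Eventually.of_forall fun x => ?_)
    simp only [RCLike.conj_mul]
    norm_cast

theorem tsum_enorm_sq (hb : IsCompleteONS μ b) {f : X → ℂ} (hf : MemLp f 2 μ) :
    ∑' i, ‖coef μ b f i‖ₑ ^ 2 = eLpNorm f 2 μ ^ 2 := by
  have h := hb.hasSum_sq hf
  have h1 : eLpNorm f 2 μ ^ 2 = ENNReal.ofReal (∫ x, ‖f x‖ ^ 2 ∂μ) := by
    rw [hf.eLpNorm_eq_integral_rpow_norm (by norm_num) (by norm_num),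
      ← ENNReal.ofReal_pow (by positivity)]
    congr 1
    simp only [ENNReal.toReal_ofNat, Real.rpow_two]
    rw [← Real.rpow_natCast, ← Real.rpow_mul (integral_nonneg fun x => by positivity)]
    norm_num
  rw [h1, ← h.tsum_eq, ENNReal.ofReal_tsum_of_nonneg (fun _ => by positivity) h.summable]
  refine tsum_congr fun i => ?_
  rw [ENNReal.ofReal_pow (norm_nonneg _), ofReal_norm]

theorem of_hilbertBasis (B : HilbertBasis ι ℂ (Lp ℂ 2 μ)) (hB : ∀ i, (B i : X → ℂ) =ᵐ[μ] b i) :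
    IsCompleteONS μ b := by
  have hm : ∀ i, MemLp (b i) 2 μ := fun i => (memLp_congr_ae (hB i)).1 (Lp.memLp (B i))
  have hB' : ∀ i, B i = (hm i).toLp (b i) := fun i => by
    rw [← Lp.toLp_coeFn (B i) (Lp.memLp (B i))]
    exact MemLp.toLp_congr _ _ (hB i)
  have hin : ∀ i f (hf : MemLp f 2 μ), coef μ b f i = inner ℂ (B i) (hf.toLp f) :=
    fun i f hf => by rw [hB', inner_toLp_eq_integral]; rfl
  classical
  refine ⟨hm, fun i => ?_, fun i j hij => ?_, fun f hf h => ?_⟩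
  · rw [hin i _ (hm i), ← hB', (orthonormal_iff_ite.1 B.orthonormal) i i, if_pos rfl]
  · rw [hin i _ (hm j), ← hB', (orthonormal_iff_ite.1 B.orthonormal) i j, if_neg hij]
  · have h0 : B.repr (hf.toLp f) = 0 := by
      ext i
      rw [HilbertBasis.repr_apply_apply, ← hin, h i]
      rfl
    have h1 : hf.toLp f = 0 := B.repr.map_eq_zero_iff.1 h0
    exact hf.coeFn_toLp.symm.trans ((Lp.eq_zero_iff_ae_eq_zero).1 h1)

theorem comp_measurePreserving (hc : IsCompleteONS ν c) (e : X ≃ᵐ Y)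
    (he : MeasurePreserving e μ ν) : IsCompleteONS μ (fun i x => c i (e x)) := by
  have key : ∀ (f : Y → ℂ) i, coef μ (fun i x => c i (e x)) (fun x => f (e x)) i
      = coef ν c f i := fun f i =>
    he.integral_comp e.measurableEmbedding (fun y => conj (c i y) * f y)
  refine ⟨fun i => (hc.memLp i).comp_measurePreserving he, fun i => ?_, fun i j hij => ?_,
    fun f hf h => ?_⟩
  · rw [key, hc.coef_self]
  · rw [key, hc.coef_ne i j hij]
  · have hg : MemLp (fun y => f (e.symm y)) 2 ν := hf.comp_measurePreserving (he.symm e)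
    have h0 := hc.complete _ hg fun i => by
      rw [← key]
      simpa using h i
    have := he.quasiMeasurePreserving.ae h0
    filter_upwards [this] with x hx
    simpa using hx

/-- For completeness, fix `i` and take the coefficient along `b i` of the slices `f(·, y)`. By
Bessel it is square integrable in `y`, and its coefficients along `c` are those of `f`, hence zero.
Countability of `ι` makes all these coefficients vanish for almost every `y` simultaneously, so
almost every slice vanishes. -/
theorem prod [SFinite μ] [SFinite ν] [Countable ι] [Countable κ]
    (hb : IsCompleteONS μ b) (hc : IsCompleteONS ν c) :
    IsCompleteONS (μ.prod ν) (fun (i : ι × κ) z => b i.1 z.1 * c i.2 z.2) := by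
  have hcoef : ∀ i j : ι × κ, coef (μ.prod ν) (fun (i : ι × κ) z => b i.1 z.1 * c i.2 z.2)
      (fun z => b j.1 z.1 * c j.2 z.2) i = coef μ b (b j.1) i.1 * coef ν c (c j.2) i.2 := by
    intro i j
    unfold coef
    rw [← integral_prod_mul]
    refine integral_congr_ae (Filter.Eventually.of_forall fun z => ?_)
    simp only [map_mul]
    ring
  have hmem : ∀ i : ι × κ, MemLp (fun z : X × Y => b i.1 z.1 * c i.2 z.2) 2 (μ.prod ν) :=
    fun i => (memLp_two_iff_integrable_sq_norm
      ((hb.memLp i.1).aestronglyMeasurable.comp_fst.mul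
        (hc.memLp i.2).aestronglyMeasurable.comp_snd)).2 (by
      simpa only [Pi.mul_apply, norm_mul, mul_pow] using
        (((hb.memLp i.1).integrable_norm_pow (by norm_num)).mul_prod
          ((hc.memLp i.2).integrable_norm_pow (by norm_num))))
  refine ⟨hmem, fun i => ?_, fun i j hij => ?_, fun f hf h => ?_⟩
  · rw [hcoef, hb.coef_self, hc.coef_self, mul_one]
  · rw [hcoef]
    by_cases h1 : i.1 = j.1
    · rw [hc.coef_ne i.2 j.2 fun h2 => hij (Prod.ext h1 h2), mul_zero]
    · rw [hb.coef_ne i.1 j.1 h1, zero_mul]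
  · have hsw : MemLp (fun z : Y × X => f z.swap) 2 (ν.prod μ) :=
      hf.comp_measurePreserving Measure.measurePreserving_swap
    have hslice : ∀ᵐ y ∂ν, MemLp (fun x => f (x, y)) 2 μ := by
      have hm := hsw.aestronglyMeasurable.prodMk_left
      have hi := (hsw.integrable_norm_pow (by norm_num)).prod_right_ae
      filter_upwards [hm, hi] with y h1 h2
      exact (memLp_two_iff_integrable_sq_norm h1).2 h2
    have hzero : ∀ i, ∀ᵐ y ∂ν, coef μ b (fun x => f (x, y)) i = 0 := by
      intro i
      refine hc.complete (fun y => coef μ b (fun x => f (x, y)) i) ?_ fun j => ?_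
      · have hm : AEStronglyMeasurable (fun y => coef μ b (fun x => f (x, y)) i) ν := by
          have hb1 : AEStronglyMeasurable (fun z : Y × X => b i z.2) (ν.prod μ) :=
            (hb.memLp i).aestronglyMeasurable.comp_snd
          exact ((Complex.continuous_conj.comp_aestronglyMeasurable hb1).mul
            hsw.aestronglyMeasurable).integral_prod_right'
        refine (memLp_two_iff_integrable_sq_norm hm).2 ?_
        have hi := (hsw.integrable_norm_pow (by norm_num)).integral_prod_left
        refine Integrable.mono' hi (hm.norm.pow 2) ?_
        filter_upwards [hslice] with y hy
        rw [Real.norm_of_nonneg (by positivity)]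
        have h1 := inner_toLp_eq_integral (hb.memLp i) hy
        have h2 := hb.hasSum_sq hy
        exact le_hasSum h2 i fun j _ => by positivity
      · have h1 := h (i, j)
        unfold coef at h1 ⊢
        have hint : Integrable (fun z : X × Y => conj (b i z.1 * c j z.2) * f z) (μ.prod ν) :=
          integrable_conj_mul (hmem (i, j)) hf
        rw [integral_prod_symm _ hint] at h1
        rw [← h1]
        refine integral_congr_ae (Filter.Eventually.of_forall fun y => ?_)
        simp only [← integral_const_mul]
        refine integral_congr_ae (Filter.Eventually.of_forall fun x => ?_)
        simp only [map_mul]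
        ring
    have hae : ∀ᵐ y ∂ν, ∀ᵐ x ∂μ, f (x, y) = 0 := by
      filter_upwards [ae_all_iff.2 hzero, hslice] with y h1 h2
      exact hb.complete _ h2 h1
    -- Gluing null slices requires a measurable set, hence the measurable representative `g`.
    have h3 : ∀ᵐ z ∂(ν.prod μ), f z.swap = 0 := by
      obtain ⟨g, hg, hfg⟩ := hsw.aestronglyMeasurable
      have h4 : ∀ᵐ y ∂ν, ∀ᵐ x ∂μ, g (y, x) = 0 := by
        filter_upwards [Measure.ae_ae_of_ae_prod hfg, hae] with y h5 h6
        filter_upwards [h5, h6] with x h7 h8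
        rw [← h7]; exact h8
      have h9 : ∀ᵐ z ∂(ν.prod μ), g z = 0 :=
        (Measure.ae_prod_iff_ae_ae (measurableSet_eq_fun hg.measurable measurable_const)).2 h4
      filter_upwards [hfg, h9] with z h1 h2
      rw [h1, h2]
    have h5 := (Measure.measurePreserving_swap (μ := μ) (ν := ν)).quasiMeasurePreserving.ae h3
    filter_upwards [h5] with z hz
    simpa using hz

end IsCompleteONS

end CompleteSystems

section Hermite

open scoped Nat
open ProbabilityTheory Polynomial

/-! ### Hermite polynomials and the Gaussian measure -/

/-- The standard Gaussian measure on the line. -/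
abbrev gauss : Measure ℝ := gaussianReal 0 1

theorem derivative_hermite_succ (n : ℕ) :
    derivative (hermite (n + 1)) = ((n : ℤ[X]) + 1) * hermite n := by
  induction n with
  | zero => simp
  | succ n ih =>
    rw [hermite_succ (n + 1), derivative_sub, derivative_mul, ih]
    have h : derivative (((n : ℤ[X]) + 1) * hermite n)
        = ((n : ℤ[X]) + 1) * derivative (hermite n) := by
      rw [derivative_mul]
      simp
    rw [h, hermite_succ n]
    simp only [derivative_X]
    push_cast
    ring

theorem memLp_polynomial_gauss (p : ℝ[X]) (q : ℝ≥0∞) (hq : q ≠ ⊤) :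
    MemLp (fun x => p.eval x) q gauss := by
  have hpow : ∀ n : ℕ, MemLp (fun x : ℝ => x ^ n) q gauss := by
    intro n
    have h := (memLp_id_gaussianReal' (μ := 0) (v := 1) (q * n)
      (ENNReal.mul_ne_top hq (ENNReal.natCast_ne_top n)))
    rcases Nat.eq_zero_or_pos n with rfl | hn
    · simpa using memLp_const (1 : ℝ)
    · have h2 := h.norm_rpow_div (n : ℝ≥0∞)
      rw [ENNReal.mul_div_cancel_right (by exact_mod_cast hn.ne') (ENNReal.natCast_ne_top n)] at h2
      refine h2.congr_norm (by fun_prop) (Filter.Eventually.of_forall fun x => ?_)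
      simp
  induction p using Polynomial.induction_on' with
  | add p r hp hr => simp only [eval_add]; exact hp.add hr
  | monomial n a => simpa only [eval_monomial] using (hpow n).const_mul a

theorem integrable_polynomial_gauss (p : ℝ[X]) : Integrable (fun x => p.eval x) gauss :=
  memLp_one_iff_integrable.1 (memLp_polynomial_gauss p 1 (by simp))

theorem hasDerivAt_gaussianPDFReal (x : ℝ) :
    HasDerivAt (gaussianPDFReal 0 1) (-x * gaussianPDFReal 0 1 x) x := by
  have h : HasDerivAt (fun x : ℝ => (√(2 * Real.pi))⁻¹ * Real.exp (-x ^ 2 / 2))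
      ((√(2 * Real.pi))⁻¹ * (Real.exp (-x ^ 2 / 2) * (-x))) x := by
    refine HasDerivAt.const_mul _ (HasDerivAt.exp ?_)
    convert! ((hasDerivAt_pow 2 x).neg.div_const 2) using 1
    norm_num
    ring
  convert! h using 1
  · ext y; simp [gaussianPDFReal]
  · simp [gaussianPDFReal]; ring

theorem integrable_gaussianPDFReal_mul_polynomial (p : ℝ[X]) :
    Integrable (fun x => gaussianPDFReal 0 1 x * p.eval x) := by
  have h := integrable_polynomial_gauss p
  rw [gauss, gaussianReal_of_var_ne_zero _ one_ne_zero,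
    integrable_withDensity_iff_integrable_smul' (measurable_gaussianPDF _ _)
      (Filter.Eventually.of_forall fun _ => gaussianPDF_lt_top)] at h
  simpa only [toReal_gaussianPDF, smul_eq_mul] using h

/-- Gaussian integration by parts: the density satisfies `w' = -x w`. -/
theorem integral_gauss_derivative (p : ℝ[X]) :
    ∫ x, (derivative p).eval x ∂gauss = ∫ x, (X * p).eval x ∂gauss := by
  have h := integral_eq_zero_of_hasDerivAt_of_integrable
    (f := fun x => gaussianPDFReal 0 1 x * p.eval x)
    (f' := fun x => gaussianPDFReal 0 1 x * (derivative p - X * p).eval x)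
    (fun x => by
      convert! (hasDerivAt_gaussianPDFReal x).mul (p.hasDerivAt x) using 1
      simp
      ring)
    (integrable_gaussianPDFReal_mul_polynomial _) (integrable_gaussianPDFReal_mul_polynomial _)
  have h2 : ∫ x, (derivative p - X * p).eval x ∂gauss = 0 := by
    rw [integral_gaussianReal_eq_integral_smul one_ne_zero]
    simpa only [smul_eq_mul] using h
  simp only [eval_sub] at h2
  rw [integral_sub (integrable_polynomial_gauss _) (integrable_polynomial_gauss _)] at h2
  linarith

/-- The Hermite polynomial with real coefficients. -/
def hermiteR (n : ℕ) : ℝ[X] := (hermite n).map (Int.castRingHom ℝ)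

theorem hermiteR_zero : hermiteR 0 = 1 := by simp [hermiteR]

theorem hermiteR_succ (n : ℕ) :
    hermiteR (n + 1) = X * hermiteR n - derivative (hermiteR n) := by
  simp [hermiteR, hermite_succ, derivative_map]

theorem derivative_hermiteR_succ (n : ℕ) :
    derivative (hermiteR (n + 1)) = ((n : ℝ[X]) + 1) * hermiteR n := by
  rw [hermiteR, derivative_map, derivative_hermite_succ]
  simp [hermiteR]

/-- The creation operator `X - d/dx`, which raises the Hermite index, is the adjoint of `d/dx` in
`L²` of the Gaussian. -/
theorem integral_hermiteR_succ_mul (n : ℕ) (p : ℝ[X]) :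
    ∫ x, (hermiteR (n + 1) * p).eval x ∂gauss = ∫ x, (hermiteR n * derivative p).eval x ∂gauss := by
  have h := integral_gauss_derivative (hermiteR n * p)
  have h1 : hermiteR (n + 1) * p
      = X * (hermiteR n * p) - derivative (hermiteR n * p) + hermiteR n * derivative p := by
    rw [hermiteR_succ, derivative_mul]
    ring
  rw [h1]
  simp only [eval_add]
  rw [integral_add (integrable_polynomial_gauss _) (integrable_polynomial_gauss _)]
  simp only [eval_sub]
  rw [integral_sub (integrable_polynomial_gauss _)
    (integrable_polynomial_gauss _), h, sub_self, zero_add]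

theorem integral_hermiteR_mul_hermiteR (m n : ℕ) :
    ∫ x, (hermiteR m * hermiteR n).eval x ∂gauss = if m = n then (n ! : ℝ) else 0 := by
  induction m generalizing n with
  | zero =>
    cases n with
    | zero => simp [hermiteR_zero]
    | succ n =>
      rw [mul_comm, integral_hermiteR_succ_mul, hermiteR_zero]
      simp
  | succ m ih =>
    cases n with
    | zero =>
      rw [integral_hermiteR_succ_mul, hermiteR_zero]
      simp
    | succ n =>
      rw [integral_hermiteR_succ_mul, derivative_hermiteR_succ]
      have h : hermiteR m * (((n : ℝ[X]) + 1) * hermiteR n)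
          = C ((n : ℝ) + 1) * (hermiteR m * hermiteR n) := by
        simp only [map_add, map_natCast, map_one]
        ring
      simp only [h, eval_mul (p := C _), eval_C]
      rw [integral_const_mul, ih]
      by_cases hmn : m = n
      · simp [hmn, Nat.factorial_succ]
      · simp [hmn]

/-- The normalized Hermite functions. -/
def herm (n : ℕ) (x : ℝ) : ℝ := (√(n ! : ℝ))⁻¹ * (hermiteR n).eval x

theorem sqrt_factorial_succ (n : ℕ) : √((n + 1)! : ℝ) = √(n + 1) * √(n ! : ℝ) := by
  rw [Nat.factorial_succ]
  push_cast
  rw [Real.sqrt_mul (by positivity)]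

theorem sqrt_factorial_pos (n : ℕ) : 0 < √(n ! : ℝ) :=
  Real.sqrt_pos.2 (by exact_mod_cast n.factorial_pos)

theorem hasDerivAt_herm_zero (x : ℝ) : HasDerivAt (herm 0) 0 x := by
  have : herm 0 = fun _ => (1 : ℝ) := by ext; simp [herm, hermiteR_zero]
  rw [this]
  exact hasDerivAt_const _ _

theorem hasDerivAt_herm_succ (n : ℕ) (x : ℝ) :
    HasDerivAt (herm (n + 1)) (√(n + 1) * herm n x) x := by
  have h := ((hermiteR (n + 1)).hasDerivAt x).const_mul (√((n + 1)! : ℝ))⁻¹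
  convert! h using 1
  rw [herm, derivative_hermiteR_succ, sqrt_factorial_succ]
  have h1 : √((n : ℝ) + 1) * √((n : ℝ) + 1) = n + 1 := Real.mul_self_sqrt (by positivity)
  have h2 : √((n : ℝ) + 1) ≠ 0 := by positivity
  have := (sqrt_factorial_pos n).ne'
  simp only [eval_mul, eval_add, eval_natCast, eval_one]
  field_simp
  rw [sq, h1]

/-- The creation relation `x hₙ - hₙ' = √(n+1) hₙ₊₁`. -/
theorem mul_herm_sub_deriv (n : ℕ) (x : ℝ) :
    x * herm n x - deriv (herm n) x = √(n + 1) * herm (n + 1) x := by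
  have h := ((hermiteR n).hasDerivAt x).const_mul (√(n ! : ℝ))⁻¹
  have h0 : deriv (herm n) x = (√(n ! : ℝ))⁻¹ * (derivative (hermiteR n)).eval x := h.deriv
  rw [h0, herm, herm, hermiteR_succ, sqrt_factorial_succ]
  have h2 : √((n : ℝ) + 1) ≠ 0 := by positivity
  have := (sqrt_factorial_pos n).ne'
  simp only [eval_sub, eval_mul, eval_X]
  field_simp

theorem herm_zero (x : ℝ) : herm 0 x = 1 := by simp [herm, hermiteR_zero]

theorem contDiff_herm (n : ℕ) : ContDiff ℝ ∞ (herm n) :=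
  contDiff_const.mul (by
    simpa only [aeval_def, eval₂_eq_eval_map, Algebra.algebraMap_self, Polynomial.map_id]
      using Polynomial.contDiff_aeval (𝕜 := ℝ) (hermiteR n) ∞)

theorem memLp_herm (n : ℕ) (q : ℝ≥0∞) (hq : q ≠ ⊤) : MemLp (herm n) q gauss :=
  (memLp_polynomial_gauss _ q hq).const_mul _

/-! ### Completeness of the Hermite functions -/

/-- The positive and negative parts of `g` are densities of two finite measures with the same
characteristic function. The measures therefore coincide, although their densities are never both
positive. -/
theorem eq_zero_of_integral_exp_eq_zero_real {P : Measure ℝ} [IsFiniteMeasure P] {g : ℝ → ℝ}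
    (hg : Integrable g P)
    (h : ∀ ξ : ℝ, ∫ x, Complex.exp (ξ * x * Complex.I) * (g x : ℂ) ∂P = 0) : g =ᵐ[P] 0 := by
  have hpart : ∀ f : ℝ → ℝ, Integrable f P →
      IsFiniteMeasure (P.withDensity fun x => ENNReal.ofReal (f x)) := fun f hf =>
    isFiniteMeasure_withDensity_ofReal hf.2
  have := hpart g hg
  have hn : Integrable (fun x => -g x) P := hg.neg
  have := hpart _ hn
  have hint : ∀ (ξ : ℝ) (f : ℝ → ℝ), Integrable f P →
      Integrable (fun x : ℝ => Complex.exp (ξ * x * Complex.I) * (f x : ℂ)) P := by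
    intro ξ f hf
    refine hf.ofReal.bdd_mul (c := 1) (by fun_prop) (Filter.Eventually.of_forall fun x => ?_)
    have := Complex.norm_exp_ofReal_mul_I (ξ * x)
    push_cast at this
    exact this.le
  have hchar : ∀ (f : ℝ → ℝ), Integrable f P → ∀ ξ : ℝ,
      charFun (P.withDensity fun x => ENNReal.ofReal (f x)) ξ
        = ∫ x, Complex.exp (ξ * x * Complex.I) * ((max (f x) 0 : ℝ) : ℂ) ∂P := by
    intro f hf ξ
    rw [charFun_apply_real, integral_withDensity_eq_integral_toReal_smul₀
      hf.aestronglyMeasurable.aemeasurable.ennreal_ofReal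
      (Filter.Eventually.of_forall fun _ => ENNReal.ofReal_lt_top)]
    refine integral_congr_ae (Filter.Eventually.of_forall fun x => ?_)
    simp only [ENNReal.toReal_ofReal', Complex.real_smul]
    ring
  have heq : P.withDensity (fun x => ENNReal.ofReal (g x))
      = P.withDensity fun x => ENNReal.ofReal (-g x) := by
    refine Measure.ext_of_charFun ?_
    ext ξ
    rw [hchar g hg, hchar _ hn, ← sub_eq_zero,
      ← integral_sub (hint ξ _ hg.pos_part) (hint ξ _ hn.pos_part), ← h ξ]
    refine integral_congr_ae (Filter.Eventually.of_forall fun x => ?_)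
    simp only []
    rw [← mul_sub, ← Complex.ofReal_sub]
    congr 2
    rcases le_total (g x) 0 with h0 | h0
    · rw [max_eq_right h0, max_eq_left (by linarith)]; ring
    · rw [max_eq_left h0, max_eq_right (by linarith)]; ring
  have h3 := (withDensity_eq_iff hg.aestronglyMeasurable.aemeasurable.ennreal_ofReal
    hg.neg.aestronglyMeasurable.aemeasurable.ennreal_ofReal
    hg.lintegral_lt_top.ne).1 heq
  filter_upwards [h3] with x hx
  simp only [Pi.neg_apply] at hx
  rcases le_total (g x) 0 with h0 | h0
  · rw [ENNReal.ofReal_of_nonpos h0] at hx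
    have := ENNReal.ofReal_eq_zero.1 hx.symm
    exact le_antisymm h0 (neg_nonpos.1 this)
  · rw [ENNReal.ofReal_of_nonpos (show -g x ≤ 0 by linarith)] at hx
    exact le_antisymm (ENNReal.ofReal_eq_zero.1 hx) h0

theorem eq_zero_of_integral_exp_eq_zero {P : Measure ℝ} [IsFiniteMeasure P] {f : ℝ → ℂ}
    (hf : Integrable f P)
    (h : ∀ ξ : ℝ, ∫ x, Complex.exp (ξ * x * Complex.I) * f x ∂P = 0) : f =ᵐ[P] 0 := by
  have hint : ∀ (ξ : ℝ) (f : ℝ → ℂ), Integrable f P →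
      Integrable (fun x : ℝ => Complex.exp (ξ * x * Complex.I) * f x) P := by
    intro ξ f hf
    refine hf.bdd_mul (c := 1) (by fun_prop) (Filter.Eventually.of_forall fun x => ?_)
    have := Complex.norm_exp_ofReal_mul_I (ξ * x)
    push_cast at this
    exact this.le
  have hc : Integrable (fun x => conj (f x)) P :=
    ⟨Complex.continuous_conj.comp_aestronglyMeasurable hf.1, by
      simpa [HasFiniteIntegral] using hf.2⟩
  have hconj : ∀ ξ : ℝ, ∫ x, Complex.exp (ξ * x * Complex.I) * conj (f x) ∂P = 0 := by
    intro ξ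
    have h1 := congrArg conj (h (-ξ))
    rw [← integral_conj, map_zero] at h1
    rw [← h1]
    refine integral_congr_ae (Filter.Eventually.of_forall fun x => ?_)
    simp only [map_mul, ← Complex.exp_conj]
    congr 2
    simp
  have hre : (fun x => (f x).re) =ᵐ[P] 0 := by
    refine eq_zero_of_integral_exp_eq_zero_real hf.re fun ξ => ?_
    have h1 : ∀ x : ℝ, Complex.exp (ξ * x * Complex.I) * ((f x).re : ℂ)
        = (1 / 2 : ℂ) * (Complex.exp (ξ * x * Complex.I) * f x)
          + (1 / 2 : ℂ) * (Complex.exp (ξ * x * Complex.I) * conj (f x)) := fun x => by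
      rw [Complex.re_eq_add_conj]; ring
    simp only [h1]
    rw [integral_add ((hint ξ _ hf).const_mul _) ((hint ξ _ hc).const_mul _),
      integral_const_mul, integral_const_mul, h, hconj]
    simp
  have him : (fun x => (f x).im) =ᵐ[P] 0 := by
    refine eq_zero_of_integral_exp_eq_zero_real hf.im fun ξ => ?_
    have h1 : ∀ x : ℝ, Complex.exp (ξ * x * Complex.I) * ((f x).im : ℂ)
        = (1 / (2 * Complex.I) : ℂ) * (Complex.exp (ξ * x * Complex.I) * f x)
          - (1 / (2 * Complex.I) : ℂ) * (Complex.exp (ξ * x * Complex.I) * conj (f x)) :=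
      fun x => by
      rw [Complex.im_eq_sub_conj]; ring
    simp only [h1]
    rw [integral_sub ((hint ξ _ hf).const_mul _) ((hint ξ _ hc).const_mul _),
      integral_const_mul, integral_const_mul, h, hconj]
    simp
  filter_upwards [hre, him] with x h1 h2
  exact Complex.ext h1 h2

theorem memLp_exp_abs_gauss (ξ : ℝ) : MemLp (fun x : ℝ => Real.exp |ξ * x|) 2 gauss := by
  refine (memLp_two_iff_integrable_sq (by fun_prop)).2 ?_
  refine Integrable.mono' ((integrable_exp_mul_gaussianReal (μ := 0) (v := 1) (2 * ξ)).add
    (integrable_exp_mul_gaussianReal (μ := 0) (v := 1) (-(2 * ξ)))) (by fun_prop)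
    (Filter.Eventually.of_forall fun x => ?_)
  rw [Real.norm_of_nonneg (by positivity), ← Real.exp_nat_mul]
  simp only [Pi.add_apply]
  rcases abs_cases (ξ * x) with ⟨h, _⟩ | ⟨h, _⟩
  · rw [h]
    have := Real.exp_pos (-(2 * ξ) * x)
    have h1 : ((2 : ℕ) : ℝ) * (ξ * x) = 2 * ξ * x := by push_cast; ring
    rw [h1]; linarith
  · rw [h]
    have := Real.exp_pos (2 * ξ * x)
    have h1 : ((2 : ℕ) : ℝ) * -(ξ * x) = -(2 * ξ) * x := by push_cast; ring
    rw [h1]; linarith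

/-- Expanding `e^{iξx}` in powers expresses the Fourier transform of `f` times the Gaussian through
the vanishing moments. The exchange of sum and integral is dominated by `e^{|ξx|} |f|`, a product of
two `L²` functions. -/
theorem eq_zero_of_integral_pow_eq_zero {f : ℝ → ℂ} (hf : MemLp f 2 gauss)
    (h : ∀ n : ℕ, ∫ x, (x : ℂ) ^ n * f x ∂gauss = 0) : f =ᵐ[gauss] 0 := by
  refine eq_zero_of_integral_exp_eq_zero (hf.integrable (by norm_num)) fun ξ => ?_
  have hs := hasSum_integral_of_dominated_convergence (μ := gauss)
    (F := fun (n : ℕ) (x : ℝ) => ((ξ * x * Complex.I) ^ n / (n ! : ℂ)) * f x)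
    (f := fun x : ℝ => Complex.exp (ξ * x * Complex.I) * f x)
    (fun n x => |ξ * x| ^ n / n ! * ‖f x‖)
    (fun n => by
      exact (Continuous.aestronglyMeasurable (by fun_prop)).mul hf.aestronglyMeasurable)
    (fun n => Filter.Eventually.of_forall fun x => by
      simp only [norm_mul, norm_div, norm_pow, Complex.norm_I, mul_one, Complex.norm_natCast,
        Complex.norm_real, abs_mul, Real.norm_eq_abs, le_refl])
    (Filter.Eventually.of_forall fun x => (Real.summable_pow_div_factorial _).mul_right _)
    (by
      have h1 : (fun x => ∑' n : ℕ, |ξ * x| ^ n / n ! * ‖f x‖)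
          = fun x => Real.exp |ξ * x| * ‖f x‖ := by
        ext x
        rw [tsum_mul_right, Real.exp_eq_exp_ℝ, NormedSpace.exp_eq_tsum_div]
      rw [h1]
      exact MemLp.integrable_mul (p := 2) (q := 2) (memLp_exp_abs_gauss ξ) hf.norm)
    (Filter.Eventually.of_forall fun x => by
      have := NormedSpace.expSeries_div_hasSum_exp (ξ * x * Complex.I : ℂ)
      rw [← Complex.exp_eq_exp_ℂ] at this
      exact this.mul_right _)
  refine hs.unique ?_
  convert hasSum_zero with n
  have h1 : ∀ x : ℝ, ((ξ * x * Complex.I) ^ n / (n ! : ℂ)) * f x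
      = ((ξ * Complex.I) ^ n / (n ! : ℂ)) * ((x : ℂ) ^ n * f x) := fun x => by ring
  simp only [h1]
  rw [integral_const_mul, h, mul_zero]

theorem isCompleteONS_herm : IsCompleteONS gauss (fun n x => (herm n x : ℂ)) := by
  have hco : ∀ m n, coef gauss (fun n x => (herm n x : ℂ)) (fun x => (herm n x : ℂ)) m
      = ((√(m ! : ℝ))⁻¹ * (√(n ! : ℝ))⁻¹ * (if m = n then (n ! : ℝ) else 0) : ℝ) := by
    intro m n
    rw [← integral_hermiteR_mul_hermiteR, ← integral_const_mul, ← integral_complex_ofReal]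
    refine integral_congr_ae (Filter.Eventually.of_forall fun x => ?_)
    simp only [herm, Complex.conj_ofReal, eval_mul]
    push_cast
    ring
  refine ⟨fun n => (memLp_herm n 2 (by simp)).ofReal, fun n => ?_, fun m n hmn => ?_,
    fun f hf h => ?_⟩
  · rw [hco, if_pos rfl]
    have h1 : √(n ! : ℝ) * √(n ! : ℝ) = n ! := Real.mul_self_sqrt (by positivity)
    have := (sqrt_factorial_pos n).ne'
    have : (√(n ! : ℝ))⁻¹ * (√(n ! : ℝ))⁻¹ * (n ! : ℝ) = 1 := by
      field_simp
      rw [sq, h1]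
    rw [this, Complex.ofReal_one]
  · rw [hco, if_neg hmn, mul_zero, Complex.ofReal_zero]
  · have hint : ∀ p : ℝ[X], Integrable (fun x => ((p.eval x : ℝ) : ℂ) * f x) gauss := fun p =>
      MemLp.integrable_mul (p := 2) (q := 2) (memLp_polynomial_gauss p 2 (by simp)).ofReal hf
    -- The recurrence `X hₙ₊₁ = hₙ₊₂ + (n+1) hₙ` trades a power of `X` for a change of index. The
    -- induction on `k` must therefore carry all `n`; the case `n = 0` of the conclusion gives the
    -- moments.
    have key : ∀ k n, ∫ x, (((X ^ k * hermiteR n).eval x : ℝ) : ℂ) * f x ∂gauss = 0 := by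
      intro k
      induction k with
      | zero =>
        intro n
        have h1 := h n
        unfold coef at h1
        have h2 : ∀ x, conj ((herm n x : ℂ)) * f x
            = ((√(n ! : ℝ))⁻¹ : ℝ) * ((((X ^ 0 * hermiteR n).eval x : ℝ) : ℂ) * f x) := by
          intro x
          simp only [herm, Complex.conj_ofReal, pow_zero, one_mul]
          push_cast
          ring
        simp only [h2] at h1
        rw [integral_const_mul] at h1
        refine (mul_eq_zero.1 h1).resolve_left ?_
        exact_mod_cast (inv_pos.2 (sqrt_factorial_pos n)).ne'
      | succ k ih =>
        intro n
        cases n with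
        | zero =>
          have h2 : X ^ (k + 1) * hermiteR 0 = X ^ k * hermiteR 1 := by
            rw [hermiteR_succ, hermiteR_zero]
            simp
            ring
          rw [h2]
          exact ih 1
        | succ n =>
          have h2 : ∀ x, (((X ^ (k + 1) * hermiteR (n + 1)).eval x : ℝ) : ℂ) * f x
              = (((X ^ k * hermiteR (n + 2)).eval x : ℝ) : ℂ) * f x
                + (n + 1) * ((((X ^ k * hermiteR n).eval x : ℝ) : ℂ) * f x) := by
            intro x
            rw [hermiteR_succ (n + 1), derivative_hermiteR_succ]
            simp only [eval_mul, eval_sub, eval_add, eval_pow, eval_X, eval_natCast, eval_one]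
            push_cast
            ring
          simp only [h2]
          rw [integral_add (hint _) ((hint _).const_mul _), integral_const_mul, ih, ih]
          simp
    refine eq_zero_of_integral_pow_eq_zero hf fun n => ?_
    rw [← key n 0]
    simp [hermiteR_zero]

end Hermite

section PhaseBasis

open ProbabilityTheory

/-! ### Fourier series on the torus -/

theorem volume_torus_eq :
    (volume : Measure Torus) = Measure.pi fun _ => AddCircle.haarAddCircle := by
  rw [volume_pi]
  congr 1
  ext1 i
  rw [AddCircle.volume_eq_smul_haarAddCircle, ENNReal.ofReal_one, one_smul]

instance isProbabilityMeasure_torus : IsProbabilityMeasure (volume : Measure Torus) := by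
  rw [volume_torus_eq]
  infer_instance

theorem isCompleteONS_mFourier :
    IsCompleteONS (volume : Measure Torus) (fun k x => UnitAddTorus.mFourier k x) := by
  rw [volume_torus_eq]
  refine IsCompleteONS.of_hilbertBasis (UnitAddTorus.mFourierBasis (d := Fin 2)) fun k => ?_
  rw [UnitAddTorus.coe_mFourierBasis]
  exact UnitAddTorus.coeFn_mFourierLp 2 k

theorem norm_mFourier_apply (k : Fin 2 → ℤ) (x : Torus) : ‖UnitAddTorus.mFourier k x‖ = 1 := by
  simp [UnitAddTorus.mFourier, Circle.norm_coe]

theorem mFourier_proj (k : Fin 2 → ℤ) (y : Vel) :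
    UnitAddTorus.mFourier k (proj y)
      = Complex.exp (2 * Real.pi * Complex.I * ∑ i, (k i : ℂ) * (y i : ℂ)) := by
  simp only [UnitAddTorus.mFourier, proj, ContinuousMap.coe_mk, fourier_coe_apply,
    Complex.ofReal_one, div_one]
  rw [← Complex.exp_sum, Finset.mul_sum]
  simp only [mul_assoc]

theorem mFourier_add_single (k : Fin 2 → ℤ) (x : Torus) (i : Fin 2) (s : ℝ) :
    UnitAddTorus.mFourier k (x + Pi.single i (s : UnitAddCircle))
      = UnitAddTorus.mFourier k x * Complex.exp (2 * Real.pi * Complex.I * k i * s) := by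
  have h : ∀ j, fourier (k j) (x j + (Pi.single i (s : UnitAddCircle) : Torus) j)
      = fourier (k j) (x j) *
        if j = i then Complex.exp (2 * Real.pi * Complex.I * k i * s) else 1 := by
    intro j
    by_cases hj : j = i
    · subst hj
      simp only [Pi.single_eq_same, if_true]
      have h2 := fourier_coe_apply (T := (1 : ℝ)) (n := k j) (x := s)
      simp only [Complex.ofReal_one, div_one] at h2
      rw [← h2, fourier_apply, fourier_apply, fourier_apply, smul_add, AddCircle.toCircle_add]
      simp
    · simp [hj]
  simp only [UnitAddTorus.mFourier, ContinuousMap.coe_mk, Pi.add_apply, h,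
    Finset.prod_mul_distrib, Finset.prod_ite_eq', Finset.mem_univ, if_true]

/-! ### The basis of `L²` on phase space -/

/-- The reference measure `dx M(v) dv` on phase space. -/
def nu : Measure Phase :=
  (volume : Measure Phase).withDensity fun z => ENNReal.ofReal (maxwellian z.2)

/-- Cartesian coordinates on the velocity space. -/
def velEquiv : Vel ≃ᵐ ℝ × ℝ :=
  (MeasurableEquiv.toLp 2 (Fin 2 → ℝ)).symm.trans MeasurableEquiv.finTwoArrow

theorem velEquiv_apply (v : Vel) : velEquiv v = (v 0, v 1) := rfl

theorem measurePreserving_velEquiv : MeasurePreserving velEquiv volume volume :=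
  (volume_preserving_finTwoArrow ℝ).comp
    (EuclideanSpace.volume_preserving_symm_measurableEquiv_toLp (Fin 2))

theorem maxwellian_eq (v : Vel) :
    maxwellian v = gaussianPDFReal 0 1 (v 0) * gaussianPDFReal 0 1 (v 1) := by
  have h : √(2 * Real.pi) * √(2 * Real.pi) = 2 * Real.pi := Real.mul_self_sqrt (by positivity)
  simp only [maxwellian, gaussianPDFReal, EuclideanSpace.norm_sq_eq, Fin.sum_univ_two,
    NNReal.coe_one, mul_one, sub_zero, Real.norm_eq_abs, sq_abs]
  rw [mul_mul_mul_comm, ← Real.exp_add, ← mul_inv, h]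
  congr 2
  ring

theorem maxwellian_pos (v : Vel) : 0 < maxwellian v := by
  unfold maxwellian
  positivity

theorem contDiff_maxwellian : ContDiff ℝ ∞ maxwellian := by
  unfold maxwellian
  exact contDiff_const.mul (((contDiff_norm_sq ℝ).neg.div_const 2).exp)

theorem measurable_maxwellian : Measurable maxwellian :=
  contDiff_maxwellian.continuous.measurable

/-- The Maxwellian probability measure `M(v) dv`. -/
def gauss2 : Measure Vel := volume.withDensity fun v => ENNReal.ofReal (maxwellian v)

theorem measurePreserving_velEquiv_gauss :
    MeasurePreserving velEquiv gauss2 (gauss.prod gauss) := by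
  refine ⟨velEquiv.measurable, ?_⟩
  have h : gauss.prod gauss = (volume : Measure (ℝ × ℝ)).withDensity
      fun p => ENNReal.ofReal (gaussianPDFReal 0 1 p.1 * gaussianPDFReal 0 1 p.2) := by
    rw [gauss, gaussianReal_of_var_ne_zero _ one_ne_zero,
      prod_withDensity (measurable_gaussianPDF _ _) (measurable_gaussianPDF _ _)]
    congr 1
    ext p
    rw [ENNReal.ofReal_mul (gaussianPDFReal_nonneg _ _ _)]
    rfl
  have hm : Measurable fun p : ℝ × ℝ =>
      ENNReal.ofReal (gaussianPDFReal 0 1 p.1 * gaussianPDFReal 0 1 p.2) :=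
    (((measurable_gaussianPDFReal 0 1).comp measurable_fst).mul
      ((measurable_gaussianPDFReal 0 1).comp measurable_snd)).ennreal_ofReal
  ext s hs
  rw [Measure.map_apply velEquiv.measurable hs, h, withDensity_apply _ hs, gauss2,
    withDensity_apply _ (velEquiv.measurable hs),
    ← measurePreserving_velEquiv.setLIntegral_comp_preimage hs hm]
  simp only [maxwellian_eq, velEquiv_apply]

instance isProbabilityMeasure_gauss2 : IsProbabilityMeasure gauss2 := by
  constructor
  have h := measurePreserving_velEquiv_gauss.measure_preimage_equiv univ
  simpa using h

theorem nu_eq_prod : nu = (volume : Measure Torus).prod gauss2 := by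
  rw [gauss2, prod_withDensity_right measurable_maxwellian.ennreal_ofReal]
  rfl

instance isProbabilityMeasure_nu : IsProbabilityMeasure nu := by
  rw [nu_eq_prod]
  infer_instance

/-- Products of normalized Hermite functions. -/
def herm2 (a : Fin 2 → ℕ) (v : Vel) : ℝ := ∏ i, herm (a i) (v i)

/-- The Fourier-Hermite basis of `L²(dx M(v) dv)`. -/
def phaseBasis (i : (Fin 2 → ℤ) × (Fin 2 → ℕ)) (z : Phase) : ℂ :=
  UnitAddTorus.mFourier i.1 z.1 * (herm2 i.2 z.2 : ℂ)

theorem IsCompleteONS.reindex {ι κ X : Type*} [MeasurableSpace X] {μ : Measure X}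
    {b : ι → X → ℂ} (hb : IsCompleteONS μ b) (e : κ ≃ ι) : IsCompleteONS μ fun k => b (e k) :=
  ⟨fun k => hb.memLp _, fun k => hb.coef_self _,
    fun j k hjk => hb.coef_ne (e j) (e k) (e.injective.ne hjk),
    fun f hf h => hb.complete f hf fun i => by simpa [coef] using h (e.symm i)⟩

theorem isCompleteONS_herm2 : IsCompleteONS gauss2 fun a v => (herm2 a v : ℂ) := by
  have h := ((isCompleteONS_herm.prod isCompleteONS_herm).comp_measurePreserving velEquiv
    measurePreserving_velEquiv_gauss).reindex (finTwoArrowEquiv ℕ)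
  convert h using 3 with a v
  simp [herm2, velEquiv_apply, Fin.prod_univ_two]

theorem isCompleteONS_phaseBasis : IsCompleteONS nu phaseBasis := by
  rw [nu_eq_prod]
  exact isCompleteONS_mFourier.prod isCompleteONS_herm2

/-! ### Ladder relations -/

/-- At `n = 0` the truncated index `n - 1` is harmless, since its coefficient is `√0`. The same
convention serves in `mul_herm2`. -/
theorem mul_herm (n : ℕ) (x : ℝ) :
    x * herm n x = √(n + 1) * herm (n + 1) x + √n * herm (n - 1) x := by
  rw [← mul_herm_sub_deriv]
  cases n with
  | zero => simp [(hasDerivAt_herm_zero x).deriv]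
  | succ n =>
    rw [(hasDerivAt_herm_succ n x).deriv]
    simp

theorem hasDerivAt_herm_mul_gaussianPDFReal (n : ℕ) (x : ℝ) :
    HasDerivAt (fun x => herm n x * gaussianPDFReal 0 1 x)
      (-√(n + 1) * herm (n + 1) x * gaussianPDFReal 0 1 x) x := by
  have hd : DifferentiableAt ℝ (herm n) x :=
    (contDiff_herm n).differentiable (by simp) x
  convert! hd.hasDerivAt.mul (hasDerivAt_gaussianPDFReal x) using 1
  have := mul_herm_sub_deriv n x
  linear_combination gaussianPDFReal 0 1 x * this

theorem mul_herm2 (i : Fin 2) (a : Fin 2 → ℕ) (v : Vel) :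
    v i * herm2 a v = √(a i + 1) * herm2 (a + Pi.single i 1) v
      + √(a i) * herm2 (a - Pi.single i 1) v := by
  fin_cases i
  · have := mul_herm (a 0) (v 0)
    simp [herm2, Fin.prod_univ_two]
    linear_combination herm (a 1) (v 1) * this
  · have := mul_herm (a 1) (v 1)
    simp [herm2, Fin.prod_univ_two]
    linear_combination herm (a 0) (v 0) * this

/-- With the Maxwellian included, differentiation only raises the index. Integrating by parts
against these functions thus turns a weak velocity derivative into a shift of coefficients. -/
theorem hasDerivAt_herm2_mul_maxwellian (i : Fin 2) (a : Fin 2 → ℕ) (v : Vel) :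
    HasDerivAt (fun s : ℝ => herm2 a (v + s • EuclideanSpace.single i (1 : ℝ))
        * maxwellian (v + s • EuclideanSpace.single i (1 : ℝ)))
      (-√(a i + 1) * herm2 (a + Pi.single i 1) v * maxwellian v) 0 := by
  have hlin : ∀ x : ℝ, HasDerivAt (fun s : ℝ => x + s) 1 0 := fun x =>
    (hasDerivAt_id 0).const_add x
  fin_cases i
  · have h := (hasDerivAt_herm_mul_gaussianPDFReal (a 0) (v 0))
    rw [← add_zero (v 0)] at h
    have h2 := (h.comp (0 : ℝ) (hlin (v 0))).mul_const
      (herm (a 1) (v 1) * gaussianPDFReal 0 1 (v 1))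
    convert! h2 using 1
    · ext s
      simp [herm2, maxwellian_eq, Fin.prod_univ_two]
      ring
    · simp [herm2, maxwellian_eq, Fin.prod_univ_two]
      ring
  · have h := (hasDerivAt_herm_mul_gaussianPDFReal (a 1) (v 1))
    rw [← add_zero (v 1)] at h
    have h2 := (h.comp (0 : ℝ) (hlin (v 1))).mul_const
      (herm (a 0) (v 0) * gaussianPDFReal 0 1 (v 0))
    convert! h2 using 1
    · ext s
      simp [herm2, maxwellian_eq, Fin.prod_univ_two]
      ring
    · simp [herm2, maxwellian_eq, Fin.prod_univ_two]
      ring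

theorem contDiff_herm2 (a : Fin 2 → ℕ) : ContDiff ℝ ∞ (herm2 a) := by
  unfold herm2
  exact contDiff_prod fun i _ => (contDiff_herm (a i)).comp (contDiff_euclidean.1 contDiff_id i)

end PhaseBasis

/-! ### Cutoff functions in velocity -/

/-- A smooth bump function on the velocity space. -/
def velBump : ContDiffBump (0 : Vel) := ⟨1, 2, one_pos, one_lt_two⟩

/-- Smooth cutoffs at velocities of size `n + 1`. -/
def cutoff (n : ℕ) (v : Vel) : ℝ := velBump (((n : ℝ) + 1)⁻¹ • v)

/-- The partial derivatives of `cutoff n`. -/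
def dcutoff (n : ℕ) (i : Fin 2) (v : Vel) : ℝ :=
  ((n : ℝ) + 1)⁻¹ * fderiv ℝ velBump (((n : ℝ) + 1)⁻¹ • v) (EuclideanSpace.single i (1 : ℝ))

theorem contDiff_cutoff (n : ℕ) : ContDiff ℝ ∞ (cutoff n) :=
  velBump.contDiff.comp (contDiff_const_smul _)

theorem cutoff_nonneg (n : ℕ) (v : Vel) : 0 ≤ cutoff n v := velBump.nonneg

theorem cutoff_le_one (n : ℕ) (v : Vel) : cutoff n v ≤ 1 := velBump.le_one

theorem cutoff_eq_zero {n : ℕ} {v : Vel} (hv : 2 * ((n : ℝ) + 1) < ‖v‖) : cutoff n v = 0 := by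
  refine velBump.zero_of_le_dist ?_
  rw [dist_zero_right, norm_smul, norm_inv, Real.norm_of_nonneg (by positivity)]
  change (2 : ℝ) ≤ _
  rw [inv_mul_eq_div, le_div_iff₀ (by positivity)]
  exact hv.le

theorem tendsto_cutoff (v : Vel) : Tendsto (fun n => cutoff n v) atTop (𝓝 1) := by
  have h1 : Tendsto (fun n : ℕ => (((n : ℝ) + 1)⁻¹ • v)) atTop (𝓝 0) := by
    simpa using (tendsto_inv_atTop_zero.comp
      (tendsto_atTop_add_const_right atTop (1 : ℝ) tendsto_natCast_atTop_atTop)).smul_const v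
  have h2 : velBump (0 : Vel) = 1 :=
    velBump.one_of_mem_closedBall (Metric.mem_closedBall_self zero_le_one)
  rw [← h2]
  exact (velBump.continuous.tendsto 0).comp h1

theorem hasDerivAt_cutoff (n : ℕ) (i : Fin 2) (v : Vel) :
    HasDerivAt (fun s : ℝ => cutoff n (v + s • EuclideanSpace.single i (1 : ℝ)))
      (dcutoff n i v) 0 := by
  set e : Vel := EuclideanSpace.single i (1 : ℝ)
  have hl : HasDerivAt (fun s : ℝ => ((n : ℝ) + 1)⁻¹ • (v + s • e)) (((n : ℝ) + 1)⁻¹ • e) 0 := by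
    have := (((hasDerivAt_id (0 : ℝ)).smul_const e).const_add v).const_smul ((n : ℝ) + 1)⁻¹
    rwa [one_smul] at this
  have hb : HasFDerivAt velBump (fderiv ℝ velBump (((n : ℝ) + 1)⁻¹ • v))
      (((n : ℝ) + 1)⁻¹ • (v + (0 : ℝ) • e)) := by
    rw [zero_smul, add_zero]
    exact (velBump.contDiff (n := 1)).differentiable (by simp) _ |>.hasFDerivAt
  have := hb.comp_hasDerivAt (0 : ℝ) hl
  rw [map_smul] at this
  exact this

theorem continuous_dcutoff (n : ℕ) (i : Fin 2) : Continuous (dcutoff n i) := by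
  have h : Continuous (fderiv ℝ velBump) :=
    (velBump.contDiff (n := 1)).continuous_fderiv (by simp)
  unfold dcutoff
  exact continuous_const.mul ((h.comp (continuous_const_smul _)).clm_apply continuous_const)

theorem exists_dcutoff_bound :
    ∃ C : ℝ, ∀ n i v, |dcutoff n i v| ≤ ((n : ℝ) + 1)⁻¹ * C := by
  have h : Continuous (fderiv ℝ velBump) :=
    (velBump.contDiff (n := 1)).continuous_fderiv (by simp)
  obtain ⟨C, hC⟩ := h.bounded_above_of_compact_support
    (velBump.hasCompactSupport.fderiv (𝕜 := ℝ))
  refine ⟨C, fun n i v => ?_⟩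
  rw [dcutoff, abs_mul, abs_of_nonneg (by positivity : (0 : ℝ) ≤ ((n : ℝ) + 1)⁻¹)]
  gcongr
  have h2 := (fderiv ℝ velBump (((n : ℝ) + 1)⁻¹ • v)).le_opNorm
    (EuclideanSpace.single i (1 : ℝ))
  rw [PiLp.norm_single, norm_one, mul_one] at h2
  exact h2.trans (hC _)

theorem tendsto_integral_cutoff_mul {F : Phase → ℝ} (hF : Integrable F) :
    Tendsto (fun n => ∫ z, cutoff n z.2 * F z) atTop (𝓝 (∫ z, F z)) := by
  refine tendsto_integral_of_dominated_convergence (fun z => ‖F z‖) (fun n => ?_) hF.norm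
    (fun n => Eventually.of_forall fun z => ?_) (Eventually.of_forall fun z => ?_)
  · exact ((contDiff_cutoff n).continuous.comp continuous_snd).aestronglyMeasurable.mul hF.1
  · rw [norm_mul, Real.norm_of_nonneg (cutoff_nonneg _ _)]
    exact mul_le_of_le_one_left (norm_nonneg _) (cutoff_le_one _ _)
  · simpa using (tendsto_cutoff z.2).mul_const (F z)

/-- The cutoff varies on the scale `n + 1`, so its derivative is uniformly `O(1/(n+1))`. -/
theorem tendsto_integral_dcutoff_mul {F : Phase → ℝ} (hF : Integrable F) (i : Fin 2) :
    Tendsto (fun n => ∫ z, dcutoff n i z.2 * F z) atTop (𝓝 0) := by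
  obtain ⟨C, hC⟩ := exists_dcutoff_bound
  have hC0 : 0 ≤ C := by
    have := (abs_nonneg _).trans (hC 0 i 0)
    simpa using this
  have h0 : Tendsto (fun n : ℕ => ((n : ℝ) + 1)⁻¹ * C) atTop (𝓝 0) := by
    simpa using (tendsto_inv_atTop_zero.comp
      (tendsto_atTop_add_const_right atTop (1 : ℝ) tendsto_natCast_atTop_atTop)).mul_const C
  have h1 : Tendsto (fun n : ℕ => ((n : ℝ) + 1)⁻¹ * C * ∫ z, ‖F z‖) atTop (𝓝 0) := by
    simpa using h0.mul_const (∫ z, ‖F z‖)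
  refine squeeze_zero_norm (fun n => ?_) h1
  rw [← integral_const_mul]
  refine norm_integral_le_of_norm_le (hF.norm.const_mul _) (Eventually.of_forall fun z => ?_)
  rw [norm_mul]
  gcongr
  exact hC n i z.2

theorem integrable_cutoff_mul {F : Phase → ℝ} (hF : Integrable F) (n : ℕ) :
    Integrable fun z => cutoff n z.2 * F z := by
  refine hF.bdd_mul (c := 1)
    ((contDiff_cutoff n).continuous.comp continuous_snd).aestronglyMeasurable
    (Eventually.of_forall fun z => ?_)
  rw [Real.norm_of_nonneg (cutoff_nonneg _ _)]
  exact cutoff_le_one _ _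

theorem integrable_dcutoff_mul {F : Phase → ℝ} (hF : Integrable F) (n : ℕ) (i : Fin 2) :
    Integrable fun z => dcutoff n i z.2 * F z := by
  obtain ⟨C, hC⟩ := exists_dcutoff_bound
  exact hF.bdd_mul (c := ((n : ℝ) + 1)⁻¹ * C)
    ((continuous_dcutoff n i).comp continuous_snd).aestronglyMeasurable
    (Eventually.of_forall fun z => hC n i z.2)

/-! ### Enlarging the class of test functions -/

theorem isTest_cutoff_mul {χ : Torus → ℝ} {q : Vel → ℝ} (hχ : IsTestT χ) (hq : ContDiff ℝ ∞ q)
    (n : ℕ) : IsTest fun z => χ z.1 * (cutoff n z.2 * q z.2) := by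
  refine ⟨?_, ?_⟩
  · have h1 : ContDiff ℝ ∞ fun y : Vel × Vel => χ (proj y.1) := by
      unfold IsTestT at hχ
      exact hχ.comp contDiff_fst
    have h2 : ContDiff ℝ ∞ fun y : Vel × Vel => cutoff n y.2 * q y.2 :=
      ((contDiff_cutoff n).mul hq).comp contDiff_snd
    exact h1.mul h2
  · refine HasCompactSupport.intro
      (isCompact_univ.prod (isCompact_closedBall (0 : Vel) (2 * ((n : ℝ) + 1)))) fun z hz => ?_
    have : 2 * ((n : ℝ) + 1) < ‖z.2‖ := by
      simpa using hz
    simp [cutoff_eq_zero this]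

/-- Extends the weak formulation to test functions without compact support in `v`, such as Hermite
functions times the Maxwellian. The cutoff depends on `v` only and commutes with `∂_{x_i}`. -/
theorem IsWeakDeriv.integral_partialX {i : Fin 2} {u w : Phase → ℝ}
    (h : IsWeakDeriv (partialX i) u w) {χ : Torus → ℝ} {q : Vel → ℝ} (hχ : IsTestT χ)
    (hq : ContDiff ℝ ∞ q) (h1 : Integrable fun z => u z * (partialT i χ z.1 * q z.2))
    (h2 : Integrable fun z => w z * (χ z.1 * q z.2)) :
    ∫ z, u z * (partialT i χ z.1 * q z.2) = -∫ z, w z * (χ z.1 * q z.2) := by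
  refine tendsto_nhds_unique (tendsto_integral_cutoff_mul h1) ?_
  convert! (tendsto_integral_cutoff_mul h2).neg using 1
  ext n
  have h3 := h.2.2 _ (isTest_cutoff_mul hχ hq n)
  have h4 : ∀ z, partialX i (fun z : Phase => χ z.1 * (cutoff n z.2 * q z.2)) z
      = partialT i χ z.1 * (cutoff n z.2 * q z.2) := fun z => by
    simp only [partialX, partialT]
    exact deriv_mul_const_field _
  simp only [h4] at h3
  convert h3 using 3
  · ring
  · ext z; ring

/-- Here the derivative also falls on the cutoff; that contribution tends to zero, which is why `u χ
q` too must be integrable. -/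
theorem IsWeakDeriv.integral_partialV {i : Fin 2} {u w : Phase → ℝ}
    (h : IsWeakDeriv (partialV i) u w) {χ : Torus → ℝ} {q q' : Vel → ℝ} (hχ : IsTestT χ)
    (hq : ContDiff ℝ ∞ q)
    (hq' : ∀ v, HasDerivAt (fun s : ℝ => q (v + s • EuclideanSpace.single i (1 : ℝ))) (q' v) 0)
    (h0 : Integrable fun z => u z * (χ z.1 * q z.2))
    (h1 : Integrable fun z => u z * (χ z.1 * q' z.2))
    (h2 : Integrable fun z => w z * (χ z.1 * q z.2)) :
    ∫ z, u z * (χ z.1 * q' z.2) = -∫ z, w z * (χ z.1 * q z.2) := by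
  have hlim := (tendsto_integral_dcutoff_mul h0 i).add (tendsto_integral_cutoff_mul h1)
  rw [zero_add] at hlim
  refine tendsto_nhds_unique hlim ?_
  convert! (tendsto_integral_cutoff_mul h2).neg using 1
  ext n
  have h3 := h.2.2 _ (isTest_cutoff_mul hχ hq n)
  have h4 : ∀ z, partialV i (fun z : Phase => χ z.1 * (cutoff n z.2 * q z.2)) z
      = χ z.1 * (dcutoff n i z.2 * q z.2 + cutoff n z.2 * q' z.2) := fun z => by
    have := ((hasDerivAt_cutoff n i z.2).mul (hq' z.2)).const_mul (χ z.1)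
    simp only [zero_smul, add_zero] at this
    exact this.deriv
  simp only [h4] at h3
  rw [← integral_add (integrable_dcutoff_mul h0 n i) (integrable_cutoff_mul h1 n)]
  convert h3 using 3
  · ring
  · ext z; ring

/-! ### Fourier-Hermite coefficients of weak derivatives -/

theorem contDiff_mFourier_proj (k : Fin 2 → ℤ) :
    ContDiff ℝ ∞ fun y : Vel => UnitAddTorus.mFourier k (proj y) := by
  simp only [mFourier_proj]
  refine ContDiff.cexp (contDiff_const.mul (ContDiff.sum fun i _ => contDiff_const.mul ?_))
  exact Complex.ofRealCLM.contDiff.comp (contDiff_euclidean.1 contDiff_id i)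

theorem isTestT_mFourier_re (k : Fin 2 → ℤ) :
    IsTestT fun x => (UnitAddTorus.mFourier k x).re :=
  Complex.reCLM.contDiff.comp (contDiff_mFourier_proj k)

theorem isTestT_mFourier_im (k : Fin 2 → ℤ) :
    IsTestT fun x => (UnitAddTorus.mFourier k x).im :=
  Complex.imCLM.contDiff.comp (contDiff_mFourier_proj k)

theorem hasDerivAt_mFourier (k : Fin 2 → ℤ) (i : Fin 2) (x : Torus) :
    HasDerivAt (fun s : ℝ => UnitAddTorus.mFourier k (x + Pi.single i (s : UnitAddCircle)))
      (2 * Real.pi * Complex.I * k i * UnitAddTorus.mFourier k x) 0 := by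
  simp only [mFourier_add_single]
  have h : HasDerivAt (fun s : ℝ => (2 * Real.pi * Complex.I * k i * (s : ℂ)))
      (2 * Real.pi * Complex.I * k i) 0 := by
    simpa using (Complex.ofRealCLM.hasDerivAt (x := (0 : ℝ))).const_mul
      (2 * Real.pi * Complex.I * k i : ℂ)
  have := h.cexp.const_mul (UnitAddTorus.mFourier k x)
  convert! this using 1
  simp
  ring

theorem partialT_mFourier_re (k : Fin 2 → ℤ) (i : Fin 2) (x : Torus) :
    partialT i (fun x => (UnitAddTorus.mFourier k x).re) x
      = -(2 * Real.pi * k i) * (UnitAddTorus.mFourier k x).im := by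
  have h := Complex.reCLM.hasFDerivAt.comp_hasDerivAt (0 : ℝ) (hasDerivAt_mFourier k i x)
  refine h.deriv.trans ?_
  simp

theorem partialT_mFourier_im (k : Fin 2 → ℤ) (i : Fin 2) (x : Torus) :
    partialT i (fun x => (UnitAddTorus.mFourier k x).im) x
      = 2 * Real.pi * k i * (UnitAddTorus.mFourier k x).re := by
  have h := Complex.imCLM.hasFDerivAt.comp_hasDerivAt (0 : ℝ) (hasDerivAt_mFourier k i x)
  refine h.deriv.trans ?_
  simp

theorem measurable_maxwellian_snd : Measurable fun z : Phase => maxwellian z.2 :=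
  measurable_maxwellian.comp measurable_snd

theorem integral_nu (F : Phase → ℝ) : ∫ z, F z ∂nu = ∫ z, maxwellian z.2 * F z := by
  rw [nu, integral_withDensity_eq_integral_toReal_smul
    measurable_maxwellian_snd.ennreal_ofReal
    (Eventually.of_forall fun _ => ENNReal.ofReal_lt_top)]
  simp only [ENNReal.toReal_ofReal (maxwellian_pos _).le, smul_eq_mul]

theorem integrable_nu_iff (F : Phase → ℝ) :
    Integrable F nu ↔ Integrable fun z => maxwellian z.2 * F z := by
  rw [nu, integrable_withDensity_iff_integrable_smul'
    measurable_maxwellian_snd.ennreal_ofReal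
    (Eventually.of_forall fun _ => ENNReal.ofReal_lt_top)]
  simp only [ENNReal.toReal_ofReal (maxwellian_pos _).le, smul_eq_mul]

theorem phaseBasis_re (k : Fin 2 → ℤ) (a : Fin 2 → ℕ) (z : Phase) :
    (phaseBasis (k, a) z).re = (UnitAddTorus.mFourier k z.1).re * herm2 a z.2 := by
  simp [phaseBasis]

theorem phaseBasis_im (k : Fin 2 → ℤ) (a : Fin 2 → ℕ) (z : Phase) :
    (phaseBasis (k, a) z).im = (UnitAddTorus.mFourier k z.1).im * herm2 a z.2 := by
  simp [phaseBasis]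

theorem integrable_mul_re {u : Phase → ℝ} (hu : MemLp u 2 nu) (k : Fin 2 → ℤ)
    (a : Fin 2 → ℕ) : Integrable fun z => u z *
      ((UnitAddTorus.mFourier k z.1).re * (herm2 a z.2 * maxwellian z.2)) := by
  have h := (integrable_nu_iff _).1 (MemLp.integrable_mul (p := 2) (q := 2) hu
    (isCompleteONS_phaseBasis.memLp (k, a)).re)
  refine h.congr (Eventually.of_forall fun z => ?_)
  simp only [Pi.mul_apply, RCLike.re_to_complex, phaseBasis_re]
  ring

theorem integrable_mul_im {u : Phase → ℝ} (hu : MemLp u 2 nu) (k : Fin 2 → ℤ)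
    (a : Fin 2 → ℕ) : Integrable fun z => u z *
      ((UnitAddTorus.mFourier k z.1).im * (herm2 a z.2 * maxwellian z.2)) := by
  have h := (integrable_nu_iff _).1 (MemLp.integrable_mul (p := 2) (q := 2) hu
    (isCompleteONS_phaseBasis.memLp (k, a)).im)
  refine h.congr (Eventually.of_forall fun z => ?_)
  simp only [Pi.mul_apply, RCLike.im_to_complex, phaseBasis_im]
  ring

/-- The Fourier-Hermite coefficients of a real function. -/
def fhCoef (u : Phase → ℝ) (k : Fin 2 → ℤ) (a : Fin 2 → ℕ) : ℂ :=
  coef nu phaseBasis (fun z => (u z : ℂ)) (k, a)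

/-- Weak derivatives are tested against real functions only, so the complex coefficient is split
into two real integrals against Lebesgue measure. -/
theorem fhCoef_eq {u : Phase → ℝ} (hu : MemLp u 2 nu) (k : Fin 2 → ℤ) (a : Fin 2 → ℕ) :
    fhCoef u k a
      = ((∫ z, u z * ((UnitAddTorus.mFourier k z.1).re * (herm2 a z.2 * maxwellian z.2)) : ℝ) : ℂ)
      - Complex.I *
        ((∫ z, u z * ((UnitAddTorus.mFourier k z.1).im * (herm2 a z.2 * maxwellian z.2)) : ℝ)
          : ℂ) := by
  have hint : Integrable (fun z => conj (phaseBasis (k, a) z) * (u z : ℂ)) nu :=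
    integrable_conj_mul (isCompleteONS_phaseBasis.memLp (k, a)) hu.ofReal
  have hre : (∫ z, conj (phaseBasis (k, a) z) * (u z : ℂ) ∂nu).re
      = ∫ z, u z * ((UnitAddTorus.mFourier k z.1).re * (herm2 a z.2 * maxwellian z.2)) := by
    refine (integral_re hint).symm.trans ((integral_nu _).trans ?_)
    refine integral_congr_ae (Eventually.of_forall fun z => ?_)
    simp [phaseBasis_re]
    ring
  have him : (∫ z, conj (phaseBasis (k, a) z) * (u z : ℂ) ∂nu).im
      = -∫ z, u z * ((UnitAddTorus.mFourier k z.1).im * (herm2 a z.2 * maxwellian z.2)) := by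
    refine (integral_im hint).symm.trans ((integral_nu _).trans ?_)
    rw [← integral_neg]
    refine integral_congr_ae (Eventually.of_forall fun z => ?_)
    simp [phaseBasis_im]
    ring
  unfold fhCoef coef
  rw [← hre]
  apply Complex.ext
  · simp
  · simp [him]

theorem fhCoef_partialX {i : Fin 2} {u w : Phase → ℝ} (h : IsWeakDeriv (partialX i) u w)
    (hu : MemLp u 2 nu) (hw : MemLp w 2 nu) (k : Fin 2 → ℤ) (a : Fin 2 → ℕ) :
    fhCoef w k a = 2 * Real.pi * Complex.I * k i * fhCoef u k a := by
  have hq : ContDiff ℝ ∞ fun v => herm2 a v * maxwellian v :=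
    (contDiff_herm2 a).mul contDiff_maxwellian
  have hA := h.integral_partialX (isTestT_mFourier_re k) hq (by
    simp only [partialT_mFourier_re]
    refine ((integrable_mul_im hu k a).const_mul (-(2 * Real.pi * k i))).congr
      (Eventually.of_forall fun z => ?_)
    ring) (integrable_mul_re hw k a)
  have hB := h.integral_partialX (isTestT_mFourier_im k) hq (by
    simp only [partialT_mFourier_im]
    refine ((integrable_mul_re hu k a).const_mul (2 * Real.pi * k i)).congr
      (Eventually.of_forall fun z => ?_)
    ring) (integrable_mul_im hw k a)
  simp only [partialT_mFourier_re] at hA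
  simp only [partialT_mFourier_im] at hB
  have hA' : ∫ z, w z * ((UnitAddTorus.mFourier k z.1).re * (herm2 a z.2 * maxwellian z.2))
      = 2 * Real.pi * k i *
        ∫ z, u z * ((UnitAddTorus.mFourier k z.1).im * (herm2 a z.2 * maxwellian z.2)) := by
    rw [← integral_const_mul, ← neg_eq_iff_eq_neg.2 hA, ← integral_neg]
    congr 1
    ext z
    ring
  have hB' : ∫ z, w z * ((UnitAddTorus.mFourier k z.1).im * (herm2 a z.2 * maxwellian z.2))
      = -(2 * Real.pi * k i) *
        ∫ z, u z * ((UnitAddTorus.mFourier k z.1).re * (herm2 a z.2 * maxwellian z.2)) := by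
    rw [← integral_const_mul, ← neg_eq_iff_eq_neg.2 hB, ← integral_neg]
    congr 1
    ext z
    ring
  rw [fhCoef_eq hw, fhCoef_eq hu, hA', hB']
  push_cast
  ring_nf
  simp only [Complex.I_sq]
  ring

theorem fhCoef_partialV {i : Fin 2} {u w : Phase → ℝ} (h : IsWeakDeriv (partialV i) u w)
    (hu : MemLp u 2 nu) (hw : MemLp w 2 nu) (k : Fin 2 → ℤ) (a : Fin 2 → ℕ) :
    fhCoef w k a = √(a i + 1) * fhCoef u k (a + Pi.single i 1) := by
  have hq : ContDiff ℝ ∞ fun v => herm2 a v * maxwellian v :=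
    (contDiff_herm2 a).mul contDiff_maxwellian
  have hA := h.integral_partialV (isTestT_mFourier_re k) hq
    (hasDerivAt_herm2_mul_maxwellian i a) (integrable_mul_re hu k a) (by
    refine ((integrable_mul_re hu k (a + Pi.single i 1)).const_mul (-√(a i + 1))).congr
      (Eventually.of_forall fun z => ?_)
    ring) (integrable_mul_re hw k a)
  have hB := h.integral_partialV (isTestT_mFourier_im k) hq
    (hasDerivAt_herm2_mul_maxwellian i a) (integrable_mul_im hu k a) (by
    refine ((integrable_mul_im hu k (a + Pi.single i 1)).const_mul (-√(a i + 1))).congr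
      (Eventually.of_forall fun z => ?_)
    ring) (integrable_mul_im hw k a)
  have hA' : ∫ z, w z * ((UnitAddTorus.mFourier k z.1).re * (herm2 a z.2 * maxwellian z.2))
      = √(a i + 1) * ∫ z, u z * ((UnitAddTorus.mFourier k z.1).re *
          (herm2 (a + Pi.single i 1) z.2 * maxwellian z.2)) := by
    rw [← integral_const_mul, ← neg_eq_iff_eq_neg.2 hA, ← integral_neg]
    congr 1
    ext z
    ring
  have hB' : ∫ z, w z * ((UnitAddTorus.mFourier k z.1).im * (herm2 a z.2 * maxwellian z.2))
      = √(a i + 1) * ∫ z, u z * ((UnitAddTorus.mFourier k z.1).im *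
          (herm2 (a + Pi.single i 1) z.2 * maxwellian z.2)) := by
    rw [← integral_const_mul, ← neg_eq_iff_eq_neg.2 hB, ← integral_neg]
    congr 1
    ext z
    ring
  rw [fhCoef_eq hw, fhCoef_eq hu, hA', hB']
  push_cast
  ring

/-! ### Poincaré and elliptic inequalities for the reference measure -/

theorem tsum_enorm_fhCoef_sq {u : Phase → ℝ} (hu : MemLp u 2 nu) :
    ∑' p : (Fin 2 → ℤ) × (Fin 2 → ℕ), ‖fhCoef u p.1 p.2‖ₑ ^ 2 = eLpNorm u 2 nu ^ 2 := by
  have h := isCompleteONS_phaseBasis.tsum_enorm_sq (f := fun z => (u z : ℂ)) hu.ofReal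
  have h2 : eLpNorm (fun z => (u z : ℂ)) 2 nu = eLpNorm u 2 nu :=
    eLpNorm_congr_norm_ae (Eventually.of_forall fun z => Complex.norm_real _)
  rw [h2] at h
  exact h

/-- Raising the Hermite index in the direction `i`. -/
def raise (i : Fin 2) (p : (Fin 2 → ℤ) × (Fin 2 → ℕ)) : (Fin 2 → ℤ) × (Fin 2 → ℕ) :=
  (p.1, p.2 + Pi.single i 1)

theorem raise_injective (i : Fin 2) : Function.Injective (raise i) := fun p q h => by
  simp only [raise, Prod.mk.injEq, add_left_inj] at h
  exact Prod.ext h.1 h.2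

theorem sub_single_add_single {a : Fin 2 → ℕ} {i : Fin 2} (h : a i ≠ 0) :
    a - Pi.single i 1 + Pi.single i 1 = a := by
  ext j
  by_cases hj : j = i
  · subst hj
    simp
    omega
  · simp [hj]

theorem fhCoef_partialV_sub {i : Fin 2} {u w : Phase → ℝ} (h : IsWeakDeriv (partialV i) u w)
    (hu : MemLp u 2 nu) (hw : MemLp w 2 nu) (k : Fin 2 → ℤ) {a : Fin 2 → ℕ} (ha : a i ≠ 0) :
    fhCoef w k (a - Pi.single i 1) = √(a i) * fhCoef u k a := by
  have h1 := fhCoef_partialV h hu hw k (a - Pi.single i 1)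
  rw [sub_single_add_single ha] at h1
  rw [h1]
  congr 3
  simp only [Pi.sub_apply, Pi.single_eq_same]
  rw [Nat.cast_sub (by omega)]
  simp

theorem fhCoef_sub_mean {u : Phase → ℝ} (hu : MemLp u 2 nu) (k : Fin 2 → ℤ) (a : Fin 2 → ℕ) :
    fhCoef (fun z => u z - ∫ y, u y ∂nu) k a = if k = 0 ∧ a = 0 then 0 else fhCoef u k a := by
  have h1 : ∀ z, phaseBasis (0, 0) z = 1 := fun z => by
    simp [phaseBasis, UnitAddTorus.mFourier_zero, herm2, herm_zero]
  set c : ℝ := ∫ y, u y ∂nu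
  have hc : fhCoef (fun z => u z - c) k a
      = fhCoef u k a - c * coef nu phaseBasis (phaseBasis (0, 0)) (k, a) := by
    unfold fhCoef coef
    rw [← integral_const_mul, ← integral_sub]
    · refine integral_congr_ae (Eventually.of_forall fun z => ?_)
      simp only [h1]
      push_cast
      ring
    · exact integrable_conj_mul (isCompleteONS_phaseBasis.memLp (k, a)) hu.ofReal
    · exact (integrable_conj_mul (isCompleteONS_phaseBasis.memLp (k, a))
        (isCompleteONS_phaseBasis.memLp (0, 0))).const_mul _
  rw [hc]
  split_ifs with h
  · obtain ⟨rfl, rfl⟩ := h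
    rw [isCompleteONS_phaseBasis.coef_self]
    unfold fhCoef coef
    simp only [h1, map_one, one_mul]
    rw [integral_complex_ofReal]
    simp [c]
  · rw [isCompleteONS_phaseBasis.coef_ne]
    · simp
    · intro h2
      simp only [Prod.mk.injEq] at h2
      exact h h2

theorem enorm_sq_le_of_norm_le {a b : ℂ} (h : ‖a‖ ≤ ‖b‖) : ‖a‖ₑ ^ 2 ≤ ‖b‖ₑ ^ 2 := by
  gcongr
  exact enorm_le_iff_norm_le.2 h

/-- Indexes the coefficients of a velocity derivative by the coefficient of `u` from which each one
comes. Indices with `p.2 i = 0` are lost under differentiation and contribute zero. -/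
theorem tsum_ite_sub_single (i : Fin 2) (f : (Fin 2 → ℤ) × (Fin 2 → ℕ) → ℝ≥0∞) :
    ∑' p : (Fin 2 → ℤ) × (Fin 2 → ℕ),
      (if p.2 i ≠ 0 then f (p.1, p.2 - Pi.single i 1) else 0) = ∑' p, f p := by
  rw [← (raise_injective i).tsum_eq]
  · refine tsum_congr fun p => ?_
    simp [raise]
  · intro p hp
    have h : p.2 i ≠ 0 := by
      by_contra h
      exact hp (by simp [h])
    exact ⟨(p.1, p.2 - Pi.single i 1), Prod.ext rfl (sub_single_add_single h)⟩

/-- Every index `(k, a) ≠ 0` is seen by some derivative with a factor at least one: `√(a i)` from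
`∂_{v_i}` if `a i ≠ 0`, and `2π|k i|` from `∂_{x_i}` if `a = 0` and `k i ≠ 0`. One such derivative
per index suffices, compared term by term in Parseval's identity. -/
theorem poincare_nu {u : Phase → ℝ} {G F : Fin 2 → Phase → ℝ} (hu : MemLp u 2 nu)
    (hG : ∀ i, IsWeakDeriv (partialV i) u (G i)) (hF : ∀ i, IsWeakDeriv (partialX i) u (F i))
    (hG2 : ∀ i, MemLp (G i) 2 nu) (hF2 : ∀ i, MemLp (F i) 2 nu) :
    eLpNorm (fun z => u z - ∫ y, u y ∂nu) 2 nu ^ 2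
      ≤ ∑ i, eLpNorm (G i) 2 nu ^ 2 + ∑ i, eLpNorm (F i) 2 nu ^ 2 := by
  have hm : MemLp (fun z => u z - ∫ y, u y ∂nu) 2 nu := hu.sub (memLp_const _)
  rw [← tsum_enorm_fhCoef_sq hm]
  simp only [← tsum_enorm_fhCoef_sq (hG2 _), ← tsum_enorm_fhCoef_sq (hF2 _)]
  have e1 : ∀ i, ∑' p : (Fin 2 → ℤ) × (Fin 2 → ℕ), ‖fhCoef (G i) p.1 p.2‖ₑ ^ 2
      = ∑' p : (Fin 2 → ℤ) × (Fin 2 → ℕ),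
        (if p.2 i ≠ 0 then ‖fhCoef (G i) p.1 (p.2 - Pi.single i 1)‖ₑ ^ 2 else 0) := fun i =>
    (tsum_ite_sub_single i fun p => ‖fhCoef (G i) p.1 p.2‖ₑ ^ 2).symm
  simp only [e1, Fin.sum_univ_two, ← ENNReal.tsum_add]
  refine ENNReal.tsum_le_tsum fun p => ?_
  obtain ⟨k, a⟩ := p
  simp only []
  rw [fhCoef_sub_mean hu]
  have hV : ∀ i, a i ≠ 0 → ‖fhCoef u k a‖ₑ ^ 2 ≤ ‖fhCoef (G i) k (a - Pi.single i 1)‖ₑ ^ 2 := by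
    intro i hi
    refine enorm_sq_le_of_norm_le ?_
    rw [fhCoef_partialV_sub (hG i) hu (hG2 i) k hi, norm_mul, Complex.norm_real,
      Real.norm_of_nonneg (Real.sqrt_nonneg _)]
    refine le_mul_of_one_le_left (norm_nonneg _) ?_
    rw [Real.one_le_sqrt]
    exact_mod_cast Nat.one_le_iff_ne_zero.2 hi
  have hX : ∀ i, k i ≠ 0 → ‖fhCoef u k a‖ₑ ^ 2 ≤ ‖fhCoef (F i) k a‖ₑ ^ 2 := by
    intro i hi
    refine enorm_sq_le_of_norm_le ?_
    rw [fhCoef_partialX (hF i) hu (hF2 i) k a, norm_mul]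
    refine le_mul_of_one_le_left (norm_nonneg _) ?_
    simp only [norm_mul, Complex.norm_I, mul_one, Complex.norm_real, Complex.norm_ofNat,
      Complex.norm_intCast]
    have h1 : (1 : ℝ) ≤ |(k i : ℝ)| := by exact_mod_cast Int.one_le_abs hi
    have h2 : (3 : ℝ) ≤ ‖Real.pi‖ := by
      rw [Real.norm_of_nonneg Real.pi_pos.le]; exact Real.pi_gt_three.le
    nlinarith
  by_cases h : k = 0 ∧ a = 0
  · simp [h]
  rw [if_neg h]
  by_cases h0 : a 0 ≠ 0
  · rw [if_pos h0, add_assoc]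
    exact (hV 0 h0).trans le_self_add
  by_cases h1 : a 1 ≠ 0
  · rw [if_neg h0, if_pos h1, zero_add]
    exact (hV 1 h1).trans le_self_add
  rw [if_neg h0, if_neg h1, add_zero, zero_add]
  have ha : a = 0 := by
    ext j
    fin_cases j
    · simpa using h0
    · simpa using h1
  have hk : k ≠ 0 := fun hk => h ⟨hk, ha⟩
  obtain ⟨i, hi⟩ := Function.ne_iff.1 hk
  fin_cases i
  · exact (hX 0 hi).trans le_self_add
  · exact (hX 1 hi).trans le_add_self

/-- The product `v_i w` need not be square integrable. Its coefficients exist because `v_i` can be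
moved onto the basis function, where it yields a combination of two neighbours. -/
theorem integral_phaseBasis_mul_coord {w : Phase → ℝ} (hw : MemLp w 2 nu) (i : Fin 2)
    (k : Fin 2 → ℤ) (a : Fin 2 → ℕ) :
    Integrable (fun z => conj (phaseBasis (k, a) z) * ((z.2 i * w z : ℝ) : ℂ)) nu ∧
    ∫ z, conj (phaseBasis (k, a) z) * ((z.2 i * w z : ℝ) : ℂ) ∂nu
      = √(a i + 1) * fhCoef w k (a + Pi.single i 1)
        + √(a i) * fhCoef w k (a - Pi.single i 1) := by
  have hint : ∀ b, Integrable (fun z => conj (phaseBasis (k, b) z) * (w z : ℂ)) nu := fun b =>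
    integrable_conj_mul (isCompleteONS_phaseBasis.memLp (k, b)) hw.ofReal
  have hpt : ∀ z, conj (phaseBasis (k, a) z) * ((z.2 i * w z : ℝ) : ℂ)
      = √(a i + 1) * (conj (phaseBasis (k, a + Pi.single i 1) z) * (w z : ℂ))
        + √(a i) * (conj (phaseBasis (k, a - Pi.single i 1) z) * (w z : ℂ)) := by
    intro z
    have h := congrArg (fun r : ℝ => (r : ℂ)) (mul_herm2 i a z.2)
    simp only [phaseBasis, map_mul, Complex.conj_ofReal]
    push_cast at h ⊢
    linear_combination (conj (UnitAddTorus.mFourier k z.1) * (w z : ℂ)) * h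
  simp only [hpt]
  have h1 := (hint (a + Pi.single i 1)).const_mul (√(a i + 1) : ℂ)
  have h2 := (hint (a - Pi.single i 1)).const_mul (√(a i) : ℂ)
  refine ⟨h1.add h2, ?_⟩
  rw [integral_add h1 h2, integral_const_mul, integral_const_mul]
  rfl

/-- The index-raising part of `v_i ∂_{v_i} u` cancels against `∂_{v_i}² u`. What remains is lowering
after raising, with eigenvalue `a i` in each direction. -/
theorem fhCoef_ornsteinUhlenbeck {u : Phase → ℝ} {G : Fin 2 → Phase → ℝ} {H : Fin 2 → Phase → ℝ}
    (hu : MemLp u 2 nu) (hG : ∀ i, IsWeakDeriv (partialV i) u (G i))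
    (hH : ∀ i, IsWeakDeriv (partialV i) (G i) (H i)) (hG2 : ∀ i, MemLp (G i) 2 nu)
    (hH2 : ∀ i, MemLp (H i) 2 nu) (k : Fin 2 → ℤ) (a : Fin 2 → ℕ) :
    fhCoef (fun z => ∑ i, (z.2 i * G i z - H i z)) k a = ((a 0 + a 1 : ℕ) : ℂ) * fhCoef u k a := by
  have hHint : ∀ i, Integrable (fun z => conj (phaseBasis (k, a) z) * (H i z : ℂ)) nu := fun i =>
    integrable_conj_mul (isCompleteONS_phaseBasis.memLp (k, a)) (hH2 i).ofReal
  have hi : ∀ i, ∫ z, (conj (phaseBasis (k, a) z) * ((z.2 i * G i z : ℝ) : ℂ)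
      - conj (phaseBasis (k, a) z) * (H i z : ℂ)) ∂nu = a i * fhCoef u k a := by
    intro i
    obtain ⟨h1, h2⟩ := integral_phaseBasis_mul_coord (hG2 i) i k a
    rw [integral_sub h1 (hHint i), h2]
    have h3 : ∫ z, conj (phaseBasis (k, a) z) * (H i z : ℂ) ∂nu
        = √(a i + 1) * fhCoef (G i) k (a + Pi.single i 1) :=
      fhCoef_partialV (hH i) (hG2 i) (hH2 i) k a
    rw [h3, add_sub_cancel_left]
    by_cases h0 : a i = 0
    · simp [h0]
    · rw [fhCoef_partialV_sub (hG i) hu (hG2 i) k h0, ← mul_assoc, ← Complex.ofReal_mul,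
        Real.mul_self_sqrt (by positivity)]
      simp
  have hsum : ∀ z, conj (phaseBasis (k, a) z) * ((∑ i, (z.2 i * G i z - H i z) : ℝ) : ℂ)
      = ∑ i, (conj (phaseBasis (k, a) z) * ((z.2 i * G i z : ℝ) : ℂ)
      - conj (phaseBasis (k, a) z) * (H i z : ℂ)) := by
    intro z
    push_cast
    rw [Finset.mul_sum]
    simp only [mul_sub]
  unfold fhCoef coef
  simp only [hsum]
  rw [integral_finsetSum]
  swap
  · exact fun i _ => (integral_phaseBasis_mul_coord (hG2 i) i k a).1.sub (hHint i)
  simp only [hi, Fin.sum_univ_two]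
  push_cast
  unfold fhCoef coef
  ring

/-- The coefficient of `∂_{v_i} ∂_{v_j} u` at `a` is that of `u` at `a + e_i + e_j`, times two
square roots whose radicands are at most the degree `a 0 + a 1 + 2`. This degree is the eigenvalue
of `A^*·A` at the raised index, and raising is injective, so the sums compare. -/
theorem hessian_le_nu {u : Phase → ℝ} {G : Fin 2 → Phase → ℝ} {H : Fin 2 → Fin 2 → Phase → ℝ}
    (hu : MemLp u 2 nu) (hG : ∀ i, IsWeakDeriv (partialV i) u (G i))
    (hH : ∀ i j, IsWeakDeriv (partialV i) (G j) (H i j)) (hG2 : ∀ i, MemLp (G i) 2 nu)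
    (hH2 : ∀ i j, MemLp (H i j) 2 nu)
    (hN : MemLp (fun z => ∑ i, (z.2 i * G i z - H i i z)) 2 nu) (i j : Fin 2) :
    eLpNorm (H i j) 2 nu ≤ eLpNorm (fun z => ∑ i, (z.2 i * G i z - H i i z)) 2 nu := by
  have hsq : eLpNorm (H i j) 2 nu ^ 2
      ≤ eLpNorm (fun z => ∑ i, (z.2 i * G i z - H i i z)) 2 nu ^ 2 := by
    rw [← tsum_enorm_fhCoef_sq (hH2 i j), ← tsum_enorm_fhCoef_sq hN]
    refine le_trans (ENNReal.tsum_le_tsum fun p => ?_)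
      (ENNReal.tsum_comp_le_tsum_of_injective
        ((raise_injective j).comp (raise_injective i)) _)
    obtain ⟨k, a⟩ := p
    simp only [Function.comp_apply, raise]
    refine enorm_sq_le_of_norm_le ?_
    rw [fhCoef_ornsteinUhlenbeck hu hG (fun i => hH i i) hG2 (fun i => hH2 i i),
      fhCoef_partialV (hH i j) (hG2 j) (hH2 i j), fhCoef_partialV (hG j) hu (hG2 j),
      norm_mul, norm_mul, norm_mul, ← mul_assoc]
    refine mul_le_mul_of_nonneg_right ?_ (norm_nonneg _)
    simp only [Complex.norm_real, Real.norm_of_nonneg (Real.sqrt_nonneg _), Complex.norm_natCast]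
    have hle : ∀ x y c : ℝ, 0 ≤ c → 0 ≤ x → x ≤ c → y ≤ c → √x * √y ≤ c := by
      intro x y c hc hx0 hx hy
      calc √x * √y ≤ √c * √c := by gcongr
        _ = c := Real.mul_self_sqrt hc
    refine hle _ _ _ (by positivity) (by positivity) ?_ ?_
    · fin_cases i <;> fin_cases j <;> simp <;> linarith
    · fin_cases i <;> fin_cases j <;> simp <;> linarith
  exact (ENNReal.pow_le_pow_left_iff two_ne_zero).1 hsq

/-! ### Fourier coefficients on the torus -/

/-- The Fourier coefficients of a real function on the torus. -/
def tCoef (f : Torus → ℝ) (k : Fin 2 → ℤ) : ℂ :=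
  coef volume (fun k x => UnitAddTorus.mFourier k x) (fun x => (f x : ℂ)) k

theorem continuous_mFourier (k : Fin 2 → ℤ) : Continuous fun x => UnitAddTorus.mFourier k x :=
  (UnitAddTorus.mFourier k).continuous

theorem integrable_mFourier_mul {f : Torus → ℂ} (hf : Integrable f) (k : Fin 2 → ℤ) :
    Integrable fun x => UnitAddTorus.mFourier k x * f x :=
  hf.bdd_mul (c := 1) (continuous_mFourier k).aestronglyMeasurable
    (Eventually.of_forall fun x => (norm_mFourier_apply k x).le)

theorem integrable_conj_mFourier_mul {f : Torus → ℂ} (hf : Integrable f) (k : Fin 2 → ℤ) :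
    Integrable fun x => conj (UnitAddTorus.mFourier k x) * f x :=
  hf.bdd_mul (c := 1)
    (Complex.continuous_conj.comp (continuous_mFourier k)).aestronglyMeasurable
    (Eventually.of_forall fun x => by simp [norm_mFourier_apply])

theorem integrable_mul_mFourier_re {f : Torus → ℝ} (hf : Integrable f) (k : Fin 2 → ℤ) :
    Integrable fun x => f x * (UnitAddTorus.mFourier k x).re := by
  refine (integrable_mFourier_mul hf.ofReal k).re.congr (Eventually.of_forall fun x => ?_)
  simp [mul_comm]

theorem integrable_mul_mFourier_im {f : Torus → ℝ} (hf : Integrable f) (k : Fin 2 → ℤ) :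
    Integrable fun x => f x * (UnitAddTorus.mFourier k x).im := by
  refine (integrable_mFourier_mul hf.ofReal k).im.congr (Eventually.of_forall fun x => ?_)
  simp [mul_comm]

theorem tCoef_eq {f : Torus → ℝ} (hf : Integrable f) (k : Fin 2 → ℤ) :
    tCoef f k = ((∫ x, f x * (UnitAddTorus.mFourier k x).re : ℝ) : ℂ)
      - Complex.I * ((∫ x, f x * (UnitAddTorus.mFourier k x).im : ℝ) : ℂ) := by
  rw [← integral_complex_ofReal, ← integral_complex_ofReal, ← integral_const_mul,
    ← integral_sub (integrable_mul_mFourier_re hf k).ofReal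
      ((integrable_mul_mFourier_im hf k).ofReal.const_mul _)]
  refine integral_congr_ae (Eventually.of_forall fun x => ?_)
  apply Complex.ext <;> simp <;> ring

theorem integral_mFourier_mul (f : Torus → ℝ) (k : Fin 2 → ℤ) :
    ∫ x, UnitAddTorus.mFourier k x * (f x : ℂ) = conj (tCoef f k) := by
  unfold tCoef coef
  rw [← integral_conj]
  simp

theorem tCoef_grad {u : Torus → ℝ} {G : Torus → Vel} (h : IsGradT u G) (i : Fin 2)
    (k : Fin 2 → ℤ) :
    tCoef (fun x => G x i) k = 2 * Real.pi * Complex.I * k i * tCoef u k := by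
  obtain ⟨hu, h⟩ := h
  obtain ⟨hG, h⟩ := h i
  have hA := h _ (isTestT_mFourier_re k)
  have hB := h _ (isTestT_mFourier_im k)
  simp only [partialT_mFourier_re] at hA
  simp only [partialT_mFourier_im] at hB
  have hA' : ∫ x, G x i * (UnitAddTorus.mFourier k x).re
      = 2 * Real.pi * k i * ∫ x, u x * (UnitAddTorus.mFourier k x).im := by
    rw [← integral_const_mul, ← neg_eq_iff_eq_neg.2 hA, ← integral_neg]
    congr 1
    ext z
    ring
  have hB' : ∫ x, G x i * (UnitAddTorus.mFourier k x).im
      = -(2 * Real.pi * k i) * ∫ x, u x * (UnitAddTorus.mFourier k x).re := by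
    rw [← integral_const_mul, ← neg_eq_iff_eq_neg.2 hB, ← integral_neg]
    congr 1
    ext z
    ring
  rw [tCoef_eq hG, tCoef_eq hu, hA', hB']
  push_cast
  ring_nf
  simp only [Complex.I_sq]
  ring

/-- The Poisson-Boltzmann equation on the Fourier side. -/
theorem tCoef_poissonBoltzmann {δ : ℝ} {ρ φ : Torus → ℝ} (hρ : Integrable ρ)
    (h : IsPoissonBoltzmann δ ρ φ) (k : Fin 2 → ℤ) :
    tCoef (fun x => Real.exp (-φ x) - ρ x) k
      = ((δ ^ 2 * (4 * Real.pi ^ 2 * ∑ i, (k i : ℝ) ^ 2) : ℝ) : ℂ) * tCoef φ k := by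
  obtain ⟨-, he, G, hG, -, h⟩ := h
  have hA := h _ (isTestT_mFourier_re k)
  have hB := h _ (isTestT_mFourier_im k)
  simp only [partialT_mFourier_re] at hA
  simp only [partialT_mFourier_im] at hB
  have hi : ∀ i, Integrable fun x => G x i := fun i => (hG.2 i).1
  have hA' : ∫ x, ∑ i, G x i * (-(2 * Real.pi * k i) * (UnitAddTorus.mFourier k x).im)
      = ∑ i, -(2 * Real.pi * k i) * ∫ x, G x i * (UnitAddTorus.mFourier k x).im := by
    rw [integral_finsetSum]
    · refine Finset.sum_congr rfl fun i _ => ?_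
      rw [← integral_const_mul]
      congr 1
      ext x
      ring
    · intro i _
      refine ((integrable_mul_mFourier_im (hi i) k).const_mul (-(2 * Real.pi * k i))).congr
        (Eventually.of_forall fun x => ?_)
      ring
  have hB' : ∫ x, ∑ i, G x i * (2 * Real.pi * k i * (UnitAddTorus.mFourier k x).re)
      = ∑ i, 2 * Real.pi * k i * ∫ x, G x i * (UnitAddTorus.mFourier k x).re := by
    rw [integral_finsetSum]
    · refine Finset.sum_congr rfl fun i _ => ?_
      rw [← integral_const_mul]
      congr 1
      ext x
      ring
    · intro i _
      refine ((integrable_mul_mFourier_re (hi i) k).const_mul (2 * Real.pi * k i)).congr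
        (Eventually.of_forall fun x => ?_)
      ring
  rw [hA'] at hA
  rw [hB'] at hB
  have h0 := tCoef_grad hG 0 k
  have h1 := tCoef_grad hG 1 k
  rw [tCoef_eq (hi 0)] at h0
  rw [tCoef_eq (hi 1)] at h1
  have hr : Integrable fun x => Real.exp (-φ x) - ρ x := he.sub hρ
  rw [tCoef_eq hr, ← hA, ← hB]
  simp only [Fin.sum_univ_two]
  push_cast
  ring_nf at h0 h1 ⊢
  linear_combination (-2 * Complex.I * (δ : ℂ) ^ 2 * Real.pi * k 0) * h0
    + (-2 * Complex.I * (δ : ℂ) ^ 2 * Real.pi * k 1) * h1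
    - (4 * (δ : ℂ) ^ 2 * Real.pi ^ 2 * tCoef φ k * ((k 0 : ℂ) ^ 2 + (k 1 : ℂ) ^ 2)
      + 2 * (δ : ℂ) ^ 2 * Real.pi * k 0 *
        ((∫ x, G x 0 * (UnitAddTorus.mFourier k x).im : ℝ) : ℂ)
      + 2 * (δ : ℂ) ^ 2 * Real.pi * k 1 *
        ((∫ x, G x 1 * (UnitAddTorus.mFourier k x).im : ℝ) : ℂ)) * Complex.I_sq

/-! ### Fejér means -/

/-- The Fejér mean of `f` for the finite set of frequencies `S`. -/
def fejer (S : Finset (Fin 2 → ℤ)) (f : Torus → ℝ) (x : Torus) : ℝ :=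
  (S.card : ℝ)⁻¹ *
    ∑ p ∈ S, ∑ q ∈ S, (tCoef f (p - q) * UnitAddTorus.mFourier (p - q) x).re

theorem continuous_fejer (S : Finset (Fin 2 → ℤ)) (f : Torus → ℝ) : Continuous (fejer S f) := by
  unfold fejer
  refine continuous_const.mul (continuous_finsetSum _ fun p _ => continuous_finsetSum _
    fun q _ => Complex.continuous_re.comp (continuous_const.mul (continuous_mFourier _)))

theorem integral_mul_re_mFourier {g : Torus → ℝ} (hg : Integrable g) (c : ℂ) (k : Fin 2 → ℤ) :
    Integrable (fun x => g x * (c * UnitAddTorus.mFourier k x).re) ∧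
    ∫ x, g x * (c * UnitAddTorus.mFourier k x).re = (c * conj (tCoef g k)).re := by
  have hint : Integrable fun x => c * (UnitAddTorus.mFourier k x * (g x : ℂ)) :=
    (integrable_mFourier_mul hg.ofReal k).const_mul c
  have hpt : ∀ x, g x * (c * UnitAddTorus.mFourier k x).re
      = RCLike.re (c * (UnitAddTorus.mFourier k x * (g x : ℂ))) := by
    intro x
    rw [← mul_assoc, RCLike.re_to_complex, Complex.re_mul_ofReal, mul_comm]
  simp only [hpt]
  refine ⟨hint.re, ?_⟩
  refine (integral_re hint).trans ?_
  rw [integral_const_mul, integral_mFourier_mul]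
  rfl

/-- The Fejér mean is a real Fourier multiplier, so the pairing involves only products of
coefficients. A factor `|p - q|²` coming from the Laplacian of one function can then be regarded as
acting on the other. -/
theorem integral_mul_fejer {f g : Torus → ℝ} (hg : Integrable g) (S : Finset (Fin 2 → ℤ)) :
    ∫ x, g x * fejer S f x = (S.card : ℝ)⁻¹ *
      ∑ p ∈ S, ∑ q ∈ S, (tCoef f (p - q) * conj (tCoef g (p - q))).re := by
  have hpt : ∀ x, g x * fejer S f x = (S.card : ℝ)⁻¹ *
      ∑ p ∈ S, ∑ q ∈ S, g x * (tCoef f (p - q) * UnitAddTorus.mFourier (p - q) x).re := by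
    intro x
    simp only [fejer, ← Finset.mul_sum]
    ring
  simp only [hpt]
  rw [integral_const_mul, integral_finsetSum]
  · congr 1
    refine Finset.sum_congr rfl fun p _ => ?_
    rw [integral_finsetSum]
    · exact Finset.sum_congr rfl fun q _ => (integral_mul_re_mFourier hg _ _).2
    · exact fun q _ => (integral_mul_re_mFourier hg _ _).1
  · exact fun p _ => integrable_finsetSum _ fun q _ => (integral_mul_re_mFourier hg _ _).1

/-- The Fejér kernel. -/
def fejerKernel (S : Finset (Fin 2 → ℤ)) (x y : Torus) : ℝ :=
  (S.card : ℝ)⁻¹ *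
    ∑ p ∈ S, ∑ q ∈ S, (conj (UnitAddTorus.mFourier (p - q) y) * UnitAddTorus.mFourier (p - q) x).re

/-- The kernel is `|S|⁻¹ |∑_{p ∈ S} e_p(x - y)|²`; the double sum over differences `p - q` is
designed for this. -/
theorem fejerKernel_nonneg (S : Finset (Fin 2 → ℤ)) (x y : Torus) : 0 ≤ fejerKernel S x y := by
  refine mul_nonneg (by positivity) ?_
  set z : ℂ := ∑ p ∈ S, conj (UnitAddTorus.mFourier p y) * UnitAddTorus.mFourier p x
  have h : ∑ p ∈ S, ∑ q ∈ S,
      (conj (UnitAddTorus.mFourier (p - q) y) * UnitAddTorus.mFourier (p - q) x).re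
      = (z * conj z).re := by
    simp only [z, map_sum, Finset.sum_mul_sum, Complex.re_sum]
    refine Finset.sum_congr rfl fun p _ => Finset.sum_congr rfl fun q _ => ?_
    rw [sub_eq_add_neg, UnitAddTorus.mFourier_add, UnitAddTorus.mFourier_add,
      UnitAddTorus.mFourier_neg, UnitAddTorus.mFourier_neg]
    simp only [map_mul, Complex.conj_conj]
    congr 1
    ring
  rw [h, Complex.mul_conj, Complex.ofReal_re]
  exact Complex.normSq_nonneg z

theorem continuous_fejerKernel (S : Finset (Fin 2 → ℤ)) (x : Torus) :
    Continuous (fejerKernel S x) := by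
  unfold fejerKernel
  refine continuous_const.mul (continuous_finsetSum _ fun p _ => continuous_finsetSum _
    fun q _ => Complex.continuous_re.comp
      ((Complex.continuous_conj.comp (continuous_mFourier _)).mul continuous_const))

theorem fejer_eq_integral {f : Torus → ℝ} (hf : Integrable f) (S : Finset (Fin 2 → ℤ))
    (x : Torus) : fejer S f x = ∫ y, fejerKernel S x y * f y := by
  have hint : ∀ k : Fin 2 → ℤ, Integrable fun y =>
      (conj (UnitAddTorus.mFourier k y) * (f y : ℂ)) * UnitAddTorus.mFourier k x := fun k =>
    (integrable_conj_mFourier_mul hf.ofReal k).mul_const _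
  have hre : ∀ (k : Fin 2 → ℤ) y,
      (conj (UnitAddTorus.mFourier k y) * UnitAddTorus.mFourier k x).re * f y
      = RCLike.re ((conj (UnitAddTorus.mFourier k y) * (f y : ℂ)) * UnitAddTorus.mFourier k x) := by
    intro k y
    rw [mul_right_comm, RCLike.re_to_complex, Complex.re_mul_ofReal]
  have hpt : ∀ y, fejerKernel S x y * f y = (S.card : ℝ)⁻¹ * ∑ p ∈ S, ∑ q ∈ S,
      RCLike.re ((conj (UnitAddTorus.mFourier (p - q) y) * (f y : ℂ))
        * UnitAddTorus.mFourier (p - q) x) := by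
    intro y
    simp only [fejerKernel, ← hre, ← Finset.sum_mul]
    ring
  simp only [hpt]
  rw [integral_const_mul, integral_finsetSum, fejer]
  · congr 1
    refine Finset.sum_congr rfl fun p _ => ?_
    rw [integral_finsetSum]
    · refine Finset.sum_congr rfl fun q _ => ?_
      rw [integral_re (hint _), integral_mul_const]
      rfl
    · exact fun q _ => (hint _).re
  · exact fun p _ => integrable_finsetSum _ fun q _ => (hint _).re

theorem tCoef_one (k : Fin 2 → ℤ) : tCoef (fun _ => 1) k = if k = 0 then 1 else 0 := by
  have h : (fun _ : Torus => ((1 : ℝ) : ℂ)) = fun x => UnitAddTorus.mFourier 0 x := by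
    ext x
    simp [UnitAddTorus.mFourier_zero]
  unfold tCoef
  rw [h]
  split_ifs with hk
  · rw [hk]; exact isCompleteONS_mFourier.coef_self 0
  · exact isCompleteONS_mFourier.coef_ne k 0 hk

theorem integral_fejerKernel {S : Finset (Fin 2 → ℤ)} (hS : S.Nonempty) (x : Torus) :
    ∫ y, fejerKernel S x y = 1 := by
  have h := fejer_eq_integral (integrable_const (1 : ℝ)) S x
  simp only [mul_one] at h
  rw [← h, fejer]
  simp only [tCoef_one, sub_eq_zero]
  have hcard : (S.card : ℝ) ≠ 0 := by exact_mod_cast hS.card_pos.ne'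
  have : ∀ p ∈ S, ∑ q ∈ S, ((if p = q then (1 : ℂ) else 0) * UnitAddTorus.mFourier (p - q) x).re
      = 1 := by
    intro p hp
    rw [Finset.sum_eq_single p]
    · simp [UnitAddTorus.mFourier_zero]
    · intro q _ hq
      simp [hq.symm]
    · exact fun h => absurd hp h
  rw [Finset.sum_congr rfl this]
  simp [hcard]

/-- The Fejér mean averages `f` against a probability density. This uniform bound, which plain
partial sums lack, provides the domination in `integral_mul_expTrunc_nonpos`. -/
theorem abs_fejer_le {f : Torus → ℝ} (hf : Integrable f) {N : ℝ} (hN : ∀ x, |f x| ≤ N)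
    {S : Finset (Fin 2 → ℤ)} (hS : S.Nonempty) (x : Torus) : |fejer S f x| ≤ N := by
  have hK : Integrable (fejerKernel S x) :=
    (continuous_fejerKernel S x).integrable_of_hasCompactSupport
      (HasCompactSupport.of_compactSpace _)
  rw [fejer_eq_integral hf, ← Real.norm_eq_abs]
  have h : ∫ y, fejerKernel S x y * N = N := by
    rw [integral_mul_const, integral_fejerKernel hS, one_mul]
  rw [← h]
  refine norm_integral_le_of_norm_le (hK.mul_const N) (Eventually.of_forall fun y => ?_)
  rw [norm_mul, Real.norm_of_nonneg (fejerKernel_nonneg S x y)]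
  exact mul_le_mul_of_nonneg_left (hN y) (fejerKernel_nonneg S x y)

/-! ### Antitone functions decrease the Dirichlet energy -/

theorem fejer_add_add_sub (S : Finset (Fin 2 → ℤ)) (f : Torus → ℝ) (i : Fin 2) (s : ℝ)
    (x : Torus) :
    2 * fejer S f x - fejer S f (x + Pi.single i (s : UnitAddCircle))
        - fejer S f (x - Pi.single i (s : UnitAddCircle))
      = (S.card : ℝ)⁻¹ * ∑ p ∈ S, ∑ q ∈ S, (2 - 2 * Real.cos (2 * Real.pi * (p i - q i) * s)) *
        (tCoef f (p - q) * UnitAddTorus.mFourier (p - q) x).re := by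
  have hneg : x - Pi.single i (s : UnitAddCircle) = x + Pi.single i ((-s : ℝ) : UnitAddCircle) := by
    rw [sub_eq_add_neg, ← Pi.single_neg]
    norm_cast
  rw [hneg]
  simp only [fejer, mFourier_add_single]
  rw [mul_left_comm, ← mul_sub, ← mul_sub]
  congr 1
  rw [Finset.mul_sum, ← Finset.sum_sub_distrib, ← Finset.sum_sub_distrib]
  refine Finset.sum_congr rfl fun p _ => ?_
  rw [Finset.mul_sum, ← Finset.sum_sub_distrib, ← Finset.sum_sub_distrib]
  refine Finset.sum_congr rfl fun q _ => ?_
  set θ : ℝ := 2 * Real.pi * (p i - q i) * s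
  set c : ℂ := tCoef f (p - q) * UnitAddTorus.mFourier (p - q) x with hc
  have h1 : (2 * Real.pi * Complex.I * ((p - q) i : ℤ) * (s : ℝ) : ℂ) = θ * Complex.I := by
    simp only [θ, Pi.sub_apply]
    push_cast
    ring
  have h2 : (2 * Real.pi * Complex.I * ((p - q) i : ℤ) * ((-s : ℝ) : ℝ) : ℂ)
      = ((-θ : ℝ) : ℂ) * Complex.I := by
    simp only [θ, Pi.sub_apply]
    push_cast
    ring
  rw [h1, h2, ← mul_assoc, ← mul_assoc]
  simp only [← hc]
  rw [Complex.mul_re c, Complex.mul_re c,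
    Complex.exp_ofReal_mul_I_re, Complex.exp_ofReal_mul_I_im, Complex.exp_ofReal_mul_I_re,
    Complex.exp_ofReal_mul_I_im, Real.cos_neg, Real.sin_neg]
  ring

/-- A discrete form of `∫ ∇u · ∇Ψ(u) ≤ 0` for decreasing `Ψ`, without a chain rule. Translation
invariance turns `∫ Ψ(u) (2u - u(·+y) - u(·-y))` into the integral of `(Ψ(u(x+y)) - Ψ(u(x))) (u(x+y)
- u(x))`, which is pointwise nonpositive. On the Fourier side the second difference is the
multiplier `2 - 2 cos`. -/
theorem sum_cos_nonpos {f : Torus → ℝ} {Ψ : ℝ → ℝ} (hΨ : Antitone Ψ) (hΨc : Continuous Ψ)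
    (S : Finset (Fin 2 → ℤ)) (i : Fin 2) (s : ℝ) :
    ∑ p ∈ S, ∑ q ∈ S, (2 - 2 * Real.cos (2 * Real.pi * (p i - q i) * s)) *
      (tCoef f (p - q) * conj (tCoef (fun x => Ψ (fejer S f x)) (p - q))).re ≤ 0 := by
  rcases S.eq_empty_or_nonempty with rfl | hS
  · simp
  set u := fejer S f
  have hu : Continuous u := continuous_fejer S f
  have hw : Continuous fun x => Ψ (u x) := hΨc.comp hu
  set y : Torus := Pi.single i (s : UnitAddCircle)
  have hcint : ∀ g : Torus → ℝ, Continuous g → Integrable g := fun g hg =>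
    hg.integrable_of_hasCompactSupport (HasCompactSupport.of_compactSpace _)
  have h1 : ∫ x, Ψ (u x) * (2 * u x - u (x + y) - u (x - y)) = (S.card : ℝ)⁻¹ *
      ∑ p ∈ S, ∑ q ∈ S, (2 - 2 * Real.cos (2 * Real.pi * (p i - q i) * s)) *
      (tCoef f (p - q) * conj (tCoef (fun x => Ψ (u x)) (p - q))).re := by
    have hI := fun c k => (integral_mul_re_mFourier (hcint _ hw) c k)
    have hpt : ∀ x, Ψ (u x) * (2 * u x - u (x + y) - u (x - y)) = (S.card : ℝ)⁻¹ *
        ∑ p ∈ S, ∑ q ∈ S, (2 - 2 * Real.cos (2 * Real.pi * (p i - q i) * s)) *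
          (Ψ (u x) * (tCoef f (p - q) * UnitAddTorus.mFourier (p - q) x).re) := by
      intro x
      rw [fejer_add_add_sub, mul_left_comm, Finset.mul_sum]
      simp only [Finset.mul_sum, mul_left_comm]
    simp only [hpt]
    rw [integral_const_mul, integral_finsetSum]
    · congr 1
      refine Finset.sum_congr rfl fun p _ => ?_
      rw [integral_finsetSum]
      · refine Finset.sum_congr rfl fun q _ => ?_
        rw [integral_const_mul, (hI _ _).2]
      · exact fun q _ => (hI _ _).1.const_mul _
    · exact fun p _ => integrable_finsetSum _ fun q _ => (hI _ _).1.const_mul _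
  have h2 : ∫ x, Ψ (u x) * (2 * u x - u (x + y) - u (x - y))
      = ∫ x, (Ψ (u (x + y)) - Ψ (u x)) * (u (x + y) - u x) := by
    have e1 : ∫ x, Ψ (u x) * (u x - u (x - y)) = ∫ x, Ψ (u (x + y)) * (u (x + y) - u x) := by
      rw [← integral_add_right_eq_self _ y]
      simp only [add_sub_cancel_right]
    have e2 : ∀ x, Ψ (u x) * (2 * u x - u (x + y) - u (x - y))
        = Ψ (u x) * (u x - u (x + y)) + Ψ (u x) * (u x - u (x - y)) := fun x => by ring
    simp only [e2]
    rw [integral_add (hcint _ (by fun_prop)) (hcint _ (by fun_prop)), e1,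
      ← integral_add (hcint _ (by fun_prop)) (hcint _ (by fun_prop))]
    congr 1
    ext x
    ring
  have h3 : ∫ x, (Ψ (u (x + y)) - Ψ (u x)) * (u (x + y) - u x) ≤ 0 := by
    refine integral_nonpos fun x => ?_
    rcases le_total (u (x + y)) (u x) with h | h
    · exact mul_nonpos_of_nonneg_of_nonpos (sub_nonneg.2 (hΨ h)) (sub_nonpos.2 h)
    · exact mul_nonpos_of_nonpos_of_nonneg (sub_nonpos.2 (hΨ h)) (sub_nonneg.2 h)
  rw [← h2, h1] at h3
  have hcard : (0 : ℝ) < (S.card : ℝ)⁻¹ := inv_pos.2 (by exact_mod_cast hS.card_pos)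
  exact nonpos_of_mul_nonpos_right h3 hcard

theorem tendsto_two_sub_two_cos_div (a : ℝ) :
    Tendsto (fun s : ℝ => (2 - 2 * Real.cos (a * s)) / s ^ 2) (𝓝[≠] 0) (𝓝 (a ^ 2)) := by
  have h : HasDerivAt (fun s : ℝ => 2 * Real.sin (a * s / 2)) a 0 := by
    have h1 : HasDerivAt (fun s : ℝ => a * s / 2) (a / 2) 0 := by
      simpa using ((hasDerivAt_id (0 : ℝ)).const_mul a).div_const 2
    convert! h1.sin.const_mul 2 using 1
    simp
    ring
  have h2 := (hasDerivAt_iff_tendsto_slope_zero.1 h).pow 2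
  refine h2.congr fun s => ?_
  simp only [zero_add, mul_zero, zero_div, Real.sin_zero, sub_zero, smul_eq_mul]
  have h3 : Real.cos (a * s) = 1 - 2 * Real.sin (a * s / 2) ^ 2 := by
    have := Real.cos_two_mul (a * s / 2)
    rw [show 2 * (a * s / 2) = a * s by ring] at this
    rw [this, Real.cos_sq']
    ring
  rw [h3]
  ring

/-- Dividing the difference inequality by `s²` and letting `s → 0` replaces the cosine multiplier by
that of `-∂_i²`; the sums are finite. -/
theorem sum_sq_nonpos {f : Torus → ℝ} {Ψ : ℝ → ℝ} (hΨ : Antitone Ψ) (hΨc : Continuous Ψ)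
    (S : Finset (Fin 2 → ℤ)) (i : Fin 2) :
    ∑ p ∈ S, ∑ q ∈ S, (2 * Real.pi * (p i - q i)) ^ 2 *
      (tCoef f (p - q) * conj (tCoef (fun x => Ψ (fejer S f x)) (p - q))).re ≤ 0 := by
  have hlim : Tendsto (fun s : ℝ => ∑ p ∈ S, ∑ q ∈ S,
      (2 - 2 * Real.cos (2 * Real.pi * (p i - q i) * s)) / s ^ 2 *
      (tCoef f (p - q) * conj (tCoef (fun x => Ψ (fejer S f x)) (p - q))).re) (𝓝[≠] 0)
      (𝓝 (∑ p ∈ S, ∑ q ∈ S, (2 * Real.pi * (p i - q i)) ^ 2 *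
      (tCoef f (p - q) * conj (tCoef (fun x => Ψ (fejer S f x)) (p - q))).re)) :=
    tendsto_finsetSum _ fun p _ => tendsto_finsetSum _ fun q _ =>
      (tendsto_two_sub_two_cos_div _).mul_const _
  refine le_of_tendsto hlim (Eventually.of_forall fun s => ?_)
  have h := sum_cos_nonpos (f := f) hΨ hΨc S i s
  have h2 := div_nonpos_of_nonpos_of_nonneg h (sq_nonneg s)
  rw [Finset.sum_div] at h2
  simp only [Finset.sum_div, mul_div_right_comm] at h2
  exact h2

/-- The equation tested with `Ψ(φ)`, regularised twice. The inner mean makes `Ψ` act on a continuous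
function, and the outer mean makes the test function a trigonometric polynomial. By the Fourier form
of the equation the integral is a nonnegative multiple of the sum over `i` in `sum_sq_nonpos`. -/
theorem integral_mul_fejer_nonpos {δ : ℝ} {ρ φ : Torus → ℝ} (hρ : Integrable ρ)
    (h : IsPoissonBoltzmann δ ρ φ) {Ψ : ℝ → ℝ} (hΨ : Antitone Ψ) (hΨc : Continuous Ψ)
    (S : Finset (Fin 2 → ℤ)) :
    ∫ x, (Real.exp (-φ x) - ρ x) * fejer S (fun x => Ψ (fejer S φ x)) x ≤ 0 := by
  have hr : Integrable fun x => Real.exp (-φ x) - ρ x := h.2.1.sub hρ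
  rw [integral_mul_fejer hr]
  refine mul_nonpos_of_nonneg_of_nonpos (by positivity) ?_
  have h0 := sum_sq_nonpos (f := φ) hΨ hΨc S 0
  have h1 := sum_sq_nonpos (f := φ) hΨ hΨc S 1
  have h2 := mul_nonpos_of_nonneg_of_nonpos (sq_nonneg δ) (add_nonpos h0 h1)
  refine le_of_eq_of_le ?_ h2
  rw [← Finset.sum_add_distrib, Finset.mul_sum]
  refine Finset.sum_congr rfl fun p _ => ?_
  rw [← Finset.sum_add_distrib, Finset.mul_sum]
  refine Finset.sum_congr rfl fun q _ => ?_
  rw [tCoef_poissonBoltzmann hρ h]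
  simp only [map_mul, Complex.conj_ofReal, Fin.sum_univ_two, Pi.sub_apply]
  rw [mul_left_comm, Complex.re_ofReal_mul, ← Complex.conj_re (tCoef φ (p - q) * _)]
  simp only [map_mul, Complex.conj_conj]
  push_cast
  rw [mul_comm (tCoef (fun x => Ψ (fejer S φ x)) (p - q))]
  ring

/-! ### Convergence of Fejér means in `L²` -/

/-- The multiplier of the Fejér mean with frequencies `S`. -/
def fejerMult (S : Finset (Fin 2 → ℤ)) (k : Fin 2 → ℤ) : ℝ :=
  (S.card : ℝ)⁻¹ * (S.filter fun q => q + k ∈ S).card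

theorem fejerMult_nonneg (S : Finset (Fin 2 → ℤ)) (k : Fin 2 → ℤ) : 0 ≤ fejerMult S k := by
  unfold fejerMult
  positivity

theorem fejerMult_le_one (S : Finset (Fin 2 → ℤ)) (k : Fin 2 → ℤ) : fejerMult S k ≤ 1 := by
  unfold fejerMult
  rw [inv_mul_eq_div]
  refine div_le_one_of_le₀ ?_ (by positivity)
  exact_mod_cast Finset.card_filter_le _ _

/-- The complex trigonometric polynomial whose real part is the Fejér mean. -/
def fejerC (S : Finset (Fin 2 → ℤ)) (f : Torus → ℝ) (x : Torus) : ℂ :=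
  ((S.card : ℝ)⁻¹ : ℝ) * ∑ p ∈ S, ∑ q ∈ S, tCoef f (p - q) * UnitAddTorus.mFourier (p - q) x

theorem fejerC_re (S : Finset (Fin 2 → ℤ)) (f : Torus → ℝ) (x : Torus) :
    (fejerC S f x).re = fejer S f x := by
  rw [fejerC, fejer, Complex.re_ofReal_mul, Complex.re_sum]
  simp only [Complex.re_sum]

theorem continuous_fejerC (S : Finset (Fin 2 → ℤ)) (f : Torus → ℝ) : Continuous (fejerC S f) := by
  unfold fejerC
  refine continuous_const.mul (continuous_finsetSum _ fun p _ => continuous_finsetSum _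
    fun q _ => continuous_const.mul (continuous_mFourier _))

theorem memLp_of_continuous_torus {E : Type*} [NormedAddCommGroup E] {f : Torus → E}
    (hf : Continuous f) (p : ℝ≥0∞) : MemLp f p (volume : Measure Torus) := by
  obtain ⟨C, hC⟩ := hf.bounded_above_of_compact_support (HasCompactSupport.of_compactSpace _)
  exact MemLp.of_bound (hf.integrable_of_hasCompactSupport
    (HasCompactSupport.of_compactSpace _)).1 C (Eventually.of_forall hC)

theorem coef_fejerC (S : Finset (Fin 2 → ℤ)) (f : Torus → ℝ) (k : Fin 2 → ℤ) :
    coef volume (fun k x => UnitAddTorus.mFourier k x) (fejerC S f) k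
      = fejerMult S k * tCoef f k := by
  classical
  have hint : ∀ j, Integrable fun x =>
      conj (UnitAddTorus.mFourier k x) * UnitAddTorus.mFourier j x := fun j =>
    integrable_conj_mul (isCompleteONS_mFourier.memLp k) (isCompleteONS_mFourier.memLp j)
  have hval : ∀ j, ∫ x, conj (UnitAddTorus.mFourier k x) * UnitAddTorus.mFourier j x
      = if j = k then 1 else 0 := by
    intro j
    split_ifs with h
    · rw [h]; exact isCompleteONS_mFourier.coef_self k
    · exact isCompleteONS_mFourier.coef_ne k j (Ne.symm h)
  have hpt : ∀ x, conj (UnitAddTorus.mFourier k x) * fejerC S f x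
      = ((S.card : ℝ)⁻¹ : ℝ) * ∑ q ∈ S, ∑ p ∈ S, tCoef f (p - q) *
        (conj (UnitAddTorus.mFourier k x) * UnitAddTorus.mFourier (p - q) x) := by
    intro x
    rw [fejerC, Finset.sum_comm]
    simp only [Finset.mul_sum]
    refine Finset.sum_congr rfl fun q _ => Finset.sum_congr rfl fun p _ => ?_
    ring
  unfold coef
  simp only [hpt]
  rw [integral_const_mul, integral_finsetSum _ fun q _ =>
    integrable_finsetSum _ fun p _ => (hint _).const_mul _]
  have hq : ∀ q ∈ S, ∫ x, ∑ p ∈ S, tCoef f (p - q) *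
      (conj (UnitAddTorus.mFourier k x) * UnitAddTorus.mFourier (p - q) x)
      = if q + k ∈ S then tCoef f k else 0 := by
    intro q _
    rw [integral_finsetSum _ fun p _ => (hint _).const_mul _]
    simp only [integral_const_mul, hval, sub_eq_iff_eq_add, add_comm k q, mul_ite, mul_one,
      mul_zero, Finset.sum_ite_eq']
    simp
  rw [Finset.sum_congr rfl hq, ← Finset.sum_filter, Finset.sum_const, fejerMult]
  push_cast
  rw [nsmul_eq_mul]
  ring

/-- By Parseval, since the Fejér multiplier takes values in `[0, 1]`. -/
theorem eLpNorm_fejer_le {f : Torus → ℝ} (hf : MemLp f 2) (S : Finset (Fin 2 → ℤ)) :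
    eLpNorm (fejer S f) 2 volume ≤ eLpNorm f 2 volume := by
  have h1 : eLpNorm (fejer S f) 2 volume ≤ eLpNorm (fejerC S f) 2 volume := by
    refine eLpNorm_mono fun x => ?_
    rw [← fejerC_re, Real.norm_eq_abs]
    exact Complex.abs_re_le_norm _
  have h2 : eLpNorm (fun x => (f x : ℂ)) 2 volume = eLpNorm f 2 volume :=
    eLpNorm_congr_norm_ae (Eventually.of_forall fun x => Complex.norm_real _)
  refine h1.trans ?_
  rw [← h2, ← ENNReal.pow_le_pow_left_iff two_ne_zero,
    ← isCompleteONS_mFourier.tsum_enorm_sq (memLp_of_continuous_torus (continuous_fejerC S f) 2),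
    ← isCompleteONS_mFourier.tsum_enorm_sq (f := fun x => (f x : ℂ)) hf.ofReal]
  refine ENNReal.tsum_le_tsum fun k => enorm_sq_le_of_norm_le ?_
  rw [coef_fejerC, norm_mul, Complex.norm_real, Real.norm_of_nonneg (fejerMult_nonneg _ _)]
  exact mul_le_of_le_one_left (norm_nonneg _) (fejerMult_le_one _ _)

/-- The box of frequencies `[0, n)²`. -/
def freqBox (n : ℕ) : Finset (Fin 2 → ℤ) := Fintype.piFinset fun _ => Finset.Ico (0 : ℤ) n

theorem freqBox_nonempty {n : ℕ} (hn : 0 < n) : (freqBox n).Nonempty :=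
  ⟨0, by simp [freqBox, hn]⟩

/-- For a box of side `n` the multiplier is `∏ (1 - |k i| / n)` as soon as `n ≥ |k i|`. -/
theorem tendsto_fejerMult (k : Fin 2 → ℤ) :
    Tendsto (fun n => fejerMult (freqBox n) k) atTop (𝓝 1) := by
  have hlim : Tendsto (fun n : ℕ => ∏ i, (1 - |(k i : ℝ)| / n)) atTop (𝓝 1) := by
    have h1 : ∀ i, Tendsto (fun n : ℕ => (1 - |(k i : ℝ)| / n)) atTop (𝓝 1) := fun i => by
      simpa using (tendsto_const_div_atTop_nhds_zero_nat |(k i : ℝ)|).const_sub 1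
    simpa using tendsto_finsetProd Finset.univ fun i _ => h1 i
  refine hlim.congr' ?_
  filter_upwards [eventually_gt_atTop 0, eventually_ge_atTop (k 0).natAbs,
    eventually_ge_atTop (k 1).natAbs] with n hn h0 h1
  have hk : ∀ i, (k i).natAbs ≤ n := by
    intro i
    fin_cases i
    · exact h0
    · exact h1
  have hfil : (freqBox n).filter (fun q => q + k ∈ freqBox n)
      = Fintype.piFinset fun i => Finset.Ico (max 0 (-k i)) (min (n : ℤ) (n - k i)) := by
    ext q
    simp only [freqBox, Finset.mem_filter, Fintype.mem_piFinset, Finset.mem_Ico, Pi.add_apply,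
      ← forall_and]
    refine forall_congr' fun i => ?_
    omega
  have hcard : ∀ i, ((Finset.Ico (max 0 (-k i)) (min (n : ℤ) (n - k i))).card : ℝ)
      = n - |(k i : ℝ)| := by
    intro i
    rw [Int.card_Ico]
    have h2 : ((min (n : ℤ) (n - k i) - max 0 (-k i)).toNat : ℤ) = n - |k i| := by
      have := hk i
      rw [Int.abs_eq_natAbs, Int.toNat_of_nonneg] <;> omega
    exact_mod_cast congrArg (fun z : ℤ => (z : ℝ)) h2
  have hn0 : (n : ℝ) ≠ 0 := by exact_mod_cast hn.ne'
  rw [fejerMult, hfil, Fintype.card_piFinset, freqBox, Fintype.card_piFinset]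
  push_cast
  simp only [hcard]
  simp only [Int.card_Ico, sub_zero, Int.toNat_natCast]
  rw [← Finset.prod_inv_distrib, ← Finset.prod_mul_distrib]
  refine Finset.prod_congr rfl fun i _ => ?_
  field_simp

theorem tendsto_eLpNorm_fejer_sub {f : Torus → ℝ} (hf : MemLp f 2) :
    Tendsto (fun n => eLpNorm (fun x => fejer (freqBox n) f x - f x) 2 volume) atTop (𝓝 0) := by
  have hC : ∀ S, MemLp (fun x => fejerC S f x - (f x : ℂ)) 2 volume := fun S =>
    (memLp_of_continuous_torus (continuous_fejerC S f) 2).sub hf.ofReal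
  have hcoef : ∀ S k, coef volume (fun k x => UnitAddTorus.mFourier k x)
      (fun x => fejerC S f x - (f x : ℂ)) k = ((fejerMult S k - 1 : ℝ) : ℂ) * tCoef f k := by
    intro S k
    have h1 : coef volume (fun k x => UnitAddTorus.mFourier k x)
        (fun x => fejerC S f x - (f x : ℂ)) k
        = coef volume (fun k x => UnitAddTorus.mFourier k x) (fejerC S f) k - tCoef f k := by
      unfold tCoef coef
      rw [← integral_sub]
      · refine integral_congr_ae (Eventually.of_forall fun x => ?_)
        simp only [mul_sub]
      · exact integrable_conj_mul (isCompleteONS_mFourier.memLp k)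
          (memLp_of_continuous_torus (continuous_fejerC S f) 2)
      · exact integrable_conj_mul (isCompleteONS_mFourier.memLp k) hf.ofReal
    rw [h1, coef_fejerC]
    push_cast
    ring
  have hsq : Tendsto (fun n => ∑' k, ‖((fejerMult (freqBox n) k - 1 : ℝ) : ℂ) * tCoef f k‖ ^ 2)
      atTop (𝓝 0) := by
    have hs : Summable fun k => ‖tCoef f k‖ ^ 2 :=
      (isCompleteONS_mFourier.hasSum_sq (f := fun x => (f x : ℂ)) hf.ofReal).summable
    rw [← tsum_zero (α := ℝ) (β := Fin 2 → ℤ)]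
    refine tendsto_tsum_of_dominated_convergence hs (fun k => ?_)
      (Eventually.of_forall fun n k => ?_)
    · have h1 := ((tendsto_fejerMult k).sub_const 1).norm.mul_const ‖tCoef f k‖
      have h2 := h1.pow 2
      simpa only [norm_mul, Complex.norm_real, sub_self, norm_zero, zero_mul, ne_eq,
        OfNat.ofNat_ne_zero, not_false_eq_true, zero_pow] using h2
    · rw [norm_mul, Complex.norm_real, Real.norm_of_nonneg (by positivity)]
      have h1 := fejerMult_nonneg (freqBox n) k
      have h2 := fejerMult_le_one (freqBox n) k
      have h3 : ‖fejerMult (freqBox n) k - 1‖ ≤ 1 := by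
        rw [Real.norm_eq_abs, abs_le]
        constructor <;> linarith
      gcongr
      exact mul_le_of_le_one_left (norm_nonneg _) h3
  have hE : Tendsto (fun n => eLpNorm (fun x => fejerC (freqBox n) f x - (f x : ℂ)) 2 volume ^ 2)
      atTop (𝓝 0) := by
    have h1 := ENNReal.tendsto_ofReal hsq
    rw [ENNReal.ofReal_zero] at h1
    refine h1.congr fun n => ?_
    have h2 := isCompleteONS_mFourier.hasSum_sq (hC (freqBox n))
    simp only [hcoef] at h2
    rw [← isCompleteONS_mFourier.tsum_enorm_sq (hC (freqBox n)),
      ENNReal.ofReal_tsum_of_nonneg (fun _ => by positivity) h2.summable]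
    refine tsum_congr fun k => ?_
    rw [hcoef, ENNReal.ofReal_pow (norm_nonneg _), ofReal_norm]
  have hE2 := hE.ennrpow_const (1 / 2 : ℝ)
  rw [ENNReal.zero_rpow_of_pos (by norm_num)] at hE2
  refine tendsto_of_tendsto_of_tendsto_of_le_of_le tendsto_const_nhds hE2
    (fun _ => zero_le) fun n => ?_
  rw [← ENNReal.rpow_natCast, ← ENNReal.rpow_mul]
  norm_num
  refine eLpNorm_mono fun x => ?_
  rw [← fejerC_re, Real.norm_eq_abs]
  have := Complex.abs_re_le_norm (fejerC (freqBox n) f x - (f x : ℂ))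
  simpa using this

/-! ### The `L²` bound for `e^{-φ}` -/

/-- The truncation `e^{-max(s,-M)}` of `e^{-s}`. -/
def expTrunc (M : ℕ) (s : ℝ) : ℝ := Real.exp (-max s (-M))

theorem expTrunc_antitone (M : ℕ) : Antitone (expTrunc M) := fun a b h => by
  unfold expTrunc
  gcongr

theorem continuous_expTrunc (M : ℕ) : Continuous (expTrunc M) := by
  unfold expTrunc
  fun_prop

theorem expTrunc_pos (M : ℕ) (s : ℝ) : 0 < expTrunc M s := Real.exp_pos _

theorem expTrunc_le (M : ℕ) (s : ℝ) : expTrunc M s ≤ Real.exp M := by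
  unfold expTrunc
  refine Real.exp_le_exp.2 ?_
  linarith [le_max_right s (-M : ℝ)]

theorem expTrunc_le_exp (M : ℕ) (s : ℝ) : expTrunc M s ≤ Real.exp (-s) := by
  unfold expTrunc
  refine Real.exp_le_exp.2 ?_
  linarith [le_max_left s (-M : ℝ)]

theorem expTrunc_lipschitz (M : ℕ) (a b : ℝ) :
    |expTrunc M a - expTrunc M b| ≤ Real.exp M * |a - b| := by
  wlog h : a ≤ b generalizing a b
  · rw [abs_sub_comm, abs_sub_comm a b]
    exact this b a (le_of_not_ge h)
  rw [abs_of_nonneg (sub_nonneg.2 (expTrunc_antitone M h)), abs_sub_comm,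
    abs_of_nonneg (sub_nonneg.2 h)]
  unfold expTrunc
  set x := max a (-M : ℝ)
  set y := max b (-M : ℝ)
  have hxy : y - x ≤ b - a := by
    have := (abs_max_sub_max_le_abs b a (-M : ℝ))
    rw [abs_of_nonneg (sub_nonneg.2 h)] at this
    exact (le_abs_self _).trans this
  have h1 : Real.exp (-x) - Real.exp (-y) ≤ Real.exp (-x) * (y - x) := by
    have h2 : Real.exp (-y) = Real.exp (-x) * Real.exp (-(y - x)) := by
      rw [← Real.exp_add]; ring_nf
    have h3 := Real.add_one_le_exp (-(y - x))
    have h4 := mul_le_mul_of_nonneg_left h3 (Real.exp_pos (-x)).le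
    rw [h2]
    linarith
  refine h1.trans (mul_le_mul (expTrunc_le M a) hxy ?_ (Real.exp_pos _).le)
  exact sub_nonneg.2 (max_le_max_right _ h)

theorem tCoef_sub {f g : Torus → ℝ} (hf : Integrable f) (hg : Integrable g) (k : Fin 2 → ℤ) :
    tCoef (fun x => f x - g x) k = tCoef f k - tCoef g k := by
  unfold tCoef coef
  have hf' : Integrable fun x => conj (UnitAddTorus.mFourier k x) * (f x : ℂ) :=
    integrable_conj_mFourier_mul hf.ofReal k
  have hg' : Integrable fun x => conj (UnitAddTorus.mFourier k x) * (g x : ℂ) :=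
    integrable_conj_mFourier_mul hg.ofReal k
  refine Eq.trans ?_ (integral_sub hf' hg')
  refine integral_congr_ae (Eventually.of_forall fun x => ?_)
  push_cast
  ring

theorem fejer_sub {f g : Torus → ℝ} (hf : Integrable f) (hg : Integrable g)
    (S : Finset (Fin 2 → ℤ)) (x : Torus) :
    fejer S (fun x => f x - g x) x = fejer S f x - fejer S g x := by
  simp only [fejer, tCoef_sub hf hg, sub_mul, Complex.sub_re, Finset.sum_sub_distrib, mul_sub]

/-- Removes both regularisations. At this stage `e^{-φ} - ρ` is only known to be integrable, so `L²`
convergence of the test functions is not enough. A subsequence converges almost everywhere, and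
positivity of the Fejér kernel keeps the test functions below `e^M`. -/
theorem integral_mul_expTrunc_nonpos {δ : ℝ} {ρ φ : Torus → ℝ} (hρ : Integrable ρ)
    (h : IsPoissonBoltzmann δ ρ φ) (M : ℕ) :
    ∫ x, (Real.exp (-φ x) - ρ x) * expTrunc M (φ x) ≤ 0 := by
  have hφ : MemLp φ 2 := h.1
  have hr : Integrable fun x => Real.exp (-φ x) - ρ x := h.2.1.sub hρ
  have hbd : ∀ f : Torus → ℝ, AEStronglyMeasurable f volume →
      MemLp (fun x => expTrunc M (f x)) 2 volume := fun f hf =>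
    MemLp.of_bound ((continuous_expTrunc M).comp_aestronglyMeasurable hf) (Real.exp M)
      (Eventually.of_forall fun x => by
        rw [Real.norm_of_nonneg (expTrunc_pos _ _).le]; exact expTrunc_le _ _)
  have hΨ := hbd φ hφ.1
  have hΨn : ∀ n, MemLp (fun x => expTrunc M (fejer (freqBox n) φ x)) 2 volume := fun n =>
    hbd _ (memLp_of_continuous_torus (continuous_fejer _ _) 2).1
  have hconv : Tendsto (fun n => eLpNorm (fun x => fejer (freqBox n)
      (fun x => expTrunc M (fejer (freqBox n) φ x)) x - expTrunc M (φ x)) 2 volume)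
      atTop (𝓝 0) := by
    have hup : Tendsto (fun n => ENNReal.ofReal (Real.exp M) *
        eLpNorm (fun x => fejer (freqBox n) φ x - φ x) 2 volume
        + eLpNorm (fun x => fejer (freqBox n) (fun x => expTrunc M (φ x)) x - expTrunc M (φ x))
          2 volume) atTop (𝓝 0) := by
      have h1 := ENNReal.Tendsto.const_mul (a := ENNReal.ofReal (Real.exp M))
        (tendsto_eLpNorm_fejer_sub hφ) (Or.inr ENNReal.ofReal_ne_top)
      simpa using h1.add (tendsto_eLpNorm_fejer_sub hΨ)
    refine tendsto_of_tendsto_of_tendsto_of_le_of_le tendsto_const_nhds hup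
      (fun _ => zero_le) fun n => ?_
    set S := freqBox n
    have hd : MemLp (fun x => expTrunc M (fejer S φ x) - expTrunc M (φ x)) 2 volume :=
      (hΨn n).sub hΨ
    -- The first part is small because Fejér means contract `L²` and `expTrunc M` is Lipschitz; the
    -- second is the convergence of Fejér means of a fixed `L²` function.
    have e : (fun x => fejer S (fun x => expTrunc M (fejer S φ x)) x - expTrunc M (φ x))
        = (fejer S fun x => expTrunc M (fejer S φ x) - expTrunc M (φ x))
          + fun x => fejer S (fun x => expTrunc M (φ x)) x - expTrunc M (φ x) := by
      ext x
      simp only [Pi.add_apply]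
      rw [fejer_sub ((hΨn n).integrable (by norm_num)) (hΨ.integrable (by norm_num))]
      ring
    simp only []
    rw [e]
    refine (eLpNorm_add_le (continuous_fejer _ _).aestronglyMeasurable
      ((continuous_fejer _ _).aestronglyMeasurable.sub hΨ.1) (by norm_num)).trans ?_
    refine add_le_add ?_ le_rfl
    refine (eLpNorm_fejer_le hd S).trans ?_
    refine eLpNorm_le_mul_eLpNorm_of_ae_le_mul (Eventually.of_forall fun x => ?_) 2
    simpa only [Real.norm_eq_abs] using expTrunc_lipschitz M (fejer S φ x) (φ x)
  have hmeas := tendstoInMeasure_of_tendsto_eLpNorm (p := 2) (by norm_num)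
    (f := fun n x => fejer (freqBox n) (fun x => expTrunc M (fejer (freqBox n) φ x)) x)
    (fun n => (continuous_fejer _ _).aestronglyMeasurable) hΨ.1 hconv
  obtain ⟨ns, hns, hae⟩ := hmeas.exists_seq_tendsto_ae
  have hlim : Tendsto (fun m => ∫ x, (Real.exp (-φ x) - ρ x) *
      fejer (freqBox (ns m)) (fun x => expTrunc M (fejer (freqBox (ns m)) φ x)) x) atTop
      (𝓝 (∫ x, (Real.exp (-φ x) - ρ x) * expTrunc M (φ x))) := by
    refine tendsto_integral_filter_of_dominated_convergence
      (fun x => ‖Real.exp (-φ x) - ρ x‖ * Real.exp M) (Eventually.of_forall fun m =>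
        hr.1.mul (continuous_fejer _ _).aestronglyMeasurable) ?_ (hr.norm.mul_const _) ?_
    · filter_upwards [hns.tendsto_atTop.eventually_gt_atTop 0] with m hm
      refine Eventually.of_forall fun x => ?_
      rw [norm_mul]
      gcongr
      refine abs_fejer_le ((hΨn _).integrable (by norm_num)) (fun y => ?_) (freqBox_nonempty hm) x
      rw [abs_of_pos (expTrunc_pos _ _)]
      exact expTrunc_le _ _
    · filter_upwards [hae] with x hx
      exact hx.const_mul _
  exact le_of_tendsto hlim (Eventually.of_forall fun m =>
    integral_mul_fejer_nonpos hρ h (expTrunc_antitone M) (continuous_expTrunc M) _)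

/-- With `Ψ = expTrunc M (φ)`, the inequality `Ψ ≤ e^{-φ}` gives `(e^{-φ} - ρ) Ψ ≥ Ψ² - ρΨ ≥ Ψ²/2 -
ρ²/2`, while the integral of the left side is nonpositive. -/
theorem integral_expTrunc_sq_le {δ : ℝ} {ρ φ : Torus → ℝ} (hρ : MemLp ρ 2)
    (h : IsPoissonBoltzmann δ ρ φ) (M : ℕ) :
    ∫ x, expTrunc M (φ x) ^ 2 ≤ ∫ x, ρ x ^ 2 := by
  have h1 := integral_mul_expTrunc_nonpos (hρ.integrable (by norm_num)) h M
  have hm : AEStronglyMeasurable (fun x => expTrunc M (φ x)) volume :=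
    (continuous_expTrunc M).comp_aestronglyMeasurable h.1.1
  have hbd : ∀ x, ‖expTrunc M (φ x)‖ ≤ Real.exp M := fun x => by
    rw [Real.norm_of_nonneg (expTrunc_pos _ _).le]; exact expTrunc_le _ _
  have hΨ : MemLp (fun x => expTrunc M (φ x)) 2 volume :=
    MemLp.of_bound hm _ (Eventually.of_forall hbd)
  have hi1 : Integrable fun x => (Real.exp (-φ x) - ρ x) * expTrunc M (φ x) :=
    (h.2.1.sub (hρ.integrable (by norm_num))).mul_bdd (c := Real.exp M) hm
      (Eventually.of_forall hbd)
  have h2 : ∫ x, (1 / 2 * expTrunc M (φ x) ^ 2 - 1 / 2 * ρ x ^ 2)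
      ≤ ∫ x, (Real.exp (-φ x) - ρ x) * expTrunc M (φ x) := by
    refine integral_mono ((hΨ.integrable_sq.const_mul _).sub (hρ.integrable_sq.const_mul _)) hi1
      fun x => ?_
    have h3 := mul_le_mul_of_nonneg_right (expTrunc_le_exp M (φ x)) (expTrunc_pos M (φ x)).le
    simp only []
    nlinarith [sq_nonneg (ρ x - expTrunc M (φ x))]
  rw [integral_sub (hΨ.integrable_sq.const_mul _) (hρ.integrable_sq.const_mul _),
    integral_const_mul, integral_const_mul] at h2
  linarith

theorem eLpNorm_two_sq {X : Type*} [MeasurableSpace X] {μ : Measure X} {f : X → ℝ}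
    (hf : MemLp f 2 μ) : eLpNorm f 2 μ ^ 2 = ENNReal.ofReal (∫ x, f x ^ 2 ∂μ) := by
  have h0 : 0 ≤ ∫ x, ‖f x‖ ^ 2 ∂μ := integral_nonneg fun x => by positivity
  rw [hf.eLpNorm_eq_integral_rpow_norm (by norm_num) (by norm_num),
    ← ENNReal.ofReal_pow (by positivity)]
  congr 1
  simp only [ENNReal.toReal_ofNat, Real.rpow_two]
  rw [← Real.rpow_natCast, ← Real.rpow_mul h0]
  norm_num

theorem memLp_exp_neg {δ : ℝ} {ρ φ : Torus → ℝ} (hρ : MemLp ρ 2)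
    (h : IsPoissonBoltzmann δ ρ φ) :
    MemLp (fun x => Real.exp (-φ x)) 2 ∧ ∫ x, Real.exp (-φ x) ^ 2 ≤ ∫ x, ρ x ^ 2 := by
  have hm : AEStronglyMeasurable (fun x => Real.exp (-φ x)) volume := h.2.1.1
  -- Fatou's lemma as the truncation level grows; at each point the truncation is eventually
  -- inactive.
  have hle : ∫⁻ x, ENNReal.ofReal (Real.exp (-φ x) ^ 2) ≤ ENNReal.ofReal (∫ x, ρ x ^ 2) := by
    have hlim : ∀ x, liminf (fun M : ℕ => ENNReal.ofReal (expTrunc M (φ x) ^ 2)) atTop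
        = ENNReal.ofReal (Real.exp (-φ x) ^ 2) := by
      intro x
      refine Tendsto.liminf_eq (tendsto_const_nhds.congr' ?_)
      obtain ⟨N, hN⟩ := exists_nat_ge (-φ x)
      filter_upwards [eventually_ge_atTop N] with M hM
      have : (-(M : ℝ)) ≤ φ x := by
        have : (N : ℝ) ≤ M := by exact_mod_cast hM
        linarith
      rw [expTrunc, max_eq_left this]
    simp only [← hlim]
    refine (lintegral_liminf_le' fun M => ?_).trans ?_
    · exact (((continuous_expTrunc M).comp_aestronglyMeasurable h.1.1).aemeasurable.pow_const
        2).ennreal_ofReal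
    · refine liminf_le_of_le (by isBoundedDefault) fun b hb => ?_
      obtain ⟨M, hM⟩ := hb.exists
      refine hM.trans ?_
      rw [← ofReal_integral_eq_lintegral_ofReal]
      · exact ENNReal.ofReal_le_ofReal (integral_expTrunc_sq_le hρ h M)
      · refine (MemLp.of_bound ((continuous_expTrunc M).comp_aestronglyMeasurable h.1.1)
          (Real.exp M) (Eventually.of_forall fun x => ?_) : MemLp _ 2 _).integrable_sq
        rw [Real.norm_of_nonneg (expTrunc_pos _ _).le]
        exact expTrunc_le _ _
      · exact Eventually.of_forall fun x => by positivity
  have hint : Integrable fun x => Real.exp (-φ x) ^ 2 := by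
    refine ⟨hm.pow 2, ?_⟩
    rw [hasFiniteIntegral_iff_ofReal (Eventually.of_forall fun x => by positivity)]
    exact hle.trans_lt ENNReal.ofReal_lt_top
  refine ⟨(memLp_two_iff_integrable_sq hm).2 hint, ?_⟩
  rw [← ofReal_integral_eq_lintegral_ofReal hint
    (Eventually.of_forall fun x => by positivity)] at hle
  exact (ENNReal.ofReal_le_ofReal_iff (integral_nonneg fun x => by positivity)).1 hle

/-! ### Uniform bounds for the potential -/

/-- The absolutely convergent series defines a continuous function with the same Fourier
coefficients as `f`, so completeness identifies the two. -/
theorem ae_eq_tsum_of_summable {f : Torus → ℝ} (hf : MemLp f 2)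
    (hs : Summable fun k => ‖tCoef f k‖) :
    ∀ᵐ x, (f x : ℂ) = ∑' k, tCoef f k * UnitAddTorus.mFourier k x := by
  set g : Torus → ℂ := fun x => ∑' k, tCoef f k * UnitAddTorus.mFourier k x
  have hn : ∀ k x, ‖tCoef f k * UnitAddTorus.mFourier k x‖ ≤ ‖tCoef f k‖ := fun k x => by
    rw [norm_mul, norm_mFourier_apply, mul_one]
  have hg : Continuous g :=
    continuous_tsum (fun k => continuous_const.mul (continuous_mFourier k)) hs hn
  have hgm := memLp_of_continuous_torus hg 2
  have hcoef : ∀ j, coef volume (fun k x => UnitAddTorus.mFourier k x) g j = tCoef f j := by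
    intro j
    have hsum := hasSum_integral_of_summable_integral_norm (μ := (volume : Measure Torus))
      (F := fun k x => conj (UnitAddTorus.mFourier j x) * (tCoef f k * UnitAddTorus.mFourier k x))
      (fun k => integrable_conj_mFourier_mul ((memLp_of_continuous_torus
        (continuous_const.mul (continuous_mFourier k)) 1).integrable le_rfl) j)
      (by
        simp only [norm_mul, RCLike.norm_conj, norm_mFourier_apply, one_mul, mul_one,
          integral_const, smul_eq_mul, probReal_univ]
        exact hs)
    have h1 : ∀ k, ∫ x, conj (UnitAddTorus.mFourier j x) * (tCoef f k * UnitAddTorus.mFourier k x)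
        = if k = j then tCoef f j else 0 := by
      intro k
      have : ∀ x, conj (UnitAddTorus.mFourier j x) * (tCoef f k * UnitAddTorus.mFourier k x)
          = tCoef f k * (conj (UnitAddTorus.mFourier j x) * UnitAddTorus.mFourier k x) := fun x => by
        ring
      simp only [this]
      rw [integral_const_mul]
      have h2 : ∫ x, conj (UnitAddTorus.mFourier j x) * UnitAddTorus.mFourier k x
          = coef volume (fun k x => UnitAddTorus.mFourier k x)
            (fun x => UnitAddTorus.mFourier k x) j := rfl
      rw [h2]
      split_ifs with h
      · rw [h, isCompleteONS_mFourier.coef_self, mul_one]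
      · rw [isCompleteONS_mFourier.coef_ne j k (Ne.symm h), mul_zero]
    simp only [h1, tsum_mul_left] at hsum
    exact hsum.unique (hasSum_ite_eq j _)
  have h0 := isCompleteONS_mFourier.complete (fun x => (f x : ℂ) - g x) (hf.ofReal.sub hgm)
    fun j => by
      have h1 : coef volume (fun k x => UnitAddTorus.mFourier k x)
          (fun x => (f x : ℂ) - g x) j = tCoef f j -
          coef volume (fun k x => UnitAddTorus.mFourier k x) g j := by
        unfold tCoef coef
        rw [← integral_sub]
        · refine integral_congr_ae (Eventually.of_forall fun x => ?_)
          simp only [mul_sub]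
        · exact integrable_conj_mul (isCompleteONS_mFourier.memLp j) hf.ofReal
        · exact integrable_conj_mul (isCompleteONS_mFourier.memLp j) hgm
      rw [h1, hcoef, sub_self]
  filter_upwards [h0] with x hx
  exact sub_eq_zero.1 hx

/-- Uniform bounds for `e^{-φ}`, where `φ` solves the Poisson-Boltzmann equation. -/
theorem exists_exp_neg_bounds {ρ : Torus → ℝ} (hρ : MemLp ρ 2) (hρ1 : ∫ x, ρ x = 1) {δ₀ : ℝ}
    (hδ₀ : 0 < δ₀) :
    ∃ B : ℝ, 0 < B ∧ ∀ δ > δ₀, ∀ φ, IsPoissonBoltzmann δ ρ φ →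
      ∀ᵐ x, B⁻¹ ≤ Real.exp (-φ x) ∧ Real.exp (-φ x) ≤ B := by
  have hZ := EisensteinSeries.summable_one_div_norm_rpow (k := 4) (by norm_num)
  set Z := ∑' k : Fin 2 → ℤ, ‖k‖ ^ (-4 : ℝ)
  set R := ∫ x, ρ x ^ 2
  -- A bound for the sum of `|φ̂(k)|` over `k ≠ 0`; the term `4 * R` bounds `‖e^{-φ} - ρ‖₂²`. It
  -- controls both the oscillation of `φ` and its mean, hence `2 * b` in the witness.
  set b : ℝ := (δ₀ ^ 2)⁻¹ * (1 / 2 * (4 * R + Z))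
  refine ⟨Real.exp (2 * b), Real.exp_pos _, fun δ hδ φ h => ?_⟩
  have hρi := hρ.integrable (by norm_num)
  obtain ⟨he2, heR⟩ := memLp_exp_neg hρ h
  have hr2 : MemLp (fun x => Real.exp (-φ x) - ρ x) 2 := he2.sub hρ
  have hrsum := isCompleteONS_mFourier.hasSum_sq
    (f := fun x => ((Real.exp (-φ x) - ρ x : ℝ) : ℂ)) hr2.ofReal
  change HasSum (fun k => ‖tCoef (fun x => Real.exp (-φ x) - ρ x) k‖ ^ 2) _ at hrsum
  set r : Torus → ℝ := fun x => Real.exp (-φ x) - ρ x with hr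
  have hrR : ∫ x, ‖((Real.exp (-φ x) - ρ x : ℝ) : ℂ)‖ ^ 2 ≤ 4 * R := by
    have h1 : ∫ x, ‖((Real.exp (-φ x) - ρ x : ℝ) : ℂ)‖ ^ 2
        ≤ ∫ x, (2 * Real.exp (-φ x) ^ 2 + 2 * ρ x ^ 2) := by
      refine integral_mono ?_ ((he2.integrable_sq.const_mul _).add
        (hρ.integrable_sq.const_mul _)) fun x => ?_
      · simpa only [Complex.norm_real, Real.norm_eq_abs, sq_abs] using hr2.integrable_sq
      · simp only [Complex.norm_real, Real.norm_eq_abs, sq_abs]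
        nlinarith [sq_nonneg (Real.exp (-φ x) + ρ x)]
    rw [integral_add (he2.integrable_sq.const_mul _) (hρ.integrable_sq.const_mul _),
      integral_const_mul, integral_const_mul] at h1
    linarith
  -- The equation gives `|φ̂(k)| ≤ |r̂(k)| / (δ₀² ‖k‖²)`, and the arithmetic-geometric mean
  -- inequality separates two summable majorants. Summability of `‖k‖^{-4}` reflects that the
  -- frequencies form a two-dimensional lattice.
  have hk : ∀ k : Fin 2 → ℤ, k ≠ 0 → ‖tCoef φ k‖
      ≤ (δ₀ ^ 2)⁻¹ * (1 / 2 * (‖tCoef r k‖ ^ 2 + ‖k‖ ^ (-4 : ℝ))) := by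
    intro k hk0
    have h1 := tCoef_poissonBoltzmann hρi h k
    have hkn : 0 < ‖k‖ := norm_pos_iff.2 hk0
    have hks : ‖k‖ ^ 2 ≤ ∑ i, (k i : ℝ) ^ 2 := by
      rw [← Real.le_sqrt (norm_nonneg _) (by positivity),
        pi_norm_le_iff_of_nonneg (Real.sqrt_nonneg _)]
      intro i
      rw [Int.norm_eq_abs]
      refine Real.le_sqrt_of_sq_le ?_
      rw [sq_abs]
      exact Finset.single_le_sum (f := fun i => (k i : ℝ) ^ 2) (fun i _ => sq_nonneg _)
        (Finset.mem_univ i)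
    have h2 : ‖tCoef r k‖ = δ ^ 2 * (4 * Real.pi ^ 2 * ∑ i, (k i : ℝ) ^ 2) * ‖tCoef φ k‖ := by
      rw [hr, h1, norm_mul, Complex.norm_real, Real.norm_of_nonneg]
      positivity
    have h3 : δ₀ ^ 2 * ‖k‖ ^ 2 * ‖tCoef φ k‖ ≤ ‖tCoef r k‖ := by
      rw [h2]
      gcongr
      have h4 : (1 : ℝ) ≤ 4 * Real.pi ^ 2 := by nlinarith [Real.pi_gt_three]
      calc ‖k‖ ^ 2 ≤ 1 * ∑ i, (k i : ℝ) ^ 2 := by rw [one_mul]; exact hks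
        _ ≤ _ := by gcongr
    have h5 : ‖k‖ ^ (-4 : ℝ) = ((‖k‖ ^ 2)⁻¹) ^ 2 := by
      rw [Real.rpow_neg hkn.le, ← inv_pow, ← pow_mul, inv_pow]
      norm_num
    have h6 : ‖tCoef φ k‖ ≤ (δ₀ ^ 2)⁻¹ * (‖tCoef r k‖ * (‖k‖ ^ 2)⁻¹) := by
      rw [← div_eq_mul_inv, inv_mul_eq_div, le_div_iff₀ (by positivity),
        le_div_iff₀ (by positivity)]
      linarith
    refine h6.trans ?_
    refine mul_le_mul_of_nonneg_left ?_ (by positivity)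
    rw [h5]
    nlinarith [sq_nonneg (‖tCoef r k‖ - (‖k‖ ^ 2)⁻¹)]
  have hmaj : Summable fun k : Fin 2 → ℤ =>
      (δ₀ ^ 2)⁻¹ * (1 / 2 * (‖tCoef r k‖ ^ 2 + ‖k‖ ^ (-4 : ℝ))) :=
    ((hrsum.summable.add hZ).mul_left _).mul_left _
  set c : (Fin 2 → ℤ) → ℝ := fun k => if k = 0 then 0 else ‖tCoef φ k‖
  have hcle : ∀ k, c k ≤ (δ₀ ^ 2)⁻¹ * (1 / 2 * (‖tCoef r k‖ ^ 2 + ‖k‖ ^ (-4 : ℝ))) := by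
    intro k
    by_cases h0 : k = 0
    · simp only [c, if_pos h0]
      positivity
    · simp only [c, if_neg h0]
      exact hk k h0
  have hc0 : ∀ k, 0 ≤ c k := fun k => by
    simp only [c]
    split_ifs <;> positivity
  have hcs : Summable c := Summable.of_nonneg_of_le hc0 hcle hmaj
  have hcb : ∑' k, c k ≤ b := by
    refine (hcs.tsum_le_tsum hcle hmaj).trans ?_
    rw [tsum_mul_left, tsum_mul_left, (hrsum.summable.tsum_add hZ), hrsum.tsum_eq]
    simp only [b]
    gcongr
  have hs : Summable fun k => ‖tCoef φ k‖ := by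
    refine (summable_congr_cofinite ?_).1 hcs
    filter_upwards [(Set.finite_singleton (0 : Fin 2 → ℤ)).compl_mem_cofinite] with k hk
    have : k ≠ 0 := hk
    simp [c, this]
  set m : ℝ := (tCoef φ 0).re
  have hosc : ∀ᵐ x, |φ x - m| ≤ b := by
    filter_upwards [ae_eq_tsum_of_summable h.1 hs] with x hx
    have hsx : Summable fun k => tCoef φ k * UnitAddTorus.mFourier k x :=
      Summable.of_norm (by simpa only [norm_mul, norm_mFourier_apply, mul_one] using hs)
    have h1 : (φ x : ℂ) - tCoef φ 0
        = ∑' k, if k = 0 then 0 else tCoef φ k * UnitAddTorus.mFourier k x := by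
      rw [hx, hsx.tsum_eq_add_tsum_ite 0]
      simp [UnitAddTorus.mFourier_zero]
    have h2 : ‖(φ x : ℂ) - tCoef φ 0‖ ≤ b := by
      rw [h1]
      refine (tsum_of_norm_bounded hcs.hasSum fun k => ?_).trans hcb
      simp only [c]
      split_ifs
      · simp
      · rw [norm_mul, norm_mFourier_apply, mul_one]
    refine le_trans ?_ h2
    have h3 := Complex.abs_re_le_norm ((φ x : ℂ) - tCoef φ 0)
    simpa [m] using h3
  -- The zero mode of the equation: the Laplacian contributes nothing, so `e^{-φ}` has the mass of
  -- `ρ`.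
  have hmass : ∫ x, Real.exp (-φ x) = 1 := by
    have h1 := tCoef_poissonBoltzmann hρi h 0
    have h2 : tCoef r 0 = ((∫ x, r x : ℝ) : ℂ) := by
      unfold tCoef coef
      simp only [UnitAddTorus.mFourier_zero, ContinuousMap.one_apply, map_one, one_mul]
      exact integral_complex_ofReal
    rw [← hr, h2] at h1
    simp only [Pi.zero_apply, Int.cast_zero, ne_eq, OfNat.ofNat_ne_zero, not_false_eq_true,
      zero_pow, Finset.sum_const_zero, mul_zero, Complex.ofReal_zero, zero_mul,
      Complex.ofReal_eq_zero] at h1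
    rw [hr, integral_sub h.2.1 hρi, hρ1] at h1
    linarith
  have hpw : ∀ᵐ x, Real.exp (-m) * Real.exp (-b) ≤ Real.exp (-φ x) ∧
      Real.exp (-φ x) ≤ Real.exp (-m) * Real.exp b := by
    filter_upwards [hosc] with x hx
    rw [abs_le] at hx
    rw [← Real.exp_add, ← Real.exp_add]
    exact ⟨Real.exp_le_exp.2 (by linarith), Real.exp_le_exp.2 (by linarith)⟩
  -- Since `e^{-φ}` lies between `e^{-m-b}` and `e^{-m+b}` and has integral one, `|m| ≤ b`.
  have hlow : Real.exp (-m) * Real.exp (-b) ≤ 1 := by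
    rw [← hmass]
    have := integral_mono_ae (integrable_const _) h.2.1 (hpw.mono fun x hx => hx.1)
    simpa using this
  have hupp : 1 ≤ Real.exp (-m) * Real.exp b := by
    rw [← hmass]
    have := integral_mono_ae h.2.1 (integrable_const _) (hpw.mono fun x hx => hx.2)
    simpa using this
  rw [← Real.exp_add, ← Real.exp_zero, Real.exp_le_exp] at hlow hupp
  filter_upwards [hosc] with x hx
  rw [abs_le] at hx
  rw [← Real.exp_neg]
  exact ⟨Real.exp_le_exp.2 (by linarith), Real.exp_le_exp.2 (by linarith)⟩

/-! ### Comparison of the weighted measure with the Gaussian measure -/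

/-- The measure `μ` is comparable, up to the factor `B`, to the Gaussian measure on phase space. -/
structure IsComparable (B : ℝ) (φ : Torus → ℝ) : Prop where
  pos : 0 < B
  mu_le : mu φ ≤ ENNReal.ofReal B • nu
  nu_le : nu ≤ ENNReal.ofReal B • mu φ

theorem isComparable_of_ae {B : ℝ} (hB : 0 < B) {φ : Torus → ℝ}
    (h : ∀ᵐ x, B⁻¹ ≤ Real.exp (-φ x) ∧ Real.exp (-φ x) ≤ B) : IsComparable B φ := by
  have h' : ∀ᵐ z : Phase, B⁻¹ ≤ Real.exp (-φ z.1) ∧ Real.exp (-φ z.1) ≤ B :=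
    Measure.quasiMeasurePreserving_fst.ae h
  refine ⟨hB, ?_, ?_⟩
  · rw [mu, nu, ← withDensity_smul' _ _ ENNReal.ofReal_ne_top]
    refine withDensity_mono ?_
    filter_upwards [h'] with z hz
    rw [Pi.smul_apply, smul_eq_mul, ← ENNReal.ofReal_mul hB.le, finf]
    refine ENNReal.ofReal_le_ofReal ?_
    rw [mul_comm]
    exact mul_le_mul_of_nonneg_right hz.2 (maxwellian_pos _).le
  · rw [mu, nu, ← withDensity_smul' _ _ ENNReal.ofReal_ne_top]
    refine withDensity_mono ?_
    filter_upwards [h'] with z hz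
    rw [Pi.smul_apply, smul_eq_mul, ← ENNReal.ofReal_mul hB.le, finf]
    refine ENNReal.ofReal_le_ofReal ?_
    have h1 : 1 ≤ B * Real.exp (-φ z.1) := by
      have := mul_le_mul_of_nonneg_left hz.1 hB.le
      rwa [mul_inv_cancel₀ hB.ne'] at this
    nlinarith [maxwellian_pos z.2]

namespace IsComparable

variable {B : ℝ} {φ : Torus → ℝ} {E : Type*} [NormedAddCommGroup E]

theorem eLpNorm_mu_le (h : IsComparable B φ) (f : Phase → E) :
    eLpNorm f 2 (mu φ) ≤ ENNReal.ofReal B ^ (1 / 2 : ℝ) * eLpNorm f 2 nu := by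
  refine (eLpNorm_mono_measure f h.mu_le).trans ?_
  rw [eLpNorm_smul_measure_of_ne_top (by norm_num)]
  simp

theorem eLpNorm_nu_le (h : IsComparable B φ) (f : Phase → E) :
    eLpNorm f 2 nu ≤ ENNReal.ofReal B ^ (1 / 2 : ℝ) * eLpNorm f 2 (mu φ) := by
  refine (eLpNorm_mono_measure f h.nu_le).trans ?_
  rw [eLpNorm_smul_measure_of_ne_top (by norm_num)]
  simp

theorem sqrt_mul_sqrt (h : IsComparable B φ) :
    ENNReal.ofReal B ^ (1 / 2 : ℝ) * ENNReal.ofReal B ^ (1 / 2 : ℝ) = ENNReal.ofReal B := by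
  rw [← ENNReal.rpow_add _ _ (by simpa using h.pos) ENNReal.ofReal_ne_top]
  norm_num

theorem eLpNorm_nu_lt_top (h : IsComparable B φ) {f : Phase → E} (hf : eLpNorm f 2 (mu φ) < ⊤) :
    eLpNorm f 2 nu < ⊤ :=
  (h.eLpNorm_nu_le f).trans_lt (ENNReal.mul_lt_top
    (ENNReal.rpow_lt_top_of_nonneg (by norm_num) ENNReal.ofReal_ne_top) hf)

theorem isFiniteMeasure (h : IsComparable B φ) : IsFiniteMeasure (mu φ) :=
  ⟨(h.mu_le univ).trans_lt (by simp)⟩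

theorem memLp_nu (h : IsComparable B φ) {f : Phase → E} (hf : MemLp f 2 (mu φ)) :
    MemLp f 2 nu :=
  ⟨hf.1.mono_ac (Measure.absolutelyContinuous_of_le_smul h.nu_le), h.eLpNorm_nu_lt_top hf.2⟩

end IsComparable

theorem nu_absolutelyContinuous : nu ≪ volume := withDensity_absolutelyContinuous _ _

theorem IsWeakDeriv.aestronglyMeasurable_nu {d : (Phase → ℝ) → Phase → ℝ} {u w : Phase → ℝ}
    (h : IsWeakDeriv d u w) : AEStronglyMeasurable w nu :=
  h.2.1.aestronglyMeasurable.mono_ac nu_absolutelyContinuous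

/-- A function of mean zero is orthogonal to constants, so subtracting one cannot shorten it. This
allows the mean with respect to `nu` in the Poincaré inequality although `g` has mean zero for `mu
φ`. -/
theorem normH_le_eLpNorm_sub_const {φ : Torus → ℝ} {g : Phase → ℝ} [IsFiniteMeasure (mu φ)]
    (hg : MemH0 φ g) (c : ℝ) : normH φ g ≤ eLpNorm (fun z => g z - c) 2 (mu φ) := by
  have h2 : MemLp (fun z => g z - c) 2 (mu φ) := hg.1.sub (memLp_const c)
  have hgi : Integrable g (mu φ) := MemLp.integrable (by norm_num) hg.1
  rw [normH, ← ENNReal.pow_le_pow_left_iff two_ne_zero, eLpNorm_two_sq hg.1, eLpNorm_two_sq h2]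
  refine ENNReal.ofReal_le_ofReal ?_
  have e : ∀ z, (g z - c) ^ 2 = g z ^ 2 - 2 * c * g z + c ^ 2 := fun z => by ring
  simp only [e]
  have hsq : Integrable (fun z => g z ^ 2) (mu φ) := MemLp.integrable_sq hg.1
  have hi : Integrable (fun z => g z ^ 2 - 2 * c * g z) (mu φ) := hsq.sub (hgi.const_mul _)
  rw [integral_add hi (integrable_const _),
    integral_sub hsq (hgi.const_mul _), integral_const_mul, hg.2]
  have : 0 ≤ ∫ _ : Phase, c ^ 2 ∂(mu φ) := integral_nonneg fun _ => sq_nonneg c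
  linarith

theorem IsComparable.poincare {B : ℝ} {φ : Torus → ℝ} (h : IsComparable B φ) {g : Phase → ℝ}
    (hg : MemH0 φ g) : normH φ g ≤ ENNReal.ofReal (2 * B) * (normA φ g + normC φ g) := by
  have hB := h.pos
  have := h.isFiniteMeasure
  have hc0 : ENNReal.ofReal (2 * B) ≠ 0 := by simpa using hB
  -- Moving the constant to the left leaves only infima on the right, so the bound can be checked
  -- for each choice of weak derivatives; infinite norms are then trivial.
  rw [mul_comm, ← ENNReal.div_le_iff hc0 ENNReal.ofReal_ne_top]
  simp only [normA, normC, ENNReal.iInf_add, ENNReal.add_iInf, le_iInf_iff]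
  intro F hF G hG
  rw [ENNReal.div_le_iff hc0 ENNReal.ofReal_ne_top, mul_comm]
  by_cases hGt : eLpNorm G 2 (mu φ) = ⊤
  · simp only [hGt, top_add, ENNReal.mul_top hc0, le_top]
  by_cases hFt : eLpNorm F 2 (mu φ) = ⊤
  · simp only [hFt, add_top, ENNReal.mul_top hc0, le_top]
  have hcomp : ∀ (K : Phase → Vel) i, eLpNorm (fun z => K z i) 2 nu ≤ eLpNorm K 2 nu :=
    fun K i => eLpNorm_mono fun z => PiLp.norm_apply_le (K z) i
  have hG2 : ∀ i, MemLp (fun z => G z i) 2 nu := fun i =>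
    ⟨(hG i).aestronglyMeasurable_nu,
      (hcomp G i).trans_lt (h.eLpNorm_nu_lt_top (lt_top_iff_ne_top.2 hGt))⟩
  have hF2 : ∀ i, MemLp (fun z => F z i) 2 nu := fun i =>
    ⟨(hF i).aestronglyMeasurable_nu,
      (hcomp F i).trans_lt (h.eLpNorm_nu_lt_top (lt_top_iff_ne_top.2 hFt))⟩
  have hP := poincare_nu (h.memLp_nu hg.1) hG hF hG2 hF2
  have hP' : eLpNorm (fun z => g z - ∫ y, g y ∂nu) 2 nu
      ≤ 2 * (eLpNorm G 2 nu + eLpNorm F 2 nu) := by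
    rw [← ENNReal.pow_le_pow_left_iff two_ne_zero]
    refine hP.trans ?_
    calc _ ≤ ∑ _i : Fin 2, eLpNorm G 2 nu ^ 2 + ∑ _i : Fin 2, eLpNorm F 2 nu ^ 2 := by
          gcongr with i _ i _
          · exact hcomp G i
          · exact hcomp F i
      _ = 2 * (eLpNorm G 2 nu ^ 2 + eLpNorm F 2 nu ^ 2) := by
          simp only [Finset.sum_const, Finset.card_univ, Fintype.card_fin, nsmul_eq_mul]
          push_cast
          ring
      _ ≤ 2 * (eLpNorm G 2 nu ^ 2 + eLpNorm F 2 nu ^ 2) + (2 * (eLpNorm G 2 nu ^ 2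
          + eLpNorm F 2 nu ^ 2) + 8 * eLpNorm G 2 nu * eLpNorm F 2 nu) := le_self_add
      _ = _ := by ring
  calc normH φ g ≤ eLpNorm (fun z => g z - ∫ y, g y ∂nu) 2 (mu φ) :=
        normH_le_eLpNorm_sub_const hg _
    _ ≤ ENNReal.ofReal B ^ (1 / 2 : ℝ) * (2 * (ENNReal.ofReal B ^ (1 / 2 : ℝ) * eLpNorm G 2 (mu φ)
        + ENNReal.ofReal B ^ (1 / 2 : ℝ) * eLpNorm F 2 (mu φ))) := by
        refine (h.eLpNorm_mu_le _).trans ?_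
        gcongr
        refine hP'.trans ?_
        gcongr
        · exact h.eLpNorm_nu_le G
        · exact h.eLpNorm_nu_le F
    _ = 2 * (ENNReal.ofReal B ^ (1 / 2 : ℝ) * ENNReal.ofReal B ^ (1 / 2 : ℝ))
        * (eLpNorm G 2 (mu φ) + eLpNorm F 2 (mu φ)) := by ring
    _ = _ := by
        rw [h.sqrt_mul_sqrt, ENNReal.ofReal_mul (by norm_num), ENNReal.ofReal_ofNat]

theorem norm_mat_le_sum (x : Mat) : ‖x‖ ≤ ‖∑ p : Fin 2 × Fin 2, ‖x p‖‖ := by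
  rw [Real.norm_of_nonneg (Finset.sum_nonneg fun _ _ => norm_nonneg _), EuclideanSpace.norm_eq]
  refine Real.sqrt_le_iff.2 ⟨Finset.sum_nonneg fun _ _ => norm_nonneg _, ?_⟩
  exact Finset.sum_sq_le_sq_sum_of_nonneg fun _ _ => norm_nonneg _

/-- The factor `4` counts the matrix entries, each bounded by `hessian_le_nu`; passing from `mu φ`
to `nu` and back costs `√B` each way. -/
theorem IsComparable.normAA_le {B : ℝ} {φ : Torus → ℝ} (h : IsComparable B φ) {u : Phase → ℝ}
    (hu : MemH φ u) : normAA φ u ≤ ENNReal.ofReal (4 * B) * normAstarA φ u := by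
  have hB := h.pos
  have hc0 : ENNReal.ofReal (4 * B) ≠ 0 := by simpa using hB
  rw [mul_comm, ← ENNReal.div_le_iff hc0 ENNReal.ofReal_ne_top]
  simp only [normAstarA, le_iInf_iff]
  intro G H hG hH hG2 hH2
  rw [ENNReal.div_le_iff hc0 ENNReal.ofReal_ne_top, mul_comm]
  set N : Phase → ℝ := fun z => ∑ i, (z.2 i * G z i - H z (i, i))
  by_cases hNt : eLpNorm N 2 (mu φ) = ⊤
  · simp only [hNt, ENNReal.mul_top hc0, le_top]
  have hG2' : ∀ i, MemLp (fun z => G z i) 2 nu := fun i =>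
    (h.memLp_nu hG2).mono (hG i).aestronglyMeasurable_nu
      (Eventually.of_forall fun z => PiLp.norm_apply_le (G z) i)
  have hH2' : ∀ i j, MemLp (fun z => H z (i, j)) 2 nu := fun i j =>
    (h.memLp_nu hH2).mono (hH i j).aestronglyMeasurable_nu
      (Eventually.of_forall fun z => PiLp.norm_apply_le (H z) (i, j))
  have hN2 : MemLp N 2 nu := by
    refine ⟨?_, h.eLpNorm_nu_lt_top (lt_top_iff_ne_top.2 hNt)⟩
    refine Finset.aestronglyMeasurable_fun_sum _ fun i _ => ?_
    have hc : Continuous fun z : Phase => z.2 i := by fun_prop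
    exact (hc.aestronglyMeasurable.mul (hG2' i).1).sub (hH2' i i).1
  have hle : ∀ i j, eLpNorm (fun z => H z (i, j)) 2 nu ≤ eLpNorm N 2 nu :=
    hessian_le_nu (h.memLp_nu hu) hG hH hG2' hH2' hN2
  have hHN : eLpNorm H 2 nu ≤ 4 * eLpNorm N 2 nu := by
    have h1 : eLpNorm H 2 nu ≤ eLpNorm (∑ p : Fin 2 × Fin 2, fun z => ‖H z p‖) 2 nu :=
      eLpNorm_mono fun z => by
        rw [Finset.sum_apply]
        exact norm_mat_le_sum (H z)
    have h2 : ∀ p ∈ (Finset.univ : Finset (Fin 2 × Fin 2)),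
        AEStronglyMeasurable (fun z => ‖H z p‖) nu := fun p _ => (hH2' p.1 p.2).1.norm
    refine (h1.trans (eLpNorm_sum_le h2 (by norm_num))).trans ?_
    calc _ ≤ ∑ _p : Fin 2 × Fin 2, eLpNorm N 2 nu := by
          refine Finset.sum_le_sum fun p _ => ?_
          exact (eLpNorm_norm (fun z => H z p)).trans_le (hle p.1 p.2)
      _ = _ := by simp [Finset.sum_const, nsmul_eq_mul]
  calc normAA φ u ≤ eLpNorm H 2 (mu φ) :=
        iInf_le_of_le G <| iInf_le_of_le H <| iInf_le_of_le hG <| iInf_le_of_le hH le_rfl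
    _ ≤ ENNReal.ofReal B ^ (1 / 2 : ℝ) * (4 * (ENNReal.ofReal B ^ (1 / 2 : ℝ)
        * eLpNorm N 2 (mu φ))) := by
        refine (h.eLpNorm_mu_le _).trans ?_
        gcongr
        refine hHN.trans ?_
        gcongr
        exact h.eLpNorm_nu_le N
    _ = 4 * (ENNReal.ofReal B ^ (1 / 2 : ℝ) * ENNReal.ofReal B ^ (1 / 2 : ℝ))
        * eLpNorm N 2 (mu φ) := by ring
    _ = _ := by
        rw [h.sqrt_mul_sqrt, ENNReal.ofReal_mul (by norm_num), ENNReal.ofReal_ofNat]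

/-- Comparability with the Gaussian measure, uniformly in `δ > δ₀`. -/
theorem exists_isComparable {p : ℝ≥0∞} (hp : 2 < p) {ρ : Torus → ℝ} (hρ : MemW1 p ρ)
    (hρ' : ∫ x, ρ x = 1) {δ₀ : ℝ} (hδ₀ : 0 < δ₀) :
    ∃ B : ℝ, 0 < B ∧ ∀ δ > δ₀, ∀ φ, IsPoissonBoltzmann δ ρ φ → IsComparable B φ := by
  obtain ⟨B, hB, h⟩ := exists_exp_neg_bounds (hρ.1.mono_exponent hp.le) hρ' hδ₀
  exact ⟨B, hB, fun δ hδ φ hφ => isComparable_of_ae hB (h δ hδ φ hφ)⟩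

/-! ### Weights `τ^a m^b` -/

/-- The weight `τ^a m^b`. -/
def wgt (τ m a b : ℝ) : ℝ≥0∞ := ENNReal.ofReal (τ ^ a * m ^ b)

section Weights

variable {τ m : ℝ}

theorem wgt_mul (hτ : 0 < τ) (hm : 0 < m) (a b a' b' : ℝ) :
    wgt τ m a b * wgt τ m a' b' = wgt τ m (a + a') (b + b') := by
  unfold wgt
  rw [← ENNReal.ofReal_mul (by positivity), Real.rpow_add hτ, Real.rpow_add hm]
  congr 1
  ring

theorem wgt_rpow (hτ : 0 < τ) (hm : 0 < m) (a b s : ℝ) :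
    wgt τ m a b ^ s = wgt τ m (s * a) (s * b) := by
  unfold wgt
  rw [ENNReal.ofReal_rpow_of_pos (by positivity), Real.mul_rpow (by positivity) (by positivity),
    ← Real.rpow_mul hτ.le, ← Real.rpow_mul hm.le, mul_comm a, mul_comm b]

theorem wgt_zero : wgt τ m 0 0 = 1 := by simp [wgt]

theorem wgt_one (a b : ℝ) : wgt τ 1 a b = wgt τ 1 a 0 := by simp [wgt]

/-- Monotonicity of the weights for `τ > τ₀` and `m ≤ 1`, for bounded differences of exponents. -/
theorem wgt_le {τ₀ : ℝ} (hτ₀ : 0 < τ₀) (hτ : τ₀ < τ) (hm : 0 < m) (hm1 : m ≤ 1) {N a b a' b' : ℝ}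
    (ha : a ≤ a') (ha' : a' ≤ a + N) (hb : b' ≤ b) :
    wgt τ m a b ≤ ENNReal.ofReal (min 1 τ₀ ^ (-N)) * wgt τ m a' b' := by
  have hτp : 0 < τ := hτ₀.trans hτ
  have hσ : 0 < min 1 τ₀ := lt_min one_pos hτ₀
  unfold wgt
  rw [← ENNReal.ofReal_mul (by positivity), ← mul_assoc]
  refine ENNReal.ofReal_le_ofReal (mul_le_mul ?_
    (Real.rpow_le_rpow_of_exponent_ge hm hm1 hb) (by positivity) (by positivity))
  -- The exponent `a' - a` lies in `[0, N]`, so only values `τ < 1` could make the power small, and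
  -- these stay above `min 1 τ₀`.
  have h1 : min 1 τ₀ ^ N ≤ τ ^ (a' - a) :=
    calc min 1 τ₀ ^ N ≤ min 1 τ₀ ^ (a' - a) :=
          Real.rpow_le_rpow_of_exponent_ge hσ (min_le_left _ _) (by linarith)
      _ ≤ τ ^ (a' - a) :=
          Real.rpow_le_rpow hσ.le ((min_le_right _ _).trans hτ.le) (by linarith)
  rw [Real.rpow_sub hτp, le_div_iff₀ (by positivity)] at h1
  rw [Real.rpow_neg hσ.le, inv_mul_eq_div, le_div_iff₀ (by positivity)]
  linarith

theorem le_wgt_mul_sqrt (hτ : 0 < τ) (hm : 0 < m) {c a b : ℝ} (hc : 0 < c) {X D : ℝ≥0∞}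
    (h : ENNReal.ofReal c * wgt τ m a b * X ^ 2 ≤ D) :
    X ≤ ENNReal.ofReal (c ^ (-(1 / 2) : ℝ)) * wgt τ m (-a / 2) (-b / 2) * D ^ (1 / 2 : ℝ) := by
  have h1 := ENNReal.rpow_le_rpow h (z := 1 / 2) (by norm_num)
  rw [ENNReal.mul_rpow_of_nonneg _ _ (by norm_num), ENNReal.mul_rpow_of_nonneg _ _ (by norm_num),
    wgt_rpow hτ hm, ENNReal.ofReal_rpow_of_pos hc, ← ENNReal.rpow_natCast, ← ENNReal.rpow_mul] at h1
  norm_num only [Nat.cast_ofNat, ENNReal.rpow_one] at h1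
  have h2 : ENNReal.ofReal (c ^ (-(1 / 2) : ℝ)) * wgt τ m (-a / 2) (-b / 2)
      * (ENNReal.ofReal (c ^ (1 / 2 : ℝ)) * wgt τ m (1 / 2 * a) (1 / 2 * b)) = 1 := by
    have h3 : ENNReal.ofReal (c ^ (-(1 / 2) : ℝ)) * ENNReal.ofReal (c ^ (1 / 2 : ℝ)) = 1 := by
      rw [← ENNReal.ofReal_mul (by positivity), ← Real.rpow_add hc]
      norm_num
    have h4 := wgt_mul hτ hm (-a / 2) (-b / 2) (1 / 2 * a) (1 / 2 * b)
    rw [show -a / 2 + 1 / 2 * a = 0 by ring, show -b / 2 + 1 / 2 * b = 0 by ring, wgt_zero] at h4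
    rw [mul_mul_mul_comm, h3, h4, one_mul]
  calc X = ENNReal.ofReal (c ^ (-(1 / 2) : ℝ)) * wgt τ m (-a / 2) (-b / 2)
      * (ENNReal.ofReal (c ^ (1 / 2 : ℝ)) * wgt τ m (1 / 2 * a) (1 / 2 * b)) * X := by
        rw [h2, one_mul]
    _ ≤ _ := by
        rw [mul_assoc]
        gcongr

/-- Geometric interpolation of two weighted bounds interpolates the exponents linearly and leaves
the constant and `x` unchanged. -/
theorem rpow_mul_rpow_le_wgt (hτ : 0 < τ) (hm : 0 < m) {L x H C : ℝ≥0∞} {a b a' b' s : ℝ}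
    (hs0 : 0 ≤ s) (hs1 : s ≤ 1)
    (hH : H ≤ L * wgt τ m a b * x) (hC : C ≤ L * wgt τ m a' b' * x) :
    H ^ (1 - s) * C ^ s ≤ L * wgt τ m ((1 - s) * a + s * a') ((1 - s) * b + s * b') * x := by
  have hs : 0 ≤ 1 - s := by linarith
  have key : ∀ y : ℝ≥0∞, y ^ (1 - s) * y ^ s = y := fun y => by
    rw [← ENNReal.rpow_add_of_nonneg _ _ hs hs0]
    norm_num
  calc H ^ (1 - s) * C ^ s
      ≤ (L * wgt τ m a b * x) ^ (1 - s) * (L * wgt τ m a' b' * x) ^ s := by gcongr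
    _ = (L ^ (1 - s) * L ^ s) * (wgt τ m a b ^ (1 - s) * wgt τ m a' b' ^ s)
        * (x ^ (1 - s) * x ^ s) := by
      simp only [ENNReal.mul_rpow_of_nonneg _ _ hs, ENNReal.mul_rpow_of_nonneg _ _ hs0]
      ring
    _ = _ := by rw [key, key, wgt_rpow hτ hm, wgt_rpow hτ hm, wgt_mul hτ hm]

/-- The accounting rule for all remainder terms. A deficit in the power of `τ` costs at most `min 1
τ₀ ^ (-N)`, and a surplus power of `m ≤ 1` is dropped. -/
theorem wgt_mul_three_le {τ₀ : ℝ} (hτ₀ : 0 < τ₀) (hτ : τ₀ < τ) (hm : 0 < m) (hm1 : m ≤ 1)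
    {L X Y Z x y z : ℝ≥0∞} {N P a b a₁ b₁ a₂ b₂ a₃ b₃ : ℝ}
    (hX : X ≤ L * wgt τ m a₁ b₁ * x) (hY : Y ≤ L * wgt τ m a₂ b₂ * y)
    (hZ : Z ≤ L * wgt τ m a₃ b₃ * z) (ha : a + a₁ + a₂ + a₃ ≤ P)
    (hN : P ≤ a + a₁ + a₂ + a₃ + N) (hb : 0 ≤ b + b₁ + b₂ + b₃) :
    wgt τ m a b * X * Y * Z
      ≤ L ^ 3 * ENNReal.ofReal (min 1 τ₀ ^ (-N)) * wgt τ m P 0 * (x * y * z) := by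
  have hτp : 0 < τ := hτ₀.trans hτ
  calc wgt τ m a b * X * Y * Z
      ≤ wgt τ m a b * (L * wgt τ m a₁ b₁ * x) * (L * wgt τ m a₂ b₂ * y)
        * (L * wgt τ m a₃ b₃ * z) := by gcongr
    _ = L ^ 3 * (wgt τ m a b * wgt τ m a₁ b₁ * wgt τ m a₂ b₂ * wgt τ m a₃ b₃) * (x * y * z) := by
      ring
    _ ≤ _ := by
      rw [wgt_mul hτp hm, wgt_mul hτp hm, wgt_mul hτp hm]
      have := wgt_le hτ₀ hτ hm hm1 ha hN hb
      calc _ ≤ L ^ 3 * (ENNReal.ofReal (min 1 τ₀ ^ (-N)) * wgt τ m P 0) * (x * y * z) := by gcongr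
        _ = _ := by ring

end Weights

/-! ### Consequences of the bounds on energy and dissipation -/

/-- Bounds for `h ∈ 𝓗₀` in terms of `x = D_t(h)^{1/2}`, with constant `L`. -/
structure DissipationBounds (L : ℝ≥0∞) (τ m : ℝ) (φ : Torus → ℝ) (h : Phase → ℝ) (x : ℝ≥0∞) :
    Prop where
  A : normA φ h ≤ L * wgt τ m (1 / 2) 0 * x
  AA : normAA φ h ≤ L * wgt τ m (23 / 30) (-1 / 2) * x
  AC : normAC φ h ≤ L * wgt τ m (3 / 10) (-3 / 2) * x
  C : normC φ h ≤ L * wgt τ m (1 / 30) (-1) * x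
  H : normH φ h ≤ L * wgt τ m (1 / 2) (-1) * x

/-- The constant in the bounds by energy and dissipation. -/
def boundConst (γ : Fin 3 → ℝ) (B c₀ R : ℝ) : ℝ≥0∞ :=
  1 + ENNReal.ofReal (4 * B) * ENNReal.ofReal (γ 0 ^ (-(1 / 2) : ℝ))
    + ENNReal.ofReal (γ 1 ^ (-(1 / 2) : ℝ)) + ENNReal.ofReal (γ 2 ^ (-(1 / 2) : ℝ))
    + ENNReal.ofReal (2 * B) * (ENNReal.ofReal R
      + ENNReal.ofReal (γ 2 ^ (-(1 / 2) : ℝ)) * ENNReal.ofReal R)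
    + ENNReal.ofReal (c₀ ^ (-(1 / 2) : ℝ))

theorem boundConst_ne_top (γ : Fin 3 → ℝ) (B c₀ R : ℝ) : boundConst γ B c₀ R ≠ ⊤ := by
  unfold boundConst
  finiteness

theorem wt_pos {τ t : ℝ} (hτ : 0 < τ) (ht : 0 < t) : 0 < wt τ t :=
  lt_min one_pos (div_pos ht hτ)

theorem dissipationBounds {γ : Fin 3 → ℝ} (hγ : ∀ i, 0 < γ i) {B : ℝ} {φ : Torus → ℝ}
    (hB : IsComparable B φ) (c₀ : ℝ) {τ₀ τ t N : ℝ} (hN : 1 / 2 ≤ N) (hτ₀ : 0 < τ₀) (hτ : τ₀ < τ)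
    (ht : 0 < t) {h : Phase → ℝ} (hh : MemH0 φ h) :
    DissipationBounds (boundConst γ B c₀ (min 1 τ₀ ^ (-N))) τ (wt τ t) φ h
      (dissipation γ betaColl τ t φ h ^ (1 / 2 : ℝ)) := by
  have hτp : 0 < τ := hτ₀.trans hτ
  have hm := wt_pos hτp ht
  have hm1 : wt τ t ≤ 1 := min_le_left _ _
  set m := wt τ t
  set R := min 1 τ₀ ^ (-N)
  set D := dissipation γ betaColl τ t φ h
  have hw : ∀ (c a b : ℝ), 0 < c → ENNReal.ofReal c * wgt τ m a b
      = ENNReal.ofReal (c * τ ^ a * m ^ b) := fun c a b hc => by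
    rw [wgt, ← ENNReal.ofReal_mul hc.le, mul_assoc]
  -- Each summand of the dissipation is at most the whole. Solving for the norm halves the exponents
  -- and changes their sign, which produces the entries of `DissipationBounds`.
  have dA : ENNReal.ofReal 1 * wgt τ m (-1) 0 * normA φ h ^ 2 ≤ D := by
    rw [hw _ _ _ one_pos, one_mul, Real.rpow_neg_one, Real.rpow_zero, mul_one]
    exact le_self_add.trans (le_self_add.trans le_self_add)
  have dAA : ENNReal.ofReal (γ 0) * wgt τ m (-23 / 15) 1 * normAstarA φ h ^ 2 ≤ D := by
    rw [hw _ _ _ (hγ 0), Real.rpow_one,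
      show (-23 / 15 : ℝ) = betaColl 0 - 1 by norm_num [betaColl]]
    exact le_add_self.trans (le_self_add.trans le_self_add)
  have dAC : ENNReal.ofReal (γ 1) * wgt τ m (-3 / 5) 3 * normAC φ h ^ 2 ≤ D := by
    rw [hw _ _ _ (hγ 1), show (-3 / 5 : ℝ) = betaColl 1 - 1 by norm_num [betaColl],
      show m ^ (3 : ℝ) = m ^ 3 from Real.rpow_ofNat m 3]
    exact le_add_self.trans le_self_add
  have dC : ENNReal.ofReal (γ 2) * wgt τ m (-1 / 15) 2 * normC φ h ^ 2 ≤ D := by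
    rw [hw _ _ _ (hγ 2), show (-1 / 15 : ℝ) = betaColl 2 from rfl,
      show m ^ (2 : ℝ) = m ^ 2 from Real.rpow_ofNat m 2]
    exact le_add_self
  have bA : normA φ h ≤ 1 * wgt τ m (1 / 2) 0 * D ^ (1 / 2 : ℝ) := by
    have := le_wgt_mul_sqrt hτp hm one_pos dA
    norm_num at this ⊢
    exact this
  have bAA : normAstarA φ h ≤ ENNReal.ofReal (γ 0 ^ (-(1 / 2) : ℝ))
      * wgt τ m (23 / 30) (-1 / 2) * D ^ (1 / 2 : ℝ) := by
    have := le_wgt_mul_sqrt hτp hm (hγ 0) dAA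
    norm_num at this ⊢
    exact this
  have bAC : normAC φ h ≤ ENNReal.ofReal (γ 1 ^ (-(1 / 2) : ℝ))
      * wgt τ m (3 / 10) (-3 / 2) * D ^ (1 / 2 : ℝ) := by
    have := le_wgt_mul_sqrt hτp hm (hγ 1) dAC
    norm_num at this ⊢
    exact this
  have bC : normC φ h ≤ ENNReal.ofReal (γ 2 ^ (-(1 / 2) : ℝ))
      * wgt τ m (1 / 30) (-1) * D ^ (1 / 2 : ℝ) := by
    have := le_wgt_mul_sqrt hτp hm (hγ 2) dC
    norm_num at this ⊢
    exact this
  have hL : ∀ {X c w : ℝ≥0∞}, X ≤ c * w * D ^ (1 / 2 : ℝ) → c ≤ boundConst γ B c₀ R →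
      X ≤ boundConst γ B c₀ R * w * D ^ (1 / 2 : ℝ) := fun h1 h2 => h1.trans (by gcongr)
  refine ⟨hL bA ?_, ?_, hL bAC ?_, hL bC ?_, ?_⟩
  · unfold boundConst
    simp only [add_assoc]
    exact le_self_add
  · refine hL (c := ENNReal.ofReal (4 * B) * ENNReal.ofReal (γ 0 ^ (-(1 / 2) : ℝ))) ?_ ?_
    · refine (hB.normAA_le hh.1).trans ?_
      rw [mul_assoc, mul_assoc, ← mul_assoc (ENNReal.ofReal (γ 0 ^ (-(1 / 2) : ℝ)))]
      gcongr
    · unfold boundConst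
      simp only [add_assoc]
      exact le_self_add.trans le_add_self
  · unfold boundConst
    simp only [add_assoc]
    exact le_self_add.trans (le_add_self.trans le_add_self)
  · unfold boundConst
    simp only [add_assoc]
    exact le_self_add.trans (le_add_self.trans (le_add_self.trans le_add_self))
  · refine hL (c := ENNReal.ofReal (2 * B) * (ENNReal.ofReal R
      + ENNReal.ofReal (γ 2 ^ (-(1 / 2) : ℝ)) * ENNReal.ofReal R)) ?_ ?_
    · refine (hB.poincare hh).trans ?_
      -- The bounds for `Ah` and `Ch` are raised to the common weight `τ^{1/2} m^{-1}`: for `Ah` by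
      -- `m ≤ 1`, for `Ch` by a surplus `τ^{7/15}`, whence `1 / 2 ≤ N`.
      have h1 : wgt τ m (1 / 2) 0 ≤ ENNReal.ofReal R * wgt τ m (1 / 2) (-1) :=
        wgt_le hτ₀ hτ hm hm1 le_rfl (by linarith) (by norm_num)
      have h2 : wgt τ m (1 / 30) (-1) ≤ ENNReal.ofReal R * wgt τ m (1 / 2) (-1) :=
        wgt_le hτ₀ hτ hm hm1 (by norm_num) (by linarith) le_rfl
      calc _ ≤ ENNReal.ofReal (2 * B) *
            (1 * (ENNReal.ofReal R * wgt τ m (1 / 2) (-1)) * D ^ (1 / 2 : ℝ)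
            + ENNReal.ofReal (γ 2 ^ (-(1 / 2) : ℝ)) * (ENNReal.ofReal R * wgt τ m (1 / 2) (-1))
              * D ^ (1 / 2 : ℝ)) := by
            gcongr
            · exact bA.trans (by gcongr)
            · exact bC.trans (by gcongr)
        _ = _ := by ring
    · unfold boundConst
      simp only [add_assoc]
      exact le_self_add.trans
        (le_add_self.trans (le_add_self.trans (le_add_self.trans le_add_self)))

/-- Bounds for `k ∈ 𝓗` in terms of `z = 𝓔_t(k)^{1/2}`. -/
theorem energyBounds {γ : Fin 3 → ℝ} {B c₀ R : ℝ} (hc₀ : 0 < c₀) {τ δ t : ℝ} (hτ : 0 < τ)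
    (ht : 0 < t) {φ : Torus → ℝ} {k : Phase → ℝ}
    (hk : ENNReal.ofReal c₀ * plainSq betaColl τ t φ k ≤ twistedSq γ betaColl τ t φ k) :
    normH φ k ≤ boundConst γ B c₀ R * wgt τ (wt τ t) 0 0
        * energy γ betaColl τ δ t φ k ^ (1 / 2 : ℝ)
      ∧ normC φ k ≤ boundConst γ B c₀ R * wgt τ (wt τ t) (-1 / 5) (-3 / 2)
        * energy γ betaColl τ δ t φ k ^ (1 / 2 : ℝ) := by
  have hm := wt_pos hτ ht
  set m := wt τ t with hmdef
  set Z := energy γ betaColl τ δ t φ k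
  -- The electric part of the energy is nonnegative and is dropped.
  have hZ : ENNReal.ofReal c₀ * plainSq betaColl τ t φ k ≤ Z := hk.trans le_self_add
  have dH : ENNReal.ofReal c₀ * wgt τ m 0 0 * normH φ k ^ 2 ≤ Z := by
    refine le_trans ?_ hZ
    rw [wgt_zero, mul_one]
    gcongr
    exact le_self_add.trans le_self_add
  have dC : ENNReal.ofReal c₀ * wgt τ m (2 / 5) 3 * normC φ k ^ 2 ≤ Z := by
    refine le_trans ?_ hZ
    rw [mul_assoc, wgt, show m ^ (3 : ℝ) = m ^ 3 from Real.rpow_ofNat m 3]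
    gcongr
    exact le_add_self
  have hL : ENNReal.ofReal (c₀ ^ (-(1 / 2) : ℝ)) ≤ boundConst γ B c₀ R := le_add_self
  constructor
  · have := le_wgt_mul_sqrt hτ hm hc₀ dH
    norm_num at this ⊢
    exact this.trans (by gcongr)
  · have := le_wgt_mul_sqrt hτ hm hc₀ dC
    norm_num at this ⊢
    exact this.trans (by gcongr)

/-! ### Estimates of the two remainders, for `t > 0` and at `t = 0`. -/

theorem sqrt_mul_sqrt_ennreal (D : ℝ≥0∞) : D ^ (1 / 2 : ℝ) * D ^ (1 / 2 : ℝ) = D := by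
  rw [← ENNReal.rpow_add_of_nonneg _ _ (by norm_num) (by norm_num)]
  norm_num

theorem ofReal_mul_pow_one (τ m a : ℝ) : ENNReal.ofReal (τ ^ a * m) = wgt τ m a 1 := by
  rw [wgt, Real.rpow_one]

theorem ofReal_mul_pow_two (τ m a : ℝ) : ENNReal.ofReal (τ ^ a * m ^ 2) = wgt τ m a 2 := by
  rw [wgt, ← Real.rpow_ofNat]

theorem ofReal_mul_pow_three (τ m a : ℝ) : ENNReal.ofReal (τ ^ a * m ^ 3) = wgt τ m a 3 := by
  rw [wgt, ← Real.rpow_ofNat]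

/-- Every term except the fourth has `τ`-exponent exactly `14/15`, for instance `2/5 + 1/2 + 1/30`
and `-1/15 + 1/2 + 1/2`; the fourth has `7/15`. The factor `5` counts the terms. -/
theorem quadRem_le {τ₀ τ δ t N : ℝ} (hN : 1 ≤ N) (hτ₀ : 0 < τ₀) (hτ : τ₀ < τ) (ht : 0 < t)
    {L D : ℝ≥0∞} (hL : 1 ≤ L) {φ : Torus → ℝ} {h : Phase → ℝ}
    (hh : DissipationBounds L τ (wt τ t) φ h (D ^ (1 / 2 : ℝ))) :
    quadRem betaColl τ δ t φ h ≤ ENNReal.ofReal (1 / δ ^ 2) *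
      (5 * (L ^ 3 * ENNReal.ofReal (min 1 τ₀ ^ (-N)) * wgt τ (wt τ t) (14 / 15) 0 * D)) := by
  have hm := wt_pos (hτ₀.trans hτ) ht
  have hm1 : wt τ t ≤ 1 := min_le_left _ _
  -- A trivial third factor, so that `wgt_mul_three_le` also serves for products of two norms.
  have h1 : (1 : ℝ≥0∞) ≤ L * wgt τ (wt τ t) 0 0 * 1 := by simpa [wgt_zero] using hL
  have key : ∀ {a b a₁ b₁ a₂ b₂ : ℝ} {X Y : ℝ≥0∞},
      X ≤ L * wgt τ (wt τ t) a₁ b₁ * D ^ (1 / 2 : ℝ) →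
      Y ≤ L * wgt τ (wt τ t) a₂ b₂ * D ^ (1 / 2 : ℝ) →
      a + a₁ + a₂ ≤ 14 / 15 → 14 / 15 ≤ a + a₁ + a₂ + 1 → 0 ≤ b + b₁ + b₂ →
      wgt τ (wt τ t) a b * X * Y
        ≤ L ^ 3 * ENNReal.ofReal (min 1 τ₀ ^ (-N)) * wgt τ (wt τ t) (14 / 15) 0 * D := by
    intro a b a₁ b₁ a₂ b₂ X Y hX hY ha ha' hb
    have := wgt_mul_three_le hτ₀ hτ hm hm1 (N := N) (P := 14 / 15) (a := a) (b := b) hX hY h1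
      (by linarith) (by linarith) (by linarith)
    rwa [mul_one, mul_one, sqrt_mul_sqrt_ennreal] at this
  rw [quadRem, ofReal_mul_pow_two, ofReal_mul_pow_three,
    show betaColl 1 = 2 / 5 from rfl, show betaColl 2 = -1 / 15 from rfl]
  refine mul_le_mul_right ?_ _
  have s1 := key (a := 2 / 5) (b := 3) hh.A hh.C
    (by norm_num) (by norm_num) (by norm_num)
  have s2 := key (a := 2 / 5) (b := 3) hh.H hh.C
    (by norm_num) (by norm_num) (by norm_num)
  have s3 := key (a := -1 / 15) (b := 2) hh.A hh.A
    (by norm_num) (by norm_num) (by norm_num)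
  have s4 := key (a := -1 / 15) (b := 2) hh.H hh.C
    (by norm_num) (by norm_num) (by norm_num)
  have s5 := key (a := -1 / 15) (b := 2) hh.H hh.A
    (by norm_num) (by norm_num) (by norm_num)
  rw [mul_assoc, ← pow_two] at s3
  refine (add_le_add (add_le_add (add_le_add (add_le_add s1 s2) s3) s4) s5).trans_eq ?_
  ring

/-- The exponents `1/4` and `1/2` satisfy all constraints of the count. In `T₁` the power `τ^{1 -
7η₁/15}` requires `η₁ ≥ 1/7`. In the terms where `k` is interpolated and `m` appears, the power
`m^{1/2 - 3ηᵢ/2}` requires `ηᵢ ≤ 1/3`. In the short-time term `τ^{1 - η'/5}` requires `η' ≥ 1/3`.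
The factor `10` counts the terms. -/
theorem triRem_le {τ₀ τ δ t N P : ℝ} (hP : 14 / 15 ≤ P) (hN : P ≤ N) (hτ₀ : 0 < τ₀) (hτ : τ₀ < τ)
    (ht : 0 < t) {L x y z : ℝ≥0∞} (hL : 1 ≤ L) {φ : Torus → ℝ} {h g k : Phase → ℝ}
    (hh : DissipationBounds L τ (wt τ t) φ h x) (hg : DissipationBounds L τ (wt τ t) φ g y)
    (hkH : normH φ k ≤ L * wgt τ (wt τ t) 0 0 * z)
    (hkC : normC φ k ≤ L * wgt τ (wt τ t) (-1 / 5) (-3 / 2) * z) :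
    triRem betaColl (fun _ => 1 / 4) (1 / 2) τ δ t φ h g k ≤ ENNReal.ofReal (1 / δ ^ 2) *
      (10 * (L ^ 3 * ENNReal.ofReal (min 1 τ₀ ^ (-N)) * wgt τ (wt τ t) P 0
        * (x * (y + shortTime (1 / 2) τ t φ g) * z))) := by
  have hτp := hτ₀.trans hτ
  have hm := wt_pos hτp ht
  have hm1 : wt τ t ≤ 1 := min_le_left _ _
  set m := wt τ t with hmdef
  set S := shortTime (1 / 2) τ t φ g with hS
  set U := L ^ 3 * ENNReal.ofReal (min 1 τ₀ ^ (-N)) * wgt τ m P 0 * (x * (y + S) * z) with hU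
  -- The auxiliary `y'` stands for either part of the bracket: the dissipation of `g`, or the
  -- short-time term.
  have key : ∀ {X Y Z y' : ℝ≥0∞} (a b : ℝ) {a₁ b₁ a₂ b₂ a₃ b₃ : ℝ},
      X ≤ L * wgt τ m a₁ b₁ * x → Y ≤ L * wgt τ m a₂ b₂ * y' → Z ≤ L * wgt τ m a₃ b₃ * z →
      y' ≤ y + S → a + a₁ + a₂ + a₃ ≤ 14 / 15 → 0 ≤ a + a₁ + a₂ + a₃ →
      0 ≤ b + b₁ + b₂ + b₃ → wgt τ m a b * X * Y * Z ≤ U := by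
    intro X Y Z y' a b a₁ b₁ a₂ b₂ a₃ b₃ hX hY hZ hy ha ha' hb
    refine (wgt_mul_three_le hτ₀ hτ hm hm1 (N := N) hX hY hZ (ha.trans hP) (by linarith) hb).trans ?_
    rw [hU]
    gcongr
  have key' : ∀ {X Y Z y' : ℝ≥0∞} (a b : ℝ) {a₁ b₁ a₂ b₂ a₃ b₃ : ℝ},
      X ≤ L * wgt τ m a₁ b₁ * x → Y ≤ L * wgt τ m a₂ b₂ * y' → Z ≤ L * wgt τ m a₃ b₃ * z →
      y' ≤ y + S → a + a₁ + a₂ + a₃ ≤ 14 / 15 → 0 ≤ a + a₁ + a₂ + a₃ →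
      0 ≤ b + b₁ + b₂ + b₃ → wgt τ m a b * X * Z * Y ≤ U := by
    intro X Y Z y' a b a₁ b₁ a₂ b₂ a₃ b₃ hX hY hZ hy ha ha' hb
    rw [mul_right_comm]
    exact key a b hX hY hZ hy ha ha' hb
  have ig : ∀ s : ℝ, 0 ≤ s → s ≤ 1 → interp φ g s ≤ L * wgt τ m ((1 - s) * (1 / 2) + s * (1 / 30))
      ((1 - s) * (-1) + s * (-1)) * y := fun s h0 h1 => rpow_mul_rpow_le_wgt hτp hm h0 h1 hg.H hg.C
  have ik : ∀ s : ℝ, 0 ≤ s → s ≤ 1 → interp φ k s ≤ L * wgt τ m ((1 - s) * 0 + s * (-1 / 5))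
      ((1 - s) * 0 + s * (-3 / 2)) * z := fun s h0 h1 => rpow_mul_rpow_le_wgt hτp hm h0 h1 hkH hkC
  have ig4 := ig (1 / 4) (by norm_num) (by norm_num)
  have ig34 := ig (1 - 1 / 4) (by norm_num) (by norm_num)
  have ik4 := ik (1 / 4) (by norm_num) (by norm_num)
  have hy : y ≤ y + S := le_self_add
  have t1 : (if τ ≤ t then normA φ h * interp φ g (1 / 4) * normH φ k else 0) ≤ U := by
    split_ifs with hle
    · have hm_one : m = 1 := min_eq_left ((one_le_div hτp).2 hle)
      -- For `t ≥ τ` the weight `m` equals one, so the negative `m`-exponent of the interpolated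
      -- norm may be replaced by zero.
      have h1 : interp φ g (1 / 4)
          ≤ L * wgt τ m ((1 - 1 / 4) * (1 / 2) + 1 / 4 * (1 / 30)) 0 * y := by
        rw [hm_one] at ig4 ⊢
        rwa [wgt_one] at ig4
      have := key 0 0 hh.A h1 hkH hy (by norm_num) (by norm_num) (by norm_num)
      rwa [wgt_zero, one_mul] at this
    · exact zero_le
  have t1' : (if t ≤ τ then normA φ h * normH φ g * interp φ k (1 / 2) else 0) ≤ U := by
    split_ifs with hle
    · have hmt : m = t / τ := min_eq_right ((div_le_one hτp).2 hle)
      -- The definition of the short-time term solved for `‖g‖`. Its factor `m^{3/4}` exactly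
      -- cancels the `m^{-3/4}` from interpolating `k` with exponent `1/2`.
      have h1 : normH φ g ≤ L * wgt τ m (1 / 2) (3 / 4) * S := by
        rw [hS, shortTime, if_pos hle, ← hmt, ENNReal.ofReal_rpow_of_pos hm,
          ← ENNReal.ofReal_mul (by positivity)]
        change _ ≤ L * wgt τ m (1 / 2) (3 / 4) * (wgt τ m _ _ * _)
        rw [← mul_assoc, mul_assoc L, wgt_mul hτp hm]
        norm_num only [wgt_zero, mul_one]
        exact le_mul_of_one_le_left zero_le hL
      have := key 0 0 hh.A h1 (ik (1 / 2) (by norm_num) (by norm_num)) le_add_self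
        (by norm_num) (by norm_num) (by norm_num)
      rwa [wgt_zero, one_mul] at this
    · exact zero_le
  have t2 := key (-8 / 15) 1 hh.A ig4 hkH hy (by norm_num) (by norm_num) (by norm_num)
  have t3 := key' (-8 / 15) 1 hh.AA hg.A ik4 hy (by norm_num) (by norm_num) (by norm_num)
  have t4 := key (2 / 5) 3 hh.AC hg.C ik4 hy (by norm_num) (by norm_num) (by norm_num)
  have t5 := key' (2 / 5) 3 hh.AC ig34 ik4 hy (by norm_num) (by norm_num) (by norm_num)
  have t6 := key' (-1 / 15) 2 hh.AA hg.C ik4 hy (by norm_num) (by norm_num) (by norm_num)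
  have t7 := key' (-1 / 15) 2 hh.AA ig34 ik4 hy (by norm_num) (by norm_num) (by norm_num)
  have t8 := key (-1 / 15) 2 hh.C ig4 hkH hy (by norm_num) (by norm_num) (by norm_num)
  have t9 := key' (-1 / 15) 2 hh.AC hg.A ik4 hy (by norm_num) (by norm_num) (by norm_num)
  rw [triRem, ← mul_add, ofReal_mul_pow_one, ofReal_mul_pow_two, ofReal_mul_pow_three,
    show betaColl 0 = -8 / 15 from rfl, show betaColl 1 = 2 / 5 from rfl,
    show betaColl 2 = -1 / 15 from rfl]
  refine mul_le_mul_right ?_ _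
  refine (add_le_add (add_le_add t1 t1') (add_le_add (add_le_add (add_le_add (add_le_add (add_le_add
    (add_le_add (add_le_add t2 t3) t4) t5) t6) t7) t8) t9)).trans_eq ?_
  ring

theorem quadRem_zero (τ δ : ℝ) (φ : Torus → ℝ) (h : Phase → ℝ) :
    quadRem betaColl τ δ 0 φ h = 0 := by
  simp [quadRem, wt]

/-- At `t = 0` only the short-time product `‖Ah‖ ‖g‖ [k]` survives. If one of `‖Ah‖`, `‖g‖`, `‖k‖`
vanishes, so does the left side; otherwise the singular factor makes the right side infinite. -/
theorem triRem_zero_le {γ : Fin 3 → ℝ} {τ δ K : ℝ} (hτ : 0 < τ) (hK : 0 < K) {φ : Torus → ℝ}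
    {η : Fin 9 → ℝ} {h g k : Phase → ℝ} :
    triRem betaColl η (1 / 2) τ δ 0 φ h g k ≤ ENNReal.ofReal K
      * dissipation γ betaColl τ 0 φ h ^ (1 / 2 : ℝ)
      * (dissipation γ betaColl τ 0 φ g ^ (1 / 2 : ℝ) + shortTime (1 / 2) τ 0 φ g)
      * energy γ betaColl τ δ 0 φ k ^ (1 / 2 : ℝ) := by
  have hwt : wt τ 0 = 0 := by simp [wt]
  have e : triRem betaColl η (1 / 2) τ δ 0 φ h g k
      = ENNReal.ofReal (1 / δ ^ 2) * (normA φ h * normH φ g * interp φ k (1 / 2)) := by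
    simp [triRem, hwt, hτ.le, hτ.not_ge]
  rw [e]
  by_cases hA : normA φ h = 0
  · simp [hA]
  by_cases hg : normH φ g = 0
  · simp [hg]
  by_cases hk : normH φ k = 0
  · rw [interp, hk, ENNReal.zero_rpow_of_pos (by norm_num)]
    simp
  have h1 : dissipation γ betaColl τ 0 φ h ^ (1 / 2 : ℝ) ≠ 0 := by
    simp [dissipation, hτ, hA]
  have h2 : energy γ betaColl τ δ 0 φ k ^ (1 / 2 : ℝ) ≠ 0 := by
    simp [energy, twistedSq, hk]
  have h3 : shortTime (1 / 2) τ 0 φ g = ⊤ := by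
    rw [shortTime, if_pos hτ.le, zero_div, ENNReal.ofReal_zero,
      ENNReal.zero_rpow_of_neg (by norm_num), ENNReal.mul_top, ENNReal.top_mul hg]
    have : 0 < τ ^ (-(1 / 2) : ℝ) := by positivity
    simpa using this
  rw [h3, add_top, ENNReal.mul_top, ENNReal.top_mul h2]
  · exact le_top
  · exact mul_ne_zero (by simpa using hK) h1

end VPFP

end

/-! ### Choice of the constants and conclusion. -/

theorem proposition8p2 (ε τ₀ : ℝ) (hε : 0 < ε) (hτ₀ : 0 < τ₀)
    (γ : Fin 3 → ℝ) (hγ : ∀ i, 0 < γ i) (hγ' : VPFP.NormEquivalence γ VPFP.betaColl τ₀)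
    (p : ℝ≥0∞) (hp : 2 < p) (ρ : VPFP.Torus → ℝ) (hρ : VPFP.MemW1 p ρ) (hρ' : ∫ x, ρ x = 1)
    (δ₀ : ℝ) (hδ₀ : 0 < δ₀) :
    ∃ η : Fin 9 → ℝ, (∀ i, η i ∈ Ioo (0 : ℝ) 1) ∧ ∃ η' ∈ Ioo (0 : ℝ) 1, ∃ K : ℝ, 0 < K ∧
      ∀ t ≥ 0, ∀ τ > τ₀, ∀ δ > δ₀, ∀ φ : VPFP.Torus → ℝ, VPFP.IsPoissonBoltzmann δ ρ φ →
      ∀ h g k : VPFP.Phase → ℝ, VPFP.MemH0 φ h → VPFP.MemH0 φ g → VPFP.MemH0 φ k →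
        VPFP.quadRem VPFP.betaColl τ δ t φ h
          ≤ ENNReal.ofReal (K * τ ^ (14 / 15 : ℝ) / δ ^ 2)
            * VPFP.dissipation γ VPFP.betaColl τ t φ h
        ∧ VPFP.triRem VPFP.betaColl η η' τ δ t φ h g k
          ≤ ENNReal.ofReal (K * τ ^ (14 / 15 + ε : ℝ) / δ ^ 2)
            * VPFP.dissipation γ VPFP.betaColl τ t φ h ^ (1 / 2 : ℝ)
            * (VPFP.dissipation γ VPFP.betaColl τ t φ g ^ (1 / 2 : ℝ)
                + VPFP.shortTime η' τ t φ g)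
            * VPFP.energy γ VPFP.betaColl τ δ t φ k ^ (1 / 2 : ℝ) := by
  obtain ⟨c₀, C₀, hc₀, -, hequiv⟩ := hγ'
  obtain ⟨B, hB, hcomp⟩ := VPFP.exists_isComparable hp hρ hρ' hδ₀
  -- Large enough for every exponent gap: at most `1` in the quadratic terms, and at most `14/15 +
  -- ε` in the trilinear ones, whose exponents are nonnegative.
  set N : ℝ := 1 + ε with hN
  set R : ℝ := min 1 τ₀ ^ (-N) with hR
  have hRpos : 0 < R := Real.rpow_pos_of_pos (lt_min one_pos hτ₀) _
  set L := VPFP.boundConst γ B c₀ R with hL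
  have hL1 : 1 ≤ L := by
    rw [hL, VPFP.boundConst]
    simp only [add_assoc]
    exact le_self_add
  have hLtop : L ≠ ⊤ := VPFP.boundConst_ne_top _ _ _ _
  have hLpos : 0 < L.toReal := ENNReal.toReal_pos (one_pos.trans_le hL1).ne' hLtop
  have hcast : ∀ {τ δ m P : ℝ}, 0 < τ → ENNReal.ofReal (1 / δ ^ 2)
      * (10 * (L ^ 3 * ENNReal.ofReal R * VPFP.wgt τ m P 0))
      = ENNReal.ofReal (10 * (L.toReal ^ 3 * R) * τ ^ P / δ ^ 2) := by
    intro τ δ m P hτ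
    rw [VPFP.wgt, Real.rpow_zero, mul_one, ← ENNReal.ofReal_toReal hLtop,
      ← ENNReal.ofReal_pow hLpos.le, ← ENNReal.ofReal_mul (by positivity),
      ← ENNReal.ofReal_mul (by positivity), ← ENNReal.ofReal_ofNat,
      ← ENNReal.ofReal_mul (by positivity), ← ENNReal.ofReal_mul (by positivity),
      ENNReal.toReal_ofReal hLpos.le]
    congr 1
    ring
  -- In `K`, the cube of `L` comes from products of three bounds, and `10` covers both the ten
  -- trilinear and the five quadratic terms. Since `B` depends only on `ρ` and `δ₀`, the constant is
  -- uniform in `t`, `τ` and `δ`.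
  refine ⟨fun _ => 1 / 4, fun _ => by norm_num, 1 / 2, by norm_num, 10 * (L.toReal ^ 3 * R),
    by positivity, fun t ht τ hτ δ hδ φ hφ h g k hh hg hk => ?_⟩
  have hτp : 0 < τ := hτ₀.trans hτ
  have hδp : 0 < δ := hδ₀.trans hδ
  rcases eq_or_lt_of_le (show 0 ≤ t from ht) with rfl | htp
  · exact ⟨by rw [VPFP.quadRem_zero]; exact zero_le, VPFP.triRem_zero_le hτp (by positivity)⟩
  have hcφ := hcomp δ hδ φ hφ
  have bh := VPFP.dissipationBounds hγ hcφ c₀ (N := N) (by linarith) hτ₀ hτ htp hh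
  have bg := VPFP.dissipationBounds hγ hcφ c₀ (N := N) (by linarith) hτ₀ hτ htp hg
  obtain ⟨bkH, bkC⟩ := VPFP.energyBounds (γ := γ) (B := B) (R := R) (δ := δ) hc₀ hτp htp
    (hequiv p ρ hp hρ hρ' δ hδp φ hφ τ hτ t ht k hk.1).1
  constructor
  · refine (VPFP.quadRem_le (N := N) (by linarith) hτ₀ hτ htp hL1 bh).trans ?_
    rw [← hcast hτp (m := VPFP.wt τ t), ← hR]
    calc _ ≤ ENNReal.ofReal (1 / δ ^ 2) * (10 * (L ^ 3 * ENNReal.ofReal R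
          * VPFP.wgt τ (VPFP.wt τ t) (14 / 15) 0 * VPFP.dissipation γ VPFP.betaColl τ t φ h)) := by
          gcongr
          norm_num
      _ = _ := by ring
  · refine (VPFP.triRem_le (P := 14 / 15 + ε) (N := N) (by linarith) (by linarith) hτ₀ hτ htp hL1
      bh bg bkH bkC).trans_eq ?_
    rw [← hcast hτp (m := VPFP.wt τ t), ← hR]
    ring
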